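/- A \emph{$\pi/3$-equiangular polyhedron} in hyperbolic $3$-space $\mathbb{H}^3$ is a set $P\subset\mathbb{H}^3$ that is the intersection of finitely many closed half-spaces, has non-empty interior and finite volume, and all of whose dihedral angles (between faces that meet in an edge) are equal to $\pi/3$. Let $P_1$ be the regular ideal tetrahedron and $P_2$ the regular ideal cube in $\mathbb{H}^3$, i.e. the hyperbolic convex hulls of the vertices of a regular tetrahedron, respectively a cube, inscribed in the sphere at infinity of the ball model. \textbf{Theorem.} Among all $\pi/3$-equiangular polyhedra in $\mathbb{H}^3$, the cube $P_2$ has the second smallest volume, and only $P_1$ has smaller volume. Precisely: $P_1$ and $P_2$ are $\pi/3$-equiangular polyhedra, $\operatorname{vol}(P_1)<\operatorname{vol}(P_2)$, and every $\pi/3$-equiangular polyhedron $P\subset\mathbb{H}^3$ satisfies exactly one of the following: $P$ is isometric to $P_1$ (and then $\operatorname{vol}(P)=\operatorname{vol}(P_1)$); $P$ is isometric to $P_2$ (and then $\operatorname{vol}(P)=\operatorname{vol}(P_2)$); or $\operatorname{vol}(P)>\operatorname{vol}(P_2)$. -/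

import Mathlib

open MeasureTheory

noncomputable section

namespace HypPoly

/-- Euclidean three-space. -/
abbrev E3 : Type := EuclideanSpace ℝ (Fin 3)

/-- The vector space underlying Minkowski space `ℝ^{1,3}`: a time and a space coordinate. -/
abbrev Mink : Type := ℝ × E3

/-- The Lorentzian inner product, of signature `(-,+,+,+)`. -/
def lor (v w : Mink) : ℝ := -(v.1 * w.1) + inner ℝ v.2 w.2

/-- Hyperbolic three-space: the upper sheet of the hyperboloid `⟨v, v⟩ = -1`. -/
def H3 : Type := {v : Mink // lor v v = -1 ∧ 0 < v.1}

instance : MeasurableSpace H3 :=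
  inferInstanceAs (MeasurableSpace {v : Mink // lor v v = -1 ∧ 0 < v.1})

/-- The hyperbolic distance: `cosh d(x, y) = -⟨x, y⟩`. -/
def hdist (x y : H3) : ℝ := Real.arcosh (-lor x.1 y.1)

/-- Two subsets of hyperbolic space are congruent if an isometry of hyperbolic space carries the
first onto the second. -/
def Congruent (P Q : Set H3) : Prop :=
  ∃ φ : H3 ≃ H3, (∀ x y, hdist (φ x) (φ y) = hdist x y) ∧ φ '' P = Q

/-- The point of the hyperboloid with given space coordinate. -/
def lift (y : E3) : H3 :=
  ⟨(√(1 + ‖y‖ ^ 2), y), by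
    have h : (0 : ℝ) < 1 + ‖y‖ ^ 2 := by positivity
    refine ⟨?_, Real.sqrt_pos.mpr h⟩
    simp only [lor, Real.mul_self_sqrt h.le, real_inner_self_eq_norm_sq]
    ring⟩

/-- The hyperbolic volume, `dy₁ dy₂ dy₃ / √(1 + |y|²)` in the space coordinates of the
hyperboloid model. -/
def vol : Measure H3 :=
  ((volume : Measure E3).withDensity
    fun y => ENNReal.ofReal (1 / √(1 + ‖y‖ ^ 2))).map lift

/-- The closed half-space with outward normal `e` (used for `⟨e, e⟩ = 1`). -/
def halfSpace (e : Mink) : Set H3 := {x | lor x.1 e ≤ 0}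

/-- The hyperplane with normal `e` (used for `⟨e, e⟩ = 1`). -/
def hyperplane (e : Mink) : Set H3 := {x | lor x.1 e = 0}

/-- The dimension of the linear span of a set of points of the hyperboloid. The smallest hyperbolic
subspace that contains a nonempty set has dimension one less. -/
def spanRank (A : Set H3) : ℕ :=
  Module.finrank ℝ (Submodule.span ℝ ((fun x : H3 => x.1) '' A))

/-- A convex polyhedron: an intersection of finitely many closed half-spaces that has an interior
point. -/
def IsConvexPolyhedron (P : Set H3) : Prop :=
  (∃ N : Finset Mink, (∀ e ∈ N, lor e e = 1) ∧ P = ⋂ e ∈ N, halfSpace e) ∧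
    ∃ x, ∃ r > 0, {y | hdist x y < r} ⊆ P

/-- The unit vector `e` is the outward normal of a (two-dimensional) face of `P`; that face is
`P ∩ hyperplane e`. -/
def IsFaceNormal (P : Set H3) (e : Mink) : Prop :=
  lor e e = 1 ∧ P ⊆ halfSpace e ∧ spanRank (P ∩ hyperplane e) = 3

/-- The faces of `P` with outward normals `e` and `f` are distinct and meet in an edge, that is, in
a one-dimensional set. -/
def Adjacent (P : Set H3) (e f : Mink) : Prop :=
  IsFaceNormal P e ∧ IsFaceNormal P f ∧ e ≠ f ∧
    spanRank ((P ∩ hyperplane e) ∩ (P ∩ hyperplane f)) = 2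

/-- The dihedral angle at the edge between two adjacent faces: `π` minus the angle between their
outward unit normals. The latter lie in the tangent space at any point of the edge, where the
Lorentzian inner product is the Riemannian metric. -/
def dihedralAngle (e f : Mink) : ℝ := Real.pi - Real.arccos (lor e f)

/-- A convex polyhedron of finite volume all of whose dihedral angles are equal to `θ`. -/
def IsEquiangular (θ : ℝ) (P : Set H3) : Prop :=
  IsConvexPolyhedron P ∧ vol P < ⊤ ∧ ∀ e f, Adjacent P e f → dihedralAngle e f = θ

/-- The hyperbolic convex hull in `H3` of a set `S` of ideal points, the sphere at infinity being
the unit sphere of `E3`: the convex hull is taken in the projective (Klein) model, to which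
`x ↦ x.space / x.time` maps the hyperboloid. -/
def idealHull (S : Set E3) : Set H3 := {x | (x.1.1)⁻¹ • x.1.2 ∈ convexHull ℝ S}

/-- The vertices of a cube inscribed in the unit sphere. -/
def cubeVertices : Set E3 := {v | ∀ i, v i = 1 / √3 ∨ v i = -(1 / √3)}

/-- The vertices of a regular tetrahedron inscribed in the unit sphere: every other vertex of the
cube. -/
def tetrahedronVertices : Set E3 := {v | v ∈ cubeVertices ∧ 0 < v 0 * v 1 * v 2}

/-- The regular ideal tetrahedron. -/
def P₁ : Set H3 := idealHull tetrahedronVertices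

/-- The regular ideal cube. -/
def P₂ : Set H3 := idealHull cubeVertices

end HypPoly

end

/-!
Normalise the outward normals of a `π / 3`-equiangular polyhedron to unit vectors. The Lorentzian
product of two of them is `-1 / 2` if the faces are adjacent and at most `-1` otherwise, and finite
volume means that the cone over the polyhedron contains no spacelike vector. Three planes that meet
pairwise at angles `π / 3` have a common ideal point, so every vertex is ideal and lies on exactly
three faces, and every edge joins two vertices.

Four pairwise adjacent faces bound a regular ideal tetrahedron. Otherwise, for each face `e i` at a
given vertex, the edge between the other two faces has its second end on a face `a i` that is not
adjacent to `e i`. If the `a i` are pairwise adjacent, the six faces bound the regular ideal cube.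
If not, there are at least seven faces; each has at least four vertices, so there are at least
`7 * 4 / 3 > 9` vertices.
The cell of a vertex, on which its null vector gives the least height among all vertices, has
volume at least `1 / √3`, so the volume is at least `10 / √3`. The cube is the union of `48` copies
of a region of volume at most `143 / (720 * √3)`, hence smaller, since `48 * 143 / 720 < 10`.
-/

namespace HypPoly

/-! ### The Lorentzian form -/

lemma lor_comm (v w : Mink) : lor v w = lor w v := by
  simp only [lor, real_inner_comm, mul_comm]

lemma lor_add_left (u v w : Mink) : lor (u + v) w = lor u w + lor v w := by
  simp only [lor, Prod.fst_add, Prod.snd_add, inner_add_left]; ring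

lemma lor_smul_left (c : ℝ) (v w : Mink) : lor (c • v) w = c * lor v w := by
  simp only [lor, Prod.smul_fst, Prod.smul_snd, real_inner_smul_left, smul_eq_mul]; ring

lemma lor_add_right (u v w : Mink) : lor u (v + w) = lor u v + lor u w := by
  rw [lor_comm, lor_add_left, lor_comm v, lor_comm w]

lemma lor_smul_right (c : ℝ) (v w : Mink) : lor v (c • w) = c * lor v w := by
  rw [lor_comm, lor_smul_left, lor_comm w]

lemma lor_neg_left (v w : Mink) : lor (-v) w = -lor v w := by
  rw [← neg_one_smul ℝ v, lor_smul_left, neg_one_mul]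

lemma lor_neg_right (v w : Mink) : lor v (-w) = -lor v w := by
  rw [lor_comm, lor_neg_left, lor_comm]

lemma lor_neg_neg (v w : Mink) : lor (-v) (-w) = lor v w := by
  rw [lor_neg_left, lor_neg_right, neg_neg]

lemma lor_sub_left (u v w : Mink) : lor (u - v) w = lor u w - lor v w := by
  rw [sub_eq_add_neg, lor_add_left, lor_neg_left, ← sub_eq_add_neg]

lemma lor_sub_right (u v w : Mink) : lor u (v - w) = lor u v - lor u w := by
  rw [sub_eq_add_neg, lor_add_right, lor_neg_right, ← sub_eq_add_neg]

lemma lor_zero_left (v : Mink) : lor 0 v = 0 := by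
  simp only [lor, Prod.fst_zero, Prod.snd_zero, zero_mul, neg_zero, inner_zero_left, add_zero]

lemma lor_zero_right (v : Mink) : lor v 0 = 0 := by
  rw [lor_comm, lor_zero_left]

/-- The linear functional `⟨·, e⟩`, through which orthogonality becomes linear algebra. -/
noncomputable def lorDual (e : Mink) : Mink →ₗ[ℝ] ℝ where
  toFun x := lor x e
  map_add' x y := lor_add_left x y e
  map_smul' c x := lor_smul_left c x e

@[simp] lemma lorDual_apply (e x : Mink) : lorDual e x = lor x e := rfl

lemma lor_sum_left {ι : Type*} (s : Finset ι) (f : ι → Mink) (w : Mink) :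
    lor (∑ i ∈ s, f i) w = ∑ i ∈ s, lor (f i) w :=
  map_sum (lorDual w) f s

lemma lor_self (v : Mink) : lor v v = ‖v.2‖ ^ 2 - v.1 ^ 2 := by
  simp only [lor, real_inner_self_eq_norm_sq]; ring

lemma continuous_lor : Continuous fun p : Mink × Mink => lor p.1 p.2 := by
  unfold lor; fun_prop

lemma continuous_lor_comp {X : Type*} [TopologicalSpace X] {f g : X → Mink} (hf : Continuous f)
    (hg : Continuous g) : Continuous fun x => lor (f x) (g x) :=
  continuous_lor.comp (hf.prodMk hg)

lemma eq_zero_of_forall_lor_eq_zero {v : Mink} (h : ∀ w, lor v w = 0) : v = 0 := by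
  have htime := h (1, 0)
  have hspace := h (0, v.2)
  simp only [lor, inner_zero_right, mul_one, mul_zero, neg_zero, zero_add, add_zero,
    real_inner_self_eq_norm_sq, neg_eq_zero, sq_eq_zero_iff, norm_eq_zero] at htime hspace
  exact Prod.ext htime hspace

lemma finrank_mink : Module.finrank ℝ Mink = 4 := by
  simp only [Mink, E3, Module.finrank_prod, Module.finrank_self, finrank_euclideanSpace,
    Fintype.card_fin]

/-! ### Orthogonal complements -/

/-- The orthogonal complement of a vector for the Lorentzian form; for a unit spacelike `e` it
spans the hyperplane with normal `e`. -/
noncomputable def perp (e : Mink) : Submodule ℝ Mink := LinearMap.ker (lorDual e)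

lemma mem_perp {e w : Mink} : w ∈ perp e ↔ lor w e = 0 := LinearMap.mem_ker

lemma finrank_perp {e : Mink} (he : e ≠ 0) : Module.finrank ℝ (perp e) = 3 := by
  have hne : lorDual e ≠ 0 := fun h =>
    he (eq_zero_of_forall_lor_eq_zero fun w => by rw [lor_comm, ← lorDual_apply, h]; rfl)
  have h := Module.Dual.finrank_ker_add_one_of_ne_zero hne
  rw [finrank_mink] at h
  exact Nat.succ_injective h

lemma finrank_le_finrank_inf_perp_add_one (W : Submodule ℝ Mink) (e : Mink) :
    Module.finrank ℝ W ≤ Module.finrank ℝ (W ⊓ perp e : Submodule ℝ Mink) + 1 := by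
  rcases eq_or_ne e 0 with rfl | he
  · have htop : perp 0 = ⊤ := eq_top_iff.mpr fun w _ => mem_perp.mpr (lor_zero_right w)
    rw [htop, inf_top_eq]
    exact Nat.le_succ _
  · have h := Submodule.finrank_sup_add_finrank_inf_eq W (perp e)
    have hsup := Submodule.finrank_le (W ⊔ perp e)
    rw [finrank_mink] at hsup
    rw [finrank_perp he] at h
    omega

lemma ne_zero_of_lor_self_ne_zero {e : Mink} (h : lor e e ≠ 0) : e ≠ 0 := by
  rintro rfl
  exact h (lor_zero_left 0)

lemma finrank_perp_inf_perp {e f : Mink} (he : lor e e ≠ 0)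
    (hgram : lor e f ^ 2 ≠ lor e e * lor f f) :
    Module.finrank ℝ (perp e ⊓ perp f : Submodule ℝ Mink) = 2 := by
  have hlt : perp e ⊓ perp f < perp e := by
    refine lt_of_le_of_ne inf_le_left fun heq => hgram ?_
    have hmem : lor e e • f - lor e f • e ∈ perp e := by
      rw [mem_perp, lor_sub_left, lor_smul_left, lor_smul_left, lor_comm f e]; ring
    have hf := (heq.ge hmem).2
    rw [SetLike.mem_coe, mem_perp, lor_sub_left, lor_smul_left, lor_smul_left] at hf
    linarith
  have hupper := Submodule.finrank_lt_finrank_of_lt hlt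
  have hlower := finrank_le_finrank_inf_perp_add_one (perp e) f
  rw [finrank_perp (ne_zero_of_lor_self_ne_zero he)] at hupper hlower
  omega

lemma linearIndependent_of_null {n : Fin 3 → Mink} (hnull : ∀ i, lor (n i) (n i) = 0)
    (hne : ∀ i j, i ≠ j → lor (n i) (n j) ≠ 0) : LinearIndependent ℝ n := by
  rw [Fintype.linearIndependent_iff]
  intro c hc
  have hpair : ∀ j, c 0 * lor (n 0) (n j) + c 1 * lor (n 1) (n j) + c 2 * lor (n 2) (n j) = 0 := by
    intro j
    have h := congrArg (lor · (n j)) hc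
    simpa only [Fin.sum_univ_three, lor_add_left, lor_smul_left, lor_zero_left] using h
  have h0 := hpair 0
  have h1 := hpair 1
  have h2 := hpair 2
  rw [hnull, lor_comm (n 1), lor_comm (n 2)] at h0
  rw [hnull, lor_comm (n 2)] at h1
  rw [hnull] at h2
  have h01 := hne 0 1 (by decide)
  have h02 := hne 0 2 (by decide)
  have h12 := hne 1 2 (by decide)
  -- The Gram matrix has zero diagonal, so its determinant is twice the product of these entries.
  generalize lor (n 0) (n 1) = p, lor (n 0) (n 2) = q, lor (n 1) (n 2) = r at *
  have hc0 : c 0 = 0 := by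
    have h : c 0 * (2 * p * q) = 0 := by linear_combination p * h2 + q * h1 - r * h0
    simpa [h01, h02] using h
  have hc1 : c 1 = 0 := by
    have h : c 1 * r = 0 := by linear_combination h2 - q * hc0
    simpa [h12] using h
  have hc2 : c 2 = 0 := by
    have h : c 2 * r = 0 := by linear_combination h1 - p * hc0
    simpa [h12] using h
  intro i
  fin_cases i
  exacts [hc0, hc1, hc2]

/-! ### Causal vectors -/

lemma time_ne_zero {p : Mink} (hp : lor p p ≤ 0) (h0 : p ≠ 0) : p.1 ≠ 0 := by
  contrapose! h0
  rw [lor_self, h0] at hp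
  have hspace : ‖p.2‖ ^ 2 = 0 := le_antisymm (by simpa using hp) (sq_nonneg _)
  exact Prod.ext h0 (norm_eq_zero.mp (sq_eq_zero_iff.mp hspace))

/-- Subtracting from `w` the multiple of `p` with the same time coordinate leaves a purely spatial
vector, whose norm is compared with `⟨w, w⟩`. -/
lemma exists_norm_sub_smul_sq_eq {p w : Mink} (hp : lor p p ≤ 0) (h0 : p ≠ 0)
    (h : lor p w = 0) :
    ∃ c : ℝ, (w - c • p).1 = 0 ∧ ‖(w - c • p).2‖ ^ 2 = lor w w + c ^ 2 * lor p p := by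
  have htime : (w - (w.1 / p.1) • p).1 = 0 := by
    rw [Prod.fst_sub, Prod.smul_fst, smul_eq_mul, div_mul_cancel₀ _ (time_ne_zero hp h0), sub_self]
  refine ⟨w.1 / p.1, htime, ?_⟩
  have hself := lor_self (w - (w.1 / p.1) • p)
  simp only [htime, lor_sub_left, lor_sub_right, lor_smul_left, lor_smul_right, h,
    lor_comm w p] at hself
  linarith

lemma lor_self_nonneg_of_orthogonal {p w : Mink} (hp : lor p p ≤ 0) (h0 : p ≠ 0)
    (h : lor p w = 0) : 0 ≤ lor w w := by
  obtain ⟨c, -, hnorm⟩ := exists_norm_sub_smul_sq_eq hp h0 h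
  nlinarith [sq_nonneg ‖(w - c • p).2‖, mul_nonneg (sq_nonneg c) (neg_nonneg.mpr hp)]

lemma exists_eq_smul_of_orthogonal {p w : Mink} (hp : lor p p ≤ 0) (h0 : p ≠ 0)
    (h : lor p w = 0) (hw : lor w w = 0) : ∃ c : ℝ, w = c • p := by
  obtain ⟨c, htime, hnorm⟩ := exists_norm_sub_smul_sq_eq hp h0 h
  have hspace : ‖(w - c • p).2‖ ^ 2 = 0 :=
    le_antisymm (by nlinarith [mul_nonneg (sq_nonneg c) (neg_nonneg.mpr hp)]) (sq_nonneg _)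
  exact ⟨c, sub_eq_zero.mp (Prod.ext htime (norm_eq_zero.mp (sq_eq_zero_iff.mp hspace)))⟩

lemma lor_self_pos_of_orthogonal {p w : Mink} (hp : lor p p < 0) (h : lor p w = 0)
    (hw : w ≠ 0) : 0 < lor w w := by
  have h0 : p ≠ 0 := ne_zero_of_lor_self_ne_zero hp.ne
  refine lt_of_le_of_ne (lor_self_nonneg_of_orthogonal hp.le h0 h) fun hnull => hw ?_
  obtain ⟨c, rfl⟩ := exists_eq_smul_of_orthogonal hp.le h0 h hnull.symm
  rw [lor_smul_right] at h
  rw [(mul_eq_zero.mp h).resolve_right hp.ne, zero_smul]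

lemma norm_le_time {n : Mink} (h : lor n n ≤ 0) (h0 : 0 ≤ n.1) : ‖n.2‖ ≤ n.1 := by
  rw [lor_self] at h
  exact (abs_le_of_sq_le_sq' (by linarith) h0).2

lemma norm_lt_time {n : Mink} (h : lor n n < 0) (h0 : 0 ≤ n.1) : ‖n.2‖ < n.1 := by
  rw [lor_self] at h
  exact (abs_lt_of_sq_lt_sq' (by linarith) h0).2

lemma lor_neg_of_future {x n : Mink} (hx : lor x x < 0) (hx0 : 0 < x.1) (hn : lor n n ≤ 0)
    (hn0 : 0 < n.1) : lor x n < 0 := by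
  have hspace : inner ℝ x.2 n.2 < x.1 * n.1 :=
    calc inner ℝ x.2 n.2 ≤ ‖x.2‖ * ‖n.2‖ := real_inner_le_norm _ _
      _ ≤ ‖x.2‖ * n.1 := by gcongr; exact norm_le_time hn hn0.le
      _ < x.1 * n.1 := by gcongr; exact norm_lt_time hx hx0.le
  unfold lor; linarith

lemma future_of_lor_neg {x n : Mink} (hx : lor x x < 0) (hn : lor n n ≤ 0) (hn0 : 0 < n.1)
    (h : lor x n < 0) : 0 < x.1 := by
  have hx0 := time_ne_zero hx.le (ne_zero_of_lor_self_ne_zero hx.ne)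
  refine (lt_or_gt_of_ne hx0).resolve_left fun hpast => ?_
  have hneg := lor_neg_of_future (x := -x) (by rwa [lor_neg_neg]) (neg_pos.mpr hpast) hn hn0
  rw [lor_neg_left] at hneg
  linarith

lemma H3.lor_self_neg (x : H3) : lor x.1 x.1 < 0 := by
  rw [x.2.1]; exact neg_one_lt_zero

lemma H3.lor_neg (x : H3) {n : Mink} (hn : lor n n ≤ 0) (hn0 : 0 < n.1) : lor x.1 n < 0 :=
  lor_neg_of_future x.lor_self_neg x.2.2 hn hn0

lemma H3.future_of_lor_neg (x : H3) {n : Mink} (hn : lor n n ≤ 0) (h : lor x.1 n < 0) :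
    0 < n.1 := by
  have hn0 : n ≠ 0 := by rintro rfl; rw [lor_zero_right] at h; exact h.false
  refine (lt_or_gt_of_ne (time_ne_zero hn hn0)).resolve_left fun hpast => ?_
  have hneg := x.lor_neg (n := -n) (by rwa [lor_neg_neg]) (neg_pos.mpr hpast)
  rw [lor_neg_right] at hneg
  linarith

lemma exists_H3_smul {w : Mink} (hw : lor w w < 0) (h0 : 0 < w.1) :
    ∃ x : H3, ∃ c : ℝ, 0 < c ∧ w = c • x.1 := by
  have hs : 0 < √(-lor w w) := Real.sqrt_pos.mpr (neg_pos.mpr hw)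
  refine ⟨⟨(√(-lor w w))⁻¹ • w, ?_, mul_pos (inv_pos.mpr hs) h0⟩, √(-lor w w), hs, ?_⟩
  · rw [lor_smul_left, lor_smul_right, ← mul_assoc, ← mul_inv, Real.mul_self_sqrt (by linarith),
      inv_mul_eq_div, neg_eq_neg_one_mul, div_mul_cancel_right₀ hw.ne]
    norm_num
  · rw [smul_inv_smul₀ hs.ne']

/-! ### Unit normals of half-spaces -/

lemma lor_add_self_of_unit {e f : Mink} (he : lor e e = 1) (hf : lor f f = 1) :
    lor (e + f) (e + f) = 2 + 2 * lor e f := by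
  rw [lor_add_left, lor_add_right, lor_add_right, he, hf, lor_comm f e]; ring

lemma neg_one_le_lor_of_perp {p e f : Mink} (hp : lor p p ≤ 0) (h0 : p ≠ 0)
    (he : lor e e = 1) (hf : lor f f = 1) (hpe : lor p e = 0) (hpf : lor p f = 0) :
    -1 ≤ lor e f := by
  have h := lor_self_nonneg_of_orthogonal hp h0 (w := e + f)
    (by rw [lor_add_right, hpe, hpf, add_zero])
  rw [lor_add_self_of_unit he hf] at h
  linarith

lemma exists_add_eq_smul_of_perp {p e f : Mink} (hp : lor p p ≤ 0) (h0 : p ≠ 0)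
    (he : lor e e = 1) (hf : lor f f = 1) (hpe : lor p e = 0) (hpf : lor p f = 0)
    (hef : lor e f = -1) : ∃ c : ℝ, e + f = c • p :=
  exists_eq_smul_of_orthogonal hp h0 (by rw [lor_add_right, hpe, hpf, add_zero])
    (by rw [lor_add_self_of_unit he hf, hef]; norm_num)

lemma exists_face_proj (x : H3) {e : Mink} (he : lor e e = 1) (hxe : lor x.1 e < 0) :
    ∃ z : Mink, lor z e = 0 ∧ lor z z < 0 ∧ 0 < z.1 ∧
      ∀ g, lor e g ≤ 0 → lor x.1 g < 0 → lor z g < 0 := by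
  set z := x.1 - lor x.1 e • e with hz
  have hze : lor z e = 0 := by
    rw [hz, lor_sub_left, lor_smul_left, he, mul_one, sub_self]
  have hxz : lor x.1 z < 0 := by
    rw [hz, lor_sub_right, lor_smul_right, x.2.1]
    nlinarith
  have hzz : lor z z < 0 := by
    rwa [hz, lor_sub_right, lor_smul_right, hze, mul_zero, sub_zero, lor_comm]
  refine ⟨z, hze, hzz, x.future_of_lor_neg hzz.le hxz, fun g heg hxg => ?_⟩
  rw [hz, lor_sub_left, lor_smul_left]
  nlinarith [mul_nonneg_of_nonpos_of_nonpos hxe.le heg]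

lemma exists_edge_proj (x : H3) {e f : Mink} (he : lor e e = 1) (hf : lor f f = 1)
    (hlow : -1 < lor e f) (hef : lor e f ≤ 0) (hxe : lor x.1 e < 0) (hxf : lor x.1 f < 0) :
    ∃ z : Mink, lor z e = 0 ∧ lor z f = 0 ∧ lor z z < 0 ∧ 0 < z.1 ∧
      ∀ g, lor e g ≤ 0 → lor f g ≤ 0 → lor x.1 g < 0 → lor z g < 0 := by
  set c := lor e f with hc
  have hD : 0 < 1 - c ^ 2 := by nlinarith
  -- The component of `x` in the span of `e` and `f` is `α • e + β • f`.
  obtain ⟨α, hα⟩ : ∃ α, α = (lor x.1 e - c * lor x.1 f) / (1 - c ^ 2) := ⟨_, rfl⟩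
  obtain ⟨β, hβ⟩ : ∃ β, β = (lor x.1 f - c * lor x.1 e) / (1 - c ^ 2) := ⟨_, rfl⟩
  have hα0 : α < 0 := hα ▸ div_neg_of_neg_of_pos (by nlinarith) hD
  have hβ0 : β < 0 := hβ ▸ div_neg_of_neg_of_pos (by nlinarith) hD
  have hxe' : lor x.1 e = α + β * c := by rw [hα, hβ]; field_simp; ring
  have hxf' : lor x.1 f = α * c + β := by rw [hα, hβ]; field_simp; ring
  set z := x.1 - α • e - β • f with hz
  have hze : lor z e = 0 := by
    simp only [hz, lor_sub_left, lor_smul_left, he, lor_comm f e, ← hc, hxe']; ring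
  have hzf : lor z f = 0 := by
    simp only [hz, lor_sub_left, lor_smul_left, hf, ← hc, hxf']; ring
  have hxz : lor x.1 z < 0 := by
    simp only [hz, lor_sub_right, lor_smul_right, x.2.1]
    nlinarith [mul_pos_of_neg_of_neg hα0 hxe, mul_pos_of_neg_of_neg hβ0 hxf]
  have hzz : lor z z < 0 := by
    have h : lor z z = lor x.1 z := by
      nth_rw 2 [hz]
      rw [lor_sub_right, lor_sub_right, lor_smul_right, lor_smul_right, hze, hzf, lor_comm z]
      ring
    rwa [h]
  refine ⟨z, hze, hzf, hzz, x.future_of_lor_neg hzz.le hxz, fun g heg hfg hxg => ?_⟩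
  simp only [hz, lor_sub_left, lor_smul_left]
  nlinarith [mul_nonneg_of_nonpos_of_nonpos hα0.le heg, mul_nonneg_of_nonpos_of_nonpos hβ0.le hfg]

/-! ### Systems of normals with dihedral angles `π / 3` -/

/-- The outward unit normals of a polyhedron of finite volume whose dihedral angles are `π / 3`:
faces are adjacent when their normals have product `-1 / 2`, and otherwise their planes do not
cross. Finiteness of the volume is encoded by `causal`: the cone over the polyhedron contains no
spacelike vector. -/
structure NormalSystem (N : Finset Mink) : Prop where
  unit : ∀ e ∈ N, lor e e = 1
  interior : ∃ x : H3, ∀ e ∈ N, lor x.1 e < 0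
  gram : ∀ e ∈ N, ∀ f ∈ N, e ≠ f → lor e f = -1 / 2 ∨ lor e f ≤ -1
  causal : ∀ w, (∀ e ∈ N, lor w e ≤ 0) → lor w w ≤ 0

lemma exists_pairwise_linearIndependent (K V : Type*) [Field K] [AddCommGroup V] [Module K V]
    (h : 1 < Module.finrank K V) :
    ∃ u : K → V, Pairwise fun s t => LinearIndependent K ![u s, u t] := by
  have : Nontrivial V := Module.nontrivial_of_finrank_pos (zero_lt_one.trans h)
  obtain ⟨w, hw⟩ := exists_ne (0 : V)
  obtain ⟨v, hwv⟩ := exists_linearIndependent_pair_of_one_lt_finrank h hw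
  refine ⟨fun t => v + t • w, fun s t hst => LinearIndependent.pair_iff.mpr fun a b hab => ?_⟩
  obtain ⟨hw0, hv0⟩ := LinearIndependent.pair_iff.mp hwv (a * s + b * t) (a + b)
    (by rw [← hab]; module)
  have ha : a = 0 := by
    refine (mul_eq_zero.mp ?_).resolve_right (sub_ne_zero.mpr hst)
    linear_combination hw0 - t * hv0
  exact ⟨ha, by rwa [ha, zero_add] at hv0⟩

namespace NormalSystem

variable {N : Finset Mink}

lemma le_neg_half (h : NormalSystem N) {e f : Mink} (he : e ∈ N) (hf : f ∈ N) (hef : e ≠ f) :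
    lor e f ≤ -1 / 2 := by
  rcases h.gram e he f hf hef with h | h <;> linarith

lemma ne_of_adj (h : NormalSystem N) {e f : Mink} (he : e ∈ N) (hef : lor e f = -1 / 2) :
    e ≠ f := by
  rintro rfl
  rw [h.unit e he] at hef
  norm_num at hef

lemma add_ne_zero (h : NormalSystem N) {e f : Mink} (he : e ∈ N) (hf : f ∈ N) : e + f ≠ 0 := by
  obtain ⟨x, hx⟩ := h.interior
  intro h0
  have hsum : lor x.1 (e + f) = 0 := by rw [h0, lor_zero_right]
  rw [lor_add_right] at hsum
  linarith [hx e he, hx f hf]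

lemma exists_exit (h : NormalSystem N) {z u : Mink} (hz : ∀ e ∈ N, lor z e ≤ 0)
    (hu : 0 < lor u u) :
    ∃ s : ℝ, ∃ g ∈ N, 0 < lor u g ∧ lor (z + s • u) g = 0 ∧ ∀ e ∈ N, lor (z + s • u) e ≤ 0 := by
  have hne : (N.filter fun g => 0 < lor u g).Nonempty := by
    by_contra hempty
    rw [Finset.not_nonempty_iff_eq_empty, Finset.filter_eq_empty_iff] at hempty
    exact (h.causal u fun e he => not_lt.mp (hempty he)).not_gt hu
  obtain ⟨g, hg, hmin⟩ := Finset.exists_min_image _ (fun g => -lor z g / lor u g) hne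
  obtain ⟨hgN, hug⟩ := Finset.mem_filter.mp hg
  refine ⟨-lor z g / lor u g, g, hgN, hug, ?_, fun e he => ?_⟩
  · rw [lor_add_left, lor_smul_left, div_mul_cancel₀ _ hug.ne', add_neg_cancel]
  · rw [lor_add_left, lor_smul_left]
    have hs : 0 ≤ -lor z g / lor u g := div_nonneg (neg_nonneg.mpr (hz g hgN)) hug.le
    rcases le_or_gt (lor u e) 0 with hue | hue
    · nlinarith [hz e he]
    · have hle := hmin e (Finset.mem_filter.mpr ⟨he, hue⟩)
      rw [le_div_iff₀ hue] at hle
      linarith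

lemma exists_exit_causal (h : NormalSystem N) {z u : Mink} (hz : ∀ e ∈ N, lor z e ≤ 0)
    (hzz : lor z z < 0) (hzu : lor z u = 0) (hu : u ≠ 0) :
    ∃ s : ℝ, ∃ g ∈ N, 0 < lor u g ∧ lor (z + s • u) g = 0 ∧ lor (z + s • u) (z + s • u) ≤ 0 ∧
      z + s • u ≠ 0 := by
  obtain ⟨s, g, hg, hug, hexit, hmem⟩ := h.exists_exit hz (lor_self_pos_of_orthogonal hzz hzu hu)
  refine ⟨s, g, hg, hug, hexit, h.causal _ hmem, fun h0 => hzz.ne ?_⟩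
  have hself : lor z (z + s • u) = lor z z := by
    rw [lor_add_right, lor_smul_right, hzu, mul_zero, add_zero]
  rw [← hself, h0, lor_zero_right]

lemma exists_face_interior (h : NormalSystem N) {e : Mink} (he : e ∈ N) :
    ∃ z, lor z e = 0 ∧ lor z z < 0 ∧ ∀ g ∈ N, g ≠ e → lor z g < 0 := by
  obtain ⟨x, hx⟩ := h.interior
  obtain ⟨z, hze, hzz, -, hzg⟩ := exists_face_proj x (h.unit e he) (hx e he)
  exact ⟨z, hze, hzz, fun g hg hge =>
    hzg g (by linarith [h.le_neg_half he hg hge.symm]) (hx g hg)⟩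

lemma exists_edge_interior (h : NormalSystem N) {e f : Mink} (he : e ∈ N) (hf : f ∈ N)
    (hef : lor e f = -1 / 2) :
    ∃ z, lor z e = 0 ∧ lor z f = 0 ∧ lor z z < 0 ∧ ∀ g ∈ N, g ≠ e → g ≠ f → lor z g < 0 := by
  obtain ⟨x, hx⟩ := h.interior
  obtain ⟨z, hze, hzf, hzz, -, hzg⟩ := exists_edge_proj x (h.unit e he) (h.unit f hf)
    (by rw [hef]; norm_num) (by rw [hef]; norm_num) (hx e he) (hx f hf)
  exact ⟨z, hze, hzf, hzz, fun g hg hge hgf => hzg g (by linarith [h.le_neg_half he hg hge.symm])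
    (by linarith [h.le_neg_half hf hg hgf.symm]) (hx g hg)⟩

lemma exists_tangent_exit (h : NormalSystem N) {e z u : Mink} (he : e ∈ N)
    (hnadj : ∀ f ∈ N, lor e f ≠ -1 / 2) (hze : lor z e = 0) (hzz : lor z z < 0)
    (hzg : ∀ g ∈ N, g ≠ e → lor z g < 0) (hue : lor u e = 0) (huz : lor u z = 0) (hu : u ≠ 0) :
    ∃ g ∈ N, ∃ s c : ℝ, s ≠ 0 ∧ c ≠ 0 ∧ e + g = c • (z + s • u) := by
  have hz : ∀ g ∈ N, lor z g ≤ 0 := fun g hg => by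
    rcases eq_or_ne g e with rfl | hge
    exacts [hze.le, (hzg g hg hge).le]
  obtain ⟨s, g, hg, hug, hexit, hcausal, hne⟩ :=
    h.exists_exit_causal hz hzz (by rw [lor_comm, huz]) hu
  have hge : g ≠ e := by rintro rfl; exact hug.ne' hue
  have hexit_e : lor (z + s • u) e = 0 := by
    rw [lor_add_left, lor_smul_left, hze, hue, mul_zero, add_zero]
  have htangent : lor e g = -1 := le_antisymm
    ((h.gram e he g hg hge.symm).resolve_left (hnadj g hg))
    (neg_one_le_lor_of_perp hcausal hne (h.unit e he) (h.unit g hg) hexit_e hexit)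
  obtain ⟨c, hc⟩ := exists_add_eq_smul_of_perp hcausal hne (h.unit e he) (h.unit g hg) hexit_e
    hexit htangent
  refine ⟨g, hg, s, c, ?_, ?_, hc⟩
  · rintro rfl
    rw [zero_smul, add_zero] at hexit
    exact (hzg g hg hge).ne hexit
  · rintro rfl
    exact h.add_ne_zero he hg (by rw [hc, zero_smul])

/-- If a face had no neighbour, every ray of its plane would end at an ideal point where the plane
touches that of another face: there are infinitely many rays, but only finitely many faces. -/
lemma exists_adj (h : NormalSystem N) {e : Mink} (he : e ∈ N) : ∃ f ∈ N, lor e f = -1 / 2 := by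
  by_contra! hnadj
  obtain ⟨z, hze, hzz, hzg⟩ := h.exists_face_interior he
  have hdim : 1 < Module.finrank ℝ (perp e ⊓ perp z : Submodule ℝ Mink) := by
    have hle := finrank_le_finrank_inf_perp_add_one (perp e) z
    rw [finrank_perp (ne_zero_of_lor_self_ne_zero (by rw [h.unit e he]; exact one_ne_zero))] at hle
    omega
  obtain ⟨u, hu⟩ := exists_pairwise_linearIndependent ℝ _ hdim
  have hu0 : ∀ t, (u t).1 ≠ 0 := fun t h0 =>
    (hu (ne_of_lt (lt_add_one t))).ne_zero 0 (Subtype.ext h0)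
  have huz : ∀ t, lor (u t).1 z = 0 := fun t => mem_perp.mp (u t).2.2
  choose g hg s c hs hc hsum using fun t =>
    h.exists_tangent_exit he hnadj hze hzz hzg (mem_perp.mp (u t).2.1) (huz t) (hu0 t)
  obtain ⟨t, t', htt', hgt⟩ := Finite.exists_ne_map_eq_of_infinite fun t => (⟨g t, hg t⟩ : N)
  have hexit : c t • (z + s t • (u t).1) = c t' • (z + s t' • (u t').1) := by
    rw [← hsum, ← hsum, Subtype.mk.inj hgt]
  have hcc : c t = c t' := by
    have hpair := congrArg (lor · z) hexit
    simp only [lor_smul_left, lor_add_left, huz, mul_zero, add_zero] at hpair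
    exact mul_right_cancel₀ hzz.ne hpair
  have hray : s t • (u t).1 = s t' • (u t').1 := by
    rw [hcc] at hexit
    exact add_left_cancel (smul_right_injective _ (hc t') hexit)
  refine hs t (LinearIndependent.pair_iff.mp (hu htt') (s t) (-s t') ?_).1
  rw [neg_smul, ← sub_eq_add_neg, sub_eq_zero]
  exact Subtype.ext hray

lemma adj_of_perp (h : NormalSystem N) {p e f g : Mink} (he : e ∈ N) (hf : f ∈ N) (hg : g ∈ N)
    (hge : g ≠ e) (hgf : g ≠ f) (hef : lor e f = -1 / 2) (hp : lor p p ≤ 0) (hp0 : p ≠ 0)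
    (hpe : lor p e = 0) (hpf : lor p f = 0) (hpg : lor p g = 0) : lor e g = -1 / 2 := by
  refine (h.gram e he g hg hge.symm).resolve_right fun hle => ?_
  have hlow := neg_one_le_lor_of_perp hp hp0 (h.unit e he) (h.unit g hg) hpe hpg
  obtain ⟨c, hc⟩ := exists_add_eq_smul_of_perp hp hp0 (h.unit e he) (h.unit g hg) hpe hpg
    (le_antisymm hle hlow)
  have hsum : lor (e + g) f = 0 := by rw [hc, lor_smul_left, hpf, mul_zero]
  rw [lor_add_left, hef] at hsum
  linarith [h.le_neg_half hg hf hgf]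

lemma exists_common_neighbor_of_direction (h : NormalSystem N) {e f z u : Mink} (he : e ∈ N)
    (hf : f ∈ N) (hef : lor e f = -1 / 2) (hze : lor z e = 0) (hzf : lor z f = 0)
    (hzz : lor z z < 0) (hz : ∀ g ∈ N, lor z g ≤ 0) (hu : u ≠ 0) (hue : lor u e = 0)
    (huf : lor u f = 0) (huz : lor u z = 0) :
    ∃ g ∈ N, 0 < lor u g ∧ lor e g = -1 / 2 ∧ lor f g = -1 / 2 := by
  obtain ⟨s, g, hg, hug, hpg, hpp, hp0⟩ := h.exists_exit_causal hz hzz (by rw [lor_comm, huz]) hu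
  have hge : g ≠ e := by rintro rfl; exact hug.ne' hue
  have hgf : g ≠ f := by rintro rfl; exact hug.ne' huf
  have hpe : lor (z + s • u) e = 0 := by
    rw [lor_add_left, lor_smul_left, hze, hue, mul_zero, add_zero]
  have hpf : lor (z + s • u) f = 0 := by
    rw [lor_add_left, lor_smul_left, hzf, huf, mul_zero, add_zero]
  exact ⟨g, hg, hug, h.adj_of_perp he hf hg hge hgf hef hpp hp0 hpe hpf hpg,
    h.adj_of_perp hf he hg hgf hge (by rw [lor_comm, hef]) hpp hp0 hpf hpe hpg⟩

/-- The two common neighbours sit at the two ends of the edge. -/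
lemma exists_common_neighbors (h : NormalSystem N) {e f : Mink} (he : e ∈ N) (hf : f ∈ N)
    (hef : lor e f = -1 / 2) :
    ∃ g ∈ N, ∃ g' ∈ N, g ≠ g' ∧ (lor e g = -1 / 2 ∧ lor f g = -1 / 2) ∧
      (lor e g' = -1 / 2 ∧ lor f g' = -1 / 2) := by
  obtain ⟨z, hze, hzf, hzz, hzg⟩ := h.exists_edge_interior he hf hef
  have hz : ∀ g ∈ N, lor z g ≤ 0 := fun g hg => by
    rcases eq_or_ne g e with rfl | hge
    · exact hze.le
    rcases eq_or_ne g f with rfl | hgf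
    exacts [hzf.le, (hzg g hg hge hgf).le]
  obtain ⟨u, hu, hu0⟩ : ∃ u ∈ perp e ⊓ perp f ⊓ perp z, u ≠ 0 := by
    refine Submodule.exists_mem_ne_zero_of_ne_bot fun hbot => ?_
    have hle := finrank_le_finrank_inf_perp_add_one (perp e ⊓ perp f) z
    rw [hbot, finrank_bot, finrank_perp_inf_perp (by rw [h.unit e he]; exact one_ne_zero)
      (by rw [hef, h.unit e he, h.unit f hf]; norm_num)] at hle
    omega
  obtain ⟨⟨hue, huf⟩, huz⟩ := hu
  simp only [SetLike.mem_coe, mem_perp] at hue huf huz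
  obtain ⟨g, hg, hug, hadj⟩ :=
    h.exists_common_neighbor_of_direction he hf hef hze hzf hzz hz hu0 hue huf huz
  obtain ⟨g', hg', hug', hadj'⟩ :=
    h.exists_common_neighbor_of_direction (u := -u) he hf hef hze hzf hzz hz (neg_ne_zero.mpr hu0)
      (by rw [lor_neg_left, hue, neg_zero]) (by rw [lor_neg_left, huf, neg_zero])
      (by rw [lor_neg_left, huz, neg_zero])
  refine ⟨g, hg, g', hg', ?_, hadj, hadj'⟩
  rintro rfl
  rw [lor_neg_left] at hug'
  linarith

/-- Each common neighbour `a` gives a null vector `e + f + a` in the orthogonal complement of `e`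
and `f`; this complement is a plane, so it cannot contain three such lines. -/
lemma common_neighbor_unique (h : NormalSystem N) {e f g g' k : Mink} (he : e ∈ N) (hf : f ∈ N)
    (hg : g ∈ N) (hg' : g' ∈ N) (hk : k ∈ N) (hef : lor e f = -1 / 2)
    (hadj : lor e g = -1 / 2 ∧ lor f g = -1 / 2) (hadj' : lor e g' = -1 / 2 ∧ lor f g' = -1 / 2)
    (hadjk : lor e k = -1 / 2 ∧ lor f k = -1 / 2) (hgg' : g ≠ g') : k = g ∨ k = g' := by
  by_contra! hne
  have hmem : ∀ a : Fin 3, ![g, g', k] a ∈ N := by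
    simpa only [Fin.forall_fin_succ, Fin.forall_fin_zero, and_true] using ⟨hg, hg', hk⟩
  have hneighbor : ∀ a : Fin 3,
      lor e (![g, g', k] a) = -1 / 2 ∧ lor f (![g, g', k] a) = -1 / 2 := by
    simpa only [Fin.forall_fin_succ, Fin.forall_fin_zero, and_true] using ⟨hadj, hadj', hadjk⟩
  have hinj : ∀ a b : Fin 3, a ≠ b → ![g, g', k] a ≠ ![g, g', k] b := by
    simp [Fin.forall_fin_succ, hgg', hgg'.symm, hne.1, hne.2, hne.1.symm, hne.2.symm]
  generalize ![g, g', k] = a at hmem hneighbor hinj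
  have hperp_e : ∀ i, lor (e + f + a i) e = 0 := fun i => by
    rw [lor_add_left, lor_add_left, h.unit e he, lor_comm f, hef, lor_comm (a i), (hneighbor i).1]
    norm_num
  have hperp_f : ∀ i, lor (e + f + a i) f = 0 := fun i => by
    rw [lor_add_left, lor_add_left, h.unit f hf, hef, lor_comm (a i), (hneighbor i).2]
    norm_num
  have hprod : ∀ i j, lor (e + f + a i) (e + f + a j) = -1 + lor (a i) (a j) := fun i j => by
    rw [lor_add_right, lor_add_right, hperp_e, hperp_f, lor_add_left, lor_add_left,
      (hneighbor j).1, (hneighbor j).2]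
    ring
  have hli : LinearIndependent ℝ fun i => e + f + a i := by
    refine linearIndependent_of_null (fun i => ?_) fun i j hij => ?_
    · rw [hprod, h.unit _ (hmem i)]; norm_num
    · rw [hprod]; linarith [h.le_neg_half (hmem i) (hmem j) (hinj i j hij)]
  have hcard := (hli.of_comp (v := fun i => (⟨e + f + a i, mem_perp.mpr (hperp_e i),
    mem_perp.mpr (hperp_f i)⟩ : (perp e ⊓ perp f : Submodule ℝ Mink)))
    (Submodule.subtype _)).fintype_card_le_finrank
  rw [finrank_perp_inf_perp (by rw [h.unit e he]; exact one_ne_zero)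
    (by rw [hef, h.unit e he, h.unit f hf]; norm_num), Fintype.card_fin] at hcard
  omega

end NormalSystem

/-! ### Polyhedra of finite volume -/

lemma measurable_lift : Measurable lift := by
  have hcont : Continuous fun y : E3 => ((√(1 + ‖y‖ ^ 2), y) : Mink) := by fun_prop
  exact hcont.measurable.subtype_mk

lemma measurableSet_halfSpace (e : Mink) : MeasurableSet (halfSpace e) := by
  have hmeas : Measurable fun x : H3 => lor x.1 e :=
    (continuous_lor_comp continuous_id continuous_const).measurable.comp measurable_subtype_coe
  exact measurableSet_le hmeas measurable_const

lemma measurableSet_polyhedron (N : Finset Mink) : MeasurableSet (⋂ e ∈ N, halfSpace e) :=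
  Finset.measurableSet_biInter _ fun e _ => measurableSet_halfSpace e

lemma vol_apply {A : Set H3} (hA : MeasurableSet A) :
    vol A = ∫⁻ y in lift ⁻¹' A, ENNReal.ofReal (1 / √(1 + ‖y‖ ^ 2)) := by
  rw [vol, Measure.map_apply measurable_lift hA, withDensity_apply _ (measurable_lift hA)]

lemma mem_polyhedron {N : Finset Mink} {x : H3} :
    x ∈ (⋂ e ∈ N, halfSpace e) ↔ ∀ e ∈ N, lor x.1 e ≤ 0 := by
  simp [halfSpace]

lemma lift_smul_val {R : ℝ} (hR : 0 < R) (y : E3) :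
    (lift (R • y)).1 = R • ((√(‖y‖ ^ 2 + R⁻¹ ^ 2), y) : Mink) := by
  have hsq : 1 + ‖R • y‖ ^ 2 = R ^ 2 * (‖y‖ ^ 2 + R⁻¹ ^ 2) := by
    rw [norm_smul, Real.norm_of_nonneg hR.le]
    field_simp
    ring
  have htime : √(1 + ‖R • y‖ ^ 2) = R * √(‖y‖ ^ 2 + R⁻¹ ^ 2) := by
    rw [hsq, Real.sqrt_mul (sq_nonneg R), Real.sqrt_sq hR.le]
  exact Prod.ext htime rfl

open scoped Pointwise in
lemma exists_forall_smul_ball_subset {N : Finset Mink} {n : Mink} (hn : lor n n = 0)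
    (hn0 : 0 < n.1) (h : ∀ e ∈ N, lor n e < 0) :
    ∃ δ > 0, ∀ R > δ⁻¹, R • Metric.ball n.2 δ ⊆ lift ⁻¹' (⋂ e ∈ N, halfSpace e) := by
  have hnorm : ‖n.2‖ = n.1 := by
    rw [lor_self] at hn
    exact (sq_eq_sq₀ (norm_nonneg _) hn0.le).mp (by linarith)
  set F : E3 × ℝ → Mink := fun q => (√(‖q.1‖ ^ 2 + q.2 ^ 2), q.1) with hF
  have hFcont : Continuous F := by rw [hF]; fun_prop
  have hFn : F (n.2, 0) = n := by
    refine Prod.ext ?_ rfl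
    simp [hF, hnorm, Real.sqrt_sq hn0.le]
  have hnear : ∀ᶠ q in nhds (n.2, (0 : ℝ)), ∀ e ∈ N, lor (F q) e < 0 := by
    rw [Filter.eventually_all_finset]
    intro e he
    exact ((continuous_lor_comp hFcont continuous_const).tendsto _).eventually_lt_const
      (by rw [hFn]; exact h e he)
  obtain ⟨δ, hδ, hball⟩ := Metric.eventually_nhds_iff.mp hnear
  refine ⟨δ, hδ, fun R hR => ?_⟩
  have hR0 : 0 < R := (inv_pos.mpr hδ).trans hR
  rintro _ ⟨b, hb, rfl⟩
  refine mem_polyhedron.mpr fun e he => ?_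
  have hdist : dist (b, R⁻¹) (n.2, (0 : ℝ)) < δ := by
    rw [Prod.dist_eq, Real.dist_eq, sub_zero, abs_of_pos (inv_pos.mpr hR0)]
    exact max_lt hb (inv_lt_of_inv_lt₀ hδ hR)
  change lor (lift (R • b)).1 e ≤ 0
  rw [lift_smul_val hR0, lor_smul_left]
  exact mul_nonpos_of_nonneg_of_nonpos hR0.le (hball hdist e he).le

open scoped Pointwise in
lemma ofReal_mul_volume_ball_le (c : E3) (δ : ℝ) {R : ℝ} (hR : 1 ≤ R) :
    ENNReal.ofReal (R ^ 2 / (1 + (‖c‖ + |δ|))) * volume (Metric.ball c δ) ≤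
      ∫⁻ y in R • Metric.ball c δ, ENNReal.ofReal (1 / √(1 + ‖y‖ ^ 2)) := by
  have hR0 : 0 < R := one_pos.trans_le hR
  set K := ‖c‖ + |δ|
  have hK : 0 ≤ K := by positivity
  have hdensity : ∀ y ∈ R • Metric.ball c δ,
      ENNReal.ofReal (1 / (R * (1 + K))) ≤ ENNReal.ofReal (1 / √(1 + ‖y‖ ^ 2)) := by
    rintro _ ⟨b, hb, rfl⟩
    have hbK : ‖b‖ ≤ K := by
      have hbc : ‖b - c‖ < δ := by rwa [← dist_eq_norm]
      linarith [norm_le_norm_add_norm_sub' b c, le_abs_self δ]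
    refine ENNReal.ofReal_le_ofReal (one_div_le_one_div_of_le (by positivity)
      (Real.sqrt_le_iff.mpr ⟨by positivity, ?_⟩))
    change 1 + ‖R • b‖ ^ 2 ≤ _
    rw [norm_smul, Real.norm_of_nonneg hR0.le]
    nlinarith [norm_nonneg b, mul_le_mul hbK hbK (norm_nonneg b) hK, mul_pos hR0 hR0]
  calc ENNReal.ofReal (R ^ 2 / (1 + K)) * volume (Metric.ball c δ)
      = ENNReal.ofReal (1 / (R * (1 + K))) * volume (R • Metric.ball c δ) := by
        rw [Measure.addHaar_smul, finrank_euclideanSpace_fin, abs_of_pos (by positivity),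
          ← mul_assoc, ← ENNReal.ofReal_mul (by positivity)]
        congr 2
        field_simp
    _ = ∫⁻ _ in R • Metric.ball c δ, ENNReal.ofReal (1 / (R * (1 + K))) :=
        (setLIntegral_const _ _).symm
    _ ≤ _ := setLIntegral_mono' (Metric.isOpen_ball.smul₀ hR0.ne').measurableSet hdensity

lemma vol_eq_top_of_ideal {N : Finset Mink} {n : Mink} (hn : lor n n = 0) (hn0 : 0 < n.1)
    (h : ∀ e ∈ N, lor n e < 0) : vol (⋂ e ∈ N, halfSpace e) = ⊤ := by
  obtain ⟨δ, hδ, hsub⟩ := exists_forall_smul_ball_subset hn hn0 h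
  have hlow : ∀ᶠ R : ℝ in Filter.atTop,
      ENNReal.ofReal (R ^ 2 / (1 + (‖n.2‖ + |δ|))) * volume (Metric.ball n.2 δ) ≤
        vol (⋂ e ∈ N, halfSpace e) := by
    filter_upwards [Filter.eventually_ge_atTop 1, Filter.eventually_gt_atTop δ⁻¹] with R hR1 hRδ
    rw [vol_apply (measurableSet_polyhedron N)]
    exact (ofReal_mul_volume_ball_le n.2 δ hR1).trans (lintegral_mono_set (hsub R hRδ))
  have hsq : Filter.Tendsto (fun R : ℝ => R ^ 2 / (1 + (‖n.2‖ + |δ|))) Filter.atTop Filter.atTop :=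
    (Filter.tendsto_pow_atTop two_ne_zero).atTop_div_const (by positivity)
  have htop := ENNReal.Tendsto.mul_const (b := volume (Metric.ball n.2 δ))
    (ENNReal.tendsto_ofReal_atTop.comp hsq) (Or.inl ENNReal.top_ne_zero)
  rw [ENNReal.top_mul (Metric.measure_ball_pos _ _ hδ).ne'] at htop
  exact top_le_iff.mp (le_of_tendsto htop hlow)

lemma H3.exists_null_add_smul (x : H3) {w : Mink} (hw : 0 < lor w w) :
    ∃ s : ℝ, 0 < s ∧ lor (x.1 + s • w) (x.1 + s • w) = 0 ∧ 0 < (x.1 + s • w).1 := by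
  set A := lor w w with hA
  set B := lor x.1 w with hB
  set r := √(B ^ 2 + A)
  have hr : r ^ 2 = B ^ 2 + A := Real.sq_sqrt (by positivity)
  have hr0 : 0 < r := Real.sqrt_pos.mpr (by positivity)
  have hrB : B < r := (abs_lt_of_sq_lt_sq' (by linarith) hr0.le).2
  obtain ⟨s, hs⟩ : ∃ s, A * s = r - B := ⟨(r - B) / A, mul_div_cancel₀ _ hw.ne'⟩
  have hs0 : 0 < s := pos_of_mul_pos_right (by linarith) hw.le
  have hnull : lor (x.1 + s • w) (x.1 + s • w) = 0 := by
    simp only [lor_add_left, lor_add_right, lor_smul_left, lor_smul_right, x.2.1, lor_comm w x.1,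
      ← hB, ← hA]
    refine (mul_eq_zero.mp (?_ : A * _ = 0)).resolve_left hw.ne'
    linear_combination (A * s + r + B) * hs + hr
  refine ⟨s, hs0, hnull, x.future_of_lor_neg hnull.le ?_⟩
  rw [lor_add_right, lor_smul_right, x.2.1, ← hB]
  have hAneg : A * (-1 + s * B) = -(r * (r - B)) := by linear_combination B * hs + hr
  refine neg_of_mul_neg_right ?_ hw.le
  rw [hAneg, neg_lt_zero]
  exact mul_pos hr0 (sub_pos.mpr hrB)

lemma causal_of_vol_lt_top {N : Finset Mink} (hv : vol (⋂ e ∈ N, halfSpace e) < ⊤) (x : H3)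
    (hx : ∀ e ∈ N, lor x.1 e < 0) (w : Mink) (hw : ∀ e ∈ N, lor w e ≤ 0) : lor w w ≤ 0 := by
  by_contra! hspace
  obtain ⟨s, hs, hnull, hfuture⟩ := x.exists_null_add_smul hspace
  refine hv.ne (vol_eq_top_of_ideal hnull hfuture fun e he => ?_)
  rw [lor_add_left, lor_smul_left]
  nlinarith [hx e he, hw e he]

/-! ### Irredundant presentations -/

lemma exists_irredundant {α β : Type*} (N : Finset α) (H : α → Set β) :
    ∃ M ⊆ N, (⋂ e ∈ M, H e) = ⋂ e ∈ N, H e ∧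
      ∀ e ∈ M, ∃ y, y ∉ H e ∧ ∀ f ∈ M, f ≠ e → y ∈ H f := by
  classical
  obtain ⟨M, hM, hmin⟩ := Finset.exists_min_image
    (N.powerset.filter fun M => (⋂ e ∈ M, H e) = ⋂ e ∈ N, H e) Finset.card ⟨N, by simp⟩
  rw [Finset.mem_filter, Finset.mem_powerset] at hM
  refine ⟨M, hM.1, hM.2, fun e he => ?_⟩
  by_contra! hredundant
  have herase : (⋂ f ∈ M.erase e, H f) = ⋂ f ∈ N, H f := by
    rw [← hM.2]
    refine Set.Subset.antisymm (fun y hy => ?_)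
      (Set.biInter_subset_biInter_left (Finset.erase_subset e M))
    simp only [Set.mem_iInter, Finset.mem_erase] at hy ⊢
    have hye : y ∈ H e := by
      by_contra hye
      obtain ⟨f, hf, hfe, hyf⟩ := hredundant y hye
      exact hyf (hy f ⟨hfe, hf⟩)
    intro f hf
    rcases eq_or_ne f e with rfl | hfe
    exacts [hye, hy f ⟨hfe, hf⟩]
  refine (Finset.card_erase_lt_of_mem he).not_ge (hmin (M.erase e) ?_)
  rw [Finset.mem_filter, Finset.mem_powerset]
  exact ⟨(Finset.erase_subset e M).trans hM.1, herase⟩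

lemma timelike_future_add {z y : Mink} (hz : lor z z < 0) (hz0 : 0 < z.1) (hy : lor y y < 0)
    (hy0 : 0 < y.1) {a b : ℝ} (ha : 0 < a) (hb : 0 < b) :
    lor (a • z + b • y) (a • z + b • y) < 0 ∧ 0 < (a • z + b • y).1 := by
  have hzy := lor_neg_of_future hz hz0 hy.le hy0
  constructor
  · simp only [lor_add_left, lor_add_right, lor_smul_left, lor_smul_right, lor_comm y z]
    nlinarith [mul_pos ha hb, mul_pos ha ha, mul_pos hb hb]
  · simp only [Prod.fst_add, Prod.smul_fst, smul_eq_mul]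
    positivity

lemma exists_crossing {z y f : Mink} (hz : lor z z < 0) (hz0 : 0 < z.1) (hy : lor y y < 0)
    (hy0 : 0 < y.1) (hzf : lor z f < 0) (hyf : 0 < lor y f) :
    ∃ p, lor p p < 0 ∧ 0 < p.1 ∧ lor p f = 0 ∧ (∀ g, lor z g < 0 → lor y g ≤ 0 → lor p g < 0) ∧
      ∀ g, lor z g = 0 → lor y g = 0 → lor p g = 0 := by
  have hp := timelike_future_add hz hz0 hy hy0 hyf (neg_pos.mpr hzf)
  refine ⟨lor y f • z + (-lor z f) • y, hp.1, hp.2, ?_, fun g hzg hyg => ?_, fun g hzg hyg => ?_⟩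
  · rw [lor_add_left, lor_smul_left, lor_smul_left]
    ring
  · rw [lor_add_left, lor_smul_left, lor_smul_left]
    nlinarith [mul_pos_of_neg_of_neg hzf hzg]
  · rw [lor_add_left, lor_smul_left, lor_smul_left, hzg, hyg, mul_zero, mul_zero, add_zero]

lemma exists_small_step {z u : Mink} (hz : lor z z < 0) (hz0 : 0 < z.1) {N : Finset Mink}
    (hN : ∀ g ∈ N, lor z g < 0 ∨ lor z g = 0 ∧ lor u g = 0) :
    ∃ s : ℝ, 0 < s ∧ lor (z + s • u) (z + s • u) < 0 ∧ 0 < (z + s • u).1 ∧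
      ∀ g ∈ N, lor (z + s • u) g ≤ 0 := by
  have hcont : Continuous fun s : ℝ => z + s • u := by fun_prop
  have hat0 : z + (0 : ℝ) • u = z := by simp
  have htimelike : ∀ᶠ s in nhds (0 : ℝ), lor (z + s • u) (z + s • u) < 0 :=
    ((continuous_lor_comp hcont hcont).tendsto _).eventually_lt_const (by rwa [hat0])
  have hfuture : ∀ᶠ s in nhds (0 : ℝ), 0 < (z + s • u).1 :=
    ((continuous_fst.comp hcont).tendsto _).eventually_const_lt (by simpa using hz0)
  have hnonpos : ∀ᶠ s in nhds (0 : ℝ), ∀ g ∈ N, lor (z + s • u) g ≤ 0 := by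
    rw [Filter.eventually_all_finset]
    intro g hg
    rcases hN g hg with hzg | ⟨hzg, hug⟩
    · exact (((continuous_lor_comp hcont continuous_const).tendsto _).eventually_lt_const
        (by rwa [hat0])).mono fun s hs => hs.le
    · refine .of_forall fun s => ?_
      rw [lor_add_left, lor_smul_left, hzg, hug, mul_zero, add_zero]
  have hpos : ∀ᶠ s in nhdsWithin (0 : ℝ) (Set.Ioi 0), 0 < s := eventually_mem_nhdsWithin
  exact (hpos.and ((htimelike.and (hfuture.and hnonpos)).filter_mono nhdsWithin_le_nhds)).exists

lemma span_eq_of_steps {A : Set H3} {W : Submodule ℝ Mink} (hA : ∀ x ∈ A, x.1 ∈ W) {z : Mink}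
    (hstep : ∀ u ∈ W, ∃ s : ℝ, 0 < s ∧ ∃ x ∈ A, ∃ c : ℝ, z + s • u = c • x.1) :
    Submodule.span ℝ ((fun x : H3 => x.1) '' A) = W := by
  refine le_antisymm (Submodule.span_le.mpr (by rintro _ ⟨x, hx, rfl⟩; exact hA x hx))
    fun u hu => ?_
  have hmem : ∀ x ∈ A, ∀ c : ℝ, c • x.1 ∈ Submodule.span ℝ ((fun x : H3 => x.1) '' A) :=
    fun x hx c => Submodule.smul_mem _ c (Submodule.subset_span ⟨x, hx, rfl⟩)
  obtain ⟨_, -, x, hx, c, hbase⟩ := hstep 0 W.zero_mem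
  rw [smul_zero, add_zero] at hbase
  obtain ⟨s, hs, y, hy, c', hmove⟩ := hstep u hu
  have hdecomp : u = s⁻¹ • (c' • y.1 - c • x.1) := by
    rw [← hmove, ← hbase, add_sub_cancel_left, inv_smul_smul₀ hs.ne']
  rw [hdecomp]
  exact Submodule.smul_mem _ _ (Submodule.sub_mem _ (hmem y hy c') (hmem x hx c))

/-! ### From equiangular polyhedra to systems of normals -/

lemma lor_eq_of_dihedralAngle {e f : Mink} (h : dihedralAngle e f = Real.pi / 3) :
    lor e f = -1 / 2 := by
  have harccos : Real.arccos (lor e f) = Real.pi - Real.pi / 3 := by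
    unfold dihedralAngle at h
    linarith
  have hpi := Real.pi_pos
  have hlow : -1 ≤ lor e f := by
    by_contra! hlt
    rw [Real.arccos_of_le_neg_one hlt.le] at harccos
    linarith
  have hhigh : lor e f ≤ 1 := by
    by_contra! hlt
    rw [Real.arccos_of_one_le hlt.le] at harccos
    linarith
  rw [← Real.cos_arccos hlow hhigh, harccos, Real.cos_pi_sub, Real.cos_pi_div_three, neg_div]

lemma lor_neg_of_ball_subset {x : H3} {r : ℝ} (hr : 0 < r) {e : Mink} (he : lor e e = 1)
    (h : {y | hdist x y < r} ⊆ halfSpace e) : lor x.1 e < 0 := by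
  have hle : lor x.1 e ≤ 0 := h (show hdist x x < r by
    rw [hdist, x.2.1, neg_neg, Real.arcosh_zero]
    exact hr)
  refine lt_of_le_of_ne hle fun hxe => ?_
  -- Otherwise the geodesic from `x` in the direction `e` leaves the half-space at once.
  set s := r / 2
  have hs0 : 0 < s := half_pos hr
  set y := Real.cosh s • x.1 + Real.sinh s • e with hy
  have hyy : lor y y = -1 := by
    simp only [hy, lor_add_left, lor_add_right, lor_smul_left, lor_smul_right, x.2.1, he, hxe,
      lor_comm e x.1]
    linear_combination -Real.cosh_sq_sub_sinh_sq s
  have hxy : lor x.1 y = -Real.cosh s := by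
    rw [hy, lor_add_right, lor_smul_right, lor_smul_right, x.2.1, hxe]
    ring
  have hfuture : 0 < y.1 := x.future_of_lor_neg (by rw [hyy]; norm_num)
    (by rw [hxy]; exact neg_neg_of_pos (Real.cosh_pos s))
  have hmem : lor y e ≤ 0 := @h ⟨y, hyy, hfuture⟩ (by
    change Real.arcosh (-lor x.1 y) < r
    rw [hxy, neg_neg, Real.arcosh_cosh hs0.le]
    exact half_lt_self hr)
  rw [hy, lor_add_left, lor_smul_left, lor_smul_left, hxe, he] at hmem
  linarith [Real.sinh_pos_iff.mpr hs0]

lemma lor_sq_lt_one_of_perp {z e f : Mink} (hz : lor z z < 0) (he : lor e e = 1)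
    (hf : lor f f = 1) (hze : lor z e = 0) (hzf : lor z f = 0) (hef : e ≠ f) (hadd : e + f ≠ 0) :
    lor e f ^ 2 < 1 := by
  have hadd' : 0 < lor (e + f) (e + f) :=
    lor_self_pos_of_orthogonal hz (by rw [lor_add_right, hze, hzf, add_zero]) hadd
  have hsub' : 0 < lor (e - f) (e - f) := lor_self_pos_of_orthogonal hz
    (by rw [lor_sub_right, hze, hzf, sub_zero]) (sub_ne_zero.mpr hef)
  simp only [lor_add_left, lor_add_right, lor_sub_left, lor_sub_right, he, hf, lor_comm f e]
    at hadd' hsub'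
  nlinarith

/-- An irredundant presentation of the polyhedron `P` by the outward unit normals `N`, with an
interior point `x`. -/
structure Presentation (P : Set H3) (N : Finset Mink) (x : H3) : Prop where
  unit : ∀ e ∈ N, lor e e = 1
  eq : P = ⋂ e ∈ N, halfSpace e
  interior : ∀ e ∈ N, lor x.1 e < 0
  irredundant : ∀ e ∈ N, ∃ y : H3, 0 < lor y.1 e ∧ ∀ f ∈ N, f ≠ e → lor y.1 f ≤ 0

lemma IsConvexPolyhedron.exists_presentation {P : Set H3} (hP : IsConvexPolyhedron P) :
    ∃ N x, Presentation P N x := by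
  obtain ⟨⟨N, hN, rfl⟩, x, r, hr, hball⟩ := hP
  obtain ⟨M, hMN, hM, hirr⟩ := exists_irredundant N halfSpace
  refine ⟨M, x, fun e he => hN e (hMN he), hM.symm, fun e he => ?_, fun e he => ?_⟩
  · exact lor_neg_of_ball_subset hr (hN e (hMN he))
      (hball.trans (Set.biInter_subset_of_mem (hMN he)))
  · obtain ⟨y, hy, hyf⟩ := hirr e he
    exact ⟨y, not_le.mp hy, hyf⟩

namespace Presentation

variable {P : Set H3} {N : Finset Mink} {x : H3}

lemma mem_iff (h : Presentation P N x) {y : H3} : y ∈ P ↔ ∀ e ∈ N, lor y.1 e ≤ 0 := by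
  rw [h.eq, mem_polyhedron]

lemma exists_mem_smul (h : Presentation P N x) {w : Mink} (hw : lor w w < 0) (hw0 : 0 < w.1)
    (hN : ∀ e ∈ N, lor w e ≤ 0) : ∃ y ∈ P, ∃ c : ℝ, 0 < c ∧ w = c • y.1 := by
  obtain ⟨y, c, hc, rfl⟩ := exists_H3_smul hw hw0
  refine ⟨y, h.mem_iff.mpr fun e he => ?_, c, hc, rfl⟩
  have hye := hN e he
  rw [lor_smul_left] at hye
  exact nonpos_of_mul_nonpos_right hye hc

lemma exists_face_interior (h : Presentation P N x) {e : Mink} (he : e ∈ N) :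
    ∃ z, lor z z < 0 ∧ 0 < z.1 ∧ lor z e = 0 ∧ ∀ g ∈ N, g ≠ e → lor z g < 0 := by
  obtain ⟨y, hye, hyg⟩ := h.irredundant e he
  obtain ⟨z, hz, hz0, hze, hzg, -⟩ :=
    exists_crossing x.lor_self_neg x.2.2 y.lor_self_neg y.2.2 (h.interior e he) hye
  exact ⟨z, hz, hz0, hze, fun g hg hge => hzg g (h.interior g hg) (hyg g hg hge)⟩

lemma isFaceNormal (h : Presentation P N x) {e : Mink} (he : e ∈ N) : IsFaceNormal P e := by
  obtain ⟨z, hz, hz0, hze, hzg⟩ := h.exists_face_interior he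
  refine ⟨h.unit e he, fun y hy => h.mem_iff.mp hy e he, ?_⟩
  rw [spanRank, span_eq_of_steps (W := perp e) (z := z) (fun y hy => mem_perp.mpr hy.2),
    finrank_perp (ne_zero_of_lor_self_ne_zero (by rw [h.unit e he]; exact one_ne_zero))]
  intro u hu
  rw [mem_perp] at hu
  obtain ⟨s, hs, htimelike, hfuture, hN⟩ := exists_small_step (u := u) hz hz0 fun g hg =>
    (eq_or_ne g e).elim (fun hge => hge ▸ Or.inr ⟨hze, hu⟩) fun hge => Or.inl (hzg g hg hge)
  obtain ⟨y, hy, c, hc, hyc⟩ := h.exists_mem_smul htimelike hfuture hN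
  refine ⟨s, hs, y, ⟨hy, ?_⟩, c, hyc⟩
  have hye : c * lor y.1 e = 0 := by
    rw [← lor_smul_left, ← hyc, lor_add_left, lor_smul_left, hze, hu, mul_zero, add_zero]
  exact (mul_eq_zero.mp hye).resolve_left hc.ne'

lemma add_ne_zero (h : Presentation P N x) {e f : Mink} (he : e ∈ N) (hf : f ∈ N) :
    e + f ≠ 0 := by
  intro hsum
  have hx : lor x.1 e + lor x.1 f = 0 := by rw [← lor_add_right, hsum, lor_zero_right]
  linarith [h.interior e he, h.interior f hf]

lemma adjacent (h : Presentation P N x) {e f z : Mink} (he : e ∈ N) (hf : f ∈ N) (hef : e ≠ f)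
    (hz : lor z z < 0) (hze : lor z e = 0) (hzf : lor z f = 0)
    (hstep : ∀ u, lor u e = 0 → lor u f = 0 → ∃ s : ℝ, 0 < s ∧ lor (z + s • u) (z + s • u) < 0 ∧
      0 < (z + s • u).1 ∧ ∀ g ∈ N, lor (z + s • u) g ≤ 0) : Adjacent P e f := by
  refine ⟨h.isFaceNormal he, h.isFaceNormal hf, hef, ?_⟩
  have hgram : lor e f ^ 2 ≠ lor e e * lor f f := by
    rw [h.unit e he, h.unit f hf, mul_one]
    exact (lor_sq_lt_one_of_perp hz (h.unit e he) (h.unit f hf) hze hzf hef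
      (h.add_ne_zero he hf)).ne
  rw [spanRank, span_eq_of_steps (W := perp e ⊓ perp f) (z := z),
    finrank_perp_inf_perp (by rw [h.unit e he]; exact one_ne_zero) hgram]
  · exact fun y hy => ⟨mem_perp.mpr hy.1.2, mem_perp.mpr hy.2.2⟩
  · rintro u ⟨hue, huf⟩
    rw [SetLike.mem_coe, mem_perp] at hue huf
    obtain ⟨s, hs, htimelike, hfuture, hN⟩ := hstep u hue huf
    obtain ⟨y, hy, c, hc, hyc⟩ := h.exists_mem_smul htimelike hfuture hN
    have hon : ∀ {g}, lor z g = 0 → lor u g = 0 → lor y.1 g = 0 := fun {g} hzg hug =>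
      (mul_eq_zero.mp (by rw [← lor_smul_left, ← hyc, lor_add_left, lor_smul_left, hzg, hug,
        mul_zero, add_zero])).resolve_left hc.ne'
    exact ⟨s, hs, y, ⟨⟨hy, hon hze hue⟩, hy, hon hzf huf⟩, c, hyc⟩

lemma exists_irredundant_face {N : Finset Mink} {e : Mink} :
    ∃ M ⊆ N, e ∉ M ∧
      (∀ p, lor p p < 0 → 0 < p.1 → lor p e = 0 → (∀ f ∈ M, lor p f ≤ 0) →
        ∀ g ∈ N, lor p g ≤ 0) ∧
      ∀ f ∈ M, ∃ y : H3, lor y.1 e = 0 ∧ 0 < lor y.1 f ∧ ∀ g ∈ M, g ≠ f → lor y.1 g ≤ 0 := by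
  classical
  obtain ⟨M, hMN, hM, hirr⟩ := exists_irredundant (N.erase e)
    (fun g => {y : {y : H3 // lor y.1 e = 0} | lor y.1.1 g ≤ 0})
  refine ⟨M, hMN.trans (Finset.erase_subset e N), fun he => Finset.notMem_erase e N (hMN he),
    fun p hp hp0 hpe hpM g hg => ?_, fun f hf => ?_⟩
  · obtain ⟨y, c, hc, rfl⟩ := exists_H3_smul hp hp0
    simp only [lor_smul_left] at hpe hpM ⊢
    rcases eq_or_ne g e with rfl | hge
    · exact hpe.le
    have hye : lor y.1 e = 0 := (mul_eq_zero.mp hpe).resolve_left hc.ne'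
    have hyM : (⟨y, hye⟩ : {y : H3 // lor y.1 e = 0}) ∈
        ⋂ f ∈ M, {y : {y : H3 // lor y.1 e = 0} | lor y.1.1 f ≤ 0} :=
      Set.mem_iInter₂.mpr fun f hf => nonpos_of_mul_nonpos_right (hpM f hf) hc
    rw [hM] at hyM
    exact mul_nonpos_of_nonneg_of_nonpos hc.le
      (Set.mem_iInter₂.mp hyM g (Finset.mem_erase.mpr ⟨hge, hg⟩))
  · obtain ⟨y, hyf, hyg⟩ := hirr f hf
    exact ⟨y.1, y.2, not_le.mp hyf, hyg⟩

lemma exists_adjacent_cutting_face (h : Presentation P N x) {e : Mink} (he : e ∈ N) :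
    ∃ M ⊆ N, (∀ f ∈ M, Adjacent P e f) ∧
      ∀ p, lor p p < 0 → 0 < p.1 → lor p e = 0 → (∀ f ∈ M, lor p f ≤ 0) →
        ∀ g ∈ N, lor p g ≤ 0 := by
  obtain ⟨M, hMN, heM, hface, hirr⟩ := exists_irredundant_face (N := N) (e := e)
  refine ⟨M, hMN, fun f hf => ?_, hface⟩
  have hne : ∀ g ∈ M, g ≠ e := fun g hg hge => heM (hge ▸ hg)
  obtain ⟨y, hye, hyf, hyg⟩ := hirr f hf
  obtain ⟨z, hz, hz0, hze, hzg⟩ := h.exists_face_interior he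
  obtain ⟨p, hp, hp0, hpf, hpneg, hpzero⟩ := exists_crossing hz hz0 y.lor_self_neg y.2.2
    (hzg f (hMN hf) (hne f hf)) hyf
  have hpe : lor p e = 0 := hpzero e hze hye
  refine h.adjacent he (hMN hf) (hne f hf).symm hp hpe hpf fun u hue huf => ?_
  obtain ⟨s, hs, htimelike, hfuture, hM⟩ := exists_small_step (N := M) (u := u) hp hp0
    fun g hg => (eq_or_ne g f).elim (fun hgf => hgf ▸ Or.inr ⟨hpf, huf⟩)
      fun hgf => Or.inl (hpneg g (hzg g (hMN hg) (hne g hg)) (hyg g hg hgf))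
  refine ⟨s, hs, htimelike, hfuture, hface _ htimelike hfuture ?_ hM⟩
  rw [lor_add_left, lor_smul_left, hpe, hue, mul_zero, add_zero]

/-- Acute dihedral angles make the polyhedron project orthogonally into each of its faces: the face
is cut out by the adjacent ones, whose normals have non-positive product with its own. -/
lemma lor_proj_nonpos (h : Presentation P N x)
    (hacute : ∀ e f, Adjacent P e f → lor e f ≤ 0) {e : Mink} (he : e ∈ N) {w : Mink}
    (hw : lor w w < 0) (hw0 : 0 < w.1) (hwN : ∀ g ∈ N, lor w g ≤ 0) :
    ∀ g ∈ N, lor (w - lor w e • e) g ≤ 0 := by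
  obtain ⟨M, hMN, hMadj, hface⟩ := h.exists_adjacent_cutting_face he
  set p := w - lor w e • e with hp
  have hpe : lor p e = 0 := by
    rw [hp, lor_sub_left, lor_smul_left, h.unit e he, mul_one, sub_self]
  have hpw : lor p w < 0 := by
    rw [hp, lor_sub_left, lor_smul_left, lor_comm e w]
    nlinarith [sq_nonneg (lor w e)]
  have hpp : lor p p < 0 := by
    nth_rw 2 [hp]
    rwa [lor_sub_right, lor_smul_right, hpe, mul_zero, sub_zero]
  refine hface p hpp (future_of_lor_neg hpp hw.le hw0 hpw) hpe fun f hf => ?_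
  rw [hp, lor_sub_left, lor_smul_left]
  nlinarith [hwN f (hMN hf), mul_nonneg_of_nonpos_of_nonpos (hwN e he) (hacute e f (hMadj f hf))]

lemma lor_nonpos (h : Presentation P N x) (hacute : ∀ e f, Adjacent P e f → lor e f ≤ 0)
    {e g : Mink} (he : e ∈ N) (hg : g ∈ N) (heg : e ≠ g) : lor e g ≤ 0 := by
  obtain ⟨z, hz, hz0, hzg, hzf⟩ := h.exists_face_interior hg
  have hproj := h.lor_proj_nonpos hacute he hz hz0 (fun f hf => (eq_or_ne f g).elim
    (fun hfg => hfg ▸ hzg.le) fun hfg => (hzf f hf hfg).le) g hg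
  rw [lor_sub_left, lor_smul_left, hzg] at hproj
  exact nonpos_of_mul_nonneg_right (by linarith) (hzf e he heg)

lemma adjacent_or_lor_le_neg_one (h : Presentation P N x)
    (hacute : ∀ e f, Adjacent P e f → lor e f ≤ 0) {e g : Mink} (he : e ∈ N) (hg : g ∈ N)
    (heg : e ≠ g) : Adjacent P e g ∨ lor e g ≤ -1 := by
  refine (le_or_gt (lor e g) (-1)).elim Or.inr fun hlow => Or.inl ?_
  obtain ⟨z, hze, hzg, hz, hz0, hzf⟩ := exists_edge_proj x (h.unit e he) (h.unit g hg) hlow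
    (h.lor_nonpos hacute he hg heg) (h.interior e he) (h.interior g hg)
  refine h.adjacent he hg heg hz hze hzg fun u hue hug => exists_small_step hz hz0 fun f hf => ?_
  rcases eq_or_ne f e with rfl | hfe
  · exact Or.inr ⟨hze, hue⟩
  rcases eq_or_ne f g with rfl | hfg
  · exact Or.inr ⟨hzg, hug⟩
  exact Or.inl (hzf f (h.lor_nonpos hacute he hf hfe.symm) (h.lor_nonpos hacute hg hf hfg.symm)
    (h.interior f hf))

lemma normalSystem (h : Presentation P N x) (hadj : ∀ e f, Adjacent P e f → lor e f = -1 / 2)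
    (hv : vol P < ⊤) : NormalSystem N where
  unit := h.unit
  interior := ⟨x, h.interior⟩
  gram e he f hf hef :=
    (h.adjacent_or_lor_le_neg_one (fun e f hef => by rw [hadj e f hef]; norm_num) he hf
      hef).imp_left (hadj e f)
  causal := causal_of_vol_lt_top (by rwa [← h.eq]) x h.interior

end Presentation

lemma IsEquiangular.exists_normalSystem {P : Set H3} (hP : IsEquiangular (Real.pi / 3) P) :
    ∃ N, NormalSystem N ∧ P = ⋂ e ∈ N, halfSpace e := by
  obtain ⟨N, x, h⟩ := hP.1.exists_presentation
  exact ⟨N, h.normalSystem (fun e f hef => lor_eq_of_dihedralAngle (hP.2.2 e f hef)) hP.2.1, h.eq⟩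

/-! ### Frames at ideal vertices -/

/-- The sum of three vectors. For the outward normals of three faces that meet at an ideal vertex
with dihedral angles `π / 3` it is a null vector that represents the vertex. -/
noncomputable def apex (e : Fin 3 → Mink) : Mink := ∑ i, e i

lemma lor_apex_right (w : Mink) (e : Fin 3 → Mink) :
    lor w (apex e) = lor w (e 0) + lor w (e 1) + lor w (e 2) := by
  rw [apex, Fin.sum_univ_three, lor_add_right, lor_add_right]

/-- The normals of three faces that meet at an ideal vertex with dihedral angles `π / 3`. -/
structure Frame (e : Fin 3 → Mink) : Prop where
  unit : ∀ i, lor (e i) (e i) = 1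
  pair : ∀ i j, i ≠ j → lor (e i) (e j) = -1 / 2
  future : 0 < (apex e).1

namespace Frame

variable {e : Fin 3 → Mink}

lemma lor_eq_ite (h : Frame e) (i j : Fin 3) :
    lor (e i) (e j) = if i = j then 1 else -1 / 2 := by
  split_ifs with hij
  · rw [hij, h.unit]
  · exact h.pair i j hij

lemma lor_apex (h : Frame e) (i : Fin 3) : lor (apex e) (e i) = 0 := by
  rw [lor_comm, lor_apex_right]
  fin_cases i <;> norm_num [h.lor_eq_ite, Fin.ext_iff]

lemma lor_apex_self (h : Frame e) : lor (apex e) (apex e) = 0 := by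
  rw [lor_apex_right, h.lor_apex, h.lor_apex, h.lor_apex, add_zero, add_zero]

lemma apex_ne_zero (h : Frame e) : apex e ≠ 0 := fun h0 =>
  h.future.ne' (by rw [h0, Prod.fst_zero])

lemma exists_mem_perp_lor_apex_ne_zero (h : Frame e) :
    ∃ w ∈ perp (e 0) ⊓ perp (e 1), lor w (apex e) ≠ 0 := by
  obtain ⟨n, hn⟩ : ∃ n, lor (apex e) n ≠ 0 := by
    by_contra! hall
    exact h.apex_ne_zero (eq_zero_of_forall_lor_eq_zero hall)
  set a := 2 / 3 * (2 * lor n (e 0) + lor n (e 1))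
  set b := 2 / 3 * (lor n (e 0) + 2 * lor n (e 1))
  refine ⟨n - a • e 0 - b • e 1, ⟨mem_perp.mpr ?_, mem_perp.mpr ?_⟩, ?_⟩
  · rw [lor_sub_left, lor_sub_left, lor_smul_left, lor_smul_left, h.unit,
      h.pair 1 0 (by decide)]
    ring
  · rw [lor_sub_left, lor_sub_left, lor_smul_left, lor_smul_left, h.unit,
      h.pair 0 1 (by decide)]
    ring
  · rwa [lor_sub_left, lor_sub_left, lor_smul_left, lor_smul_left, lor_comm (e 0),
      lor_comm (e 1), h.lor_apex, h.lor_apex, mul_zero, mul_zero, sub_zero, sub_zero, lor_comm]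

lemma exists_eq_smul_apex (h : Frame e) {d : Mink} (hd : ∀ i, lor d (e i) = 0) :
    ∃ c : ℝ, d = c • apex e := by
  set W := perp (e 0) ⊓ perp (e 1)
  have hW : Module.finrank ℝ W = 2 := finrank_perp_inf_perp
    (by rw [h.unit]; exact one_ne_zero)
    (by rw [h.unit, h.unit, h.pair 0 1 (by decide)]; norm_num)
  have hlt : W ⊓ perp (apex e) < W := by
    obtain ⟨w, hw, hwn⟩ := h.exists_mem_perp_lor_apex_ne_zero
    exact inf_lt_left.mpr fun hle => hwn (mem_perp.mp (hle hw))
  have hapex : apex e ∈ W ⊓ perp (apex e) :=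
    ⟨⟨mem_perp.mpr (h.lor_apex 0), mem_perp.mpr (h.lor_apex 1)⟩, mem_perp.mpr h.lor_apex_self⟩
  have hdW : d ∈ W ⊓ perp (apex e) := ⟨⟨mem_perp.mpr (hd 0), mem_perp.mpr (hd 1)⟩,
    mem_perp.mpr (by rw [lor_apex_right, hd, hd, hd, add_zero, add_zero])⟩
  have hrank : Module.finrank ℝ (W ⊓ perp (apex e) : Submodule ℝ Mink) ≤ 1 := by
    have := Submodule.finrank_lt_finrank_of_lt hlt
    omega
  obtain ⟨v, hv⟩ := finrank_le_one_iff.mp hrank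
  obtain ⟨a, ha⟩ := hv ⟨apex e, hapex⟩
  obtain ⟨b, hb⟩ := hv ⟨d, hdW⟩
  replace ha : a • v.1 = apex e := congrArg Subtype.val ha
  replace hb : b • v.1 = d := congrArg Subtype.val hb
  have ha0 : a ≠ 0 := fun h0 => h.apex_ne_zero (by rw [← ha, h0, zero_smul])
  exact ⟨b * a⁻¹, by rw [← ha, ← hb, smul_smul, inv_mul_cancel_right₀ ha0]⟩

lemma exists_lor_eq (h : Frame e) (Y : Fin 3 → ℝ) : ∃ x, ∀ i, lor x (e i) = Y i := by
  set L : Mink →ₗ[ℝ] (Fin 3 → ℝ) := LinearMap.pi fun i => lorDual (e i)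
  have hker : LinearMap.ker L ≤ Submodule.span ℝ {apex e} := fun d hd => by
    obtain ⟨c, rfl⟩ := h.exists_eq_smul_apex (d := d) (congrFun hd)
    exact Submodule.smul_mem _ _ (Submodule.mem_span_singleton_self _)
  have hkerrank := Submodule.finrank_mono hker
  have hnullity := LinearMap.finrank_range_add_finrank_ker L
  rw [finrank_span_singleton h.apex_ne_zero] at hkerrank
  rw [finrank_mink] at hnullity
  have hrange : LinearMap.range L = ⊤ := by
    refine Submodule.eq_top_of_finrank_eq ((Submodule.finrank_le _).antisymm ?_)
    rw [Module.finrank_fin_fun]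
    omega
  obtain ⟨x, hx⟩ := LinearMap.range_eq_top.mp hrange Y
  exact ⟨x, congrFun hx⟩

lemma lor_self_of_perp (h : Frame e) {d : Mink} (hd : lor d (apex e) = 0) :
    lor d d = 2 / 3 * ∑ i, lor d (e i) ^ 2 := by
  rw [Fin.sum_univ_three]
  have hsum := hd
  rw [lor_apex_right] at hsum
  obtain ⟨c, hc⟩ := h.exists_eq_smul_apex (d := d - (2 / 3 * lor d (e 0)) • e 0 -
      (2 / 3 * lor d (e 1)) • e 1 - (2 / 3 * lor d (e 2)) • e 2) fun i => by
    simp only [lor_sub_left, lor_smul_left, h.lor_eq_ite]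
    match i with
    | 0 | 1 | 2 => norm_num [Fin.ext_iff]; linarith
  have hpair := congrArg (fun v => lor v d) hc
  simp only [lor_sub_left, lor_smul_left] at hpair
  rw [lor_comm (apex e), hd, lor_comm (e 0), lor_comm (e 1), lor_comm (e 2)] at hpair
  linear_combination hpair

/-- After scaling `x` and `y` to equal height over the apex their difference is orthogonal to it,
so `lor_self_of_perp` expresses the form through the products with the frame. -/
lemma lor_eq (h : Frame e) {x y : Mink} (hx : lor x (apex e) ≠ 0) (hy : lor y (apex e) ≠ 0) :
    2 * lor x y / (lor x (apex e) * lor y (apex e)) =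
      lor x x / lor x (apex e) ^ 2 + lor y y / lor y (apex e) ^ 2 -
        2 / 3 * ∑ i, (lor x (e i) / lor x (apex e) - lor y (e i) / lor y (apex e)) ^ 2 := by
  set s := lor x (apex e) with hs
  set m := lor y (apex e) with hm
  have hdiff := h.lor_self_of_perp (d := s⁻¹ • x - m⁻¹ • y) (by
    rw [lor_sub_left, lor_smul_left, lor_smul_left, ← hs, ← hm, inv_mul_cancel₀ hx,
      inv_mul_cancel₀ hy, sub_self])
  simp only [lor_sub_left, lor_sub_right, lor_smul_left, lor_smul_right, lor_comm y x] at hdiff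
  simp only [div_eq_inv_mul _ s, div_eq_inv_mul _ m, ← hdiff]
  field

lemma lor_apex_neg (h : Frame e) (x : H3) : lor x.1 (apex e) < 0 :=
  x.lor_neg h.lor_apex_self.le h.future

lemma ext_H3 (h : Frame e) {x y : H3} (hxy : ∀ i, lor x.1 (e i) = lor y.1 (e i)) : x = y := by
  obtain ⟨c, hc⟩ :=
    h.exists_eq_smul_apex (d := x.1 - y.1) (fun i => by rw [lor_sub_left, hxy, sub_self])
  have hx : x.1 = y.1 + c • apex e := sub_eq_iff_eq_add'.mp hc
  have hself := x.2.1
  rw [hx] at hself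
  simp only [lor_add_left y.1, lor_add_right _ y.1, lor_smul_left, lor_smul_right, y.2.1,
    h.lor_apex_self, lor_comm (apex e) y.1] at hself
  have hc0 : c = 0 := (mul_eq_zero.mp (by linarith)).resolve_right (h.lor_apex_neg y).ne
  exact Subtype.ext (by rw [hx, hc0, zero_smul, add_zero])

lemma exists_H3 (h : Frame e) (Y : Fin 3 → ℝ) (hY : 0 < Y 0 + Y 1 + Y 2) :
    ∃ x : H3, ∀ i, lor x.1 (e i) = -Y i := by
  obtain ⟨x, hx⟩ := h.exists_lor_eq fun i => -Y i
  set s := Y 0 + Y 1 + Y 2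
  have hxv : lor x (apex e) = -s := by
    rw [lor_apex_right, hx, hx, hx]
    ring
  set c := (lor x x + 1) / (2 * s) with hc
  have hcs : 2 * c * s = lor x x + 1 := by
    rw [hc]
    field_simp
  have hself : lor (x + c • apex e) (x + c • apex e) = -1 := by
    simp only [lor_add_left x, lor_add_right _ x, lor_smul_left, lor_smul_right,
      h.lor_apex_self, lor_comm (apex e) x, hxv]
    linear_combination -hcs
  have hneg : lor (x + c • apex e) (apex e) < 0 := by
    rw [lor_add_left, lor_smul_left, h.lor_apex_self, hxv, mul_zero, add_zero]
    exact neg_neg_of_pos hY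
  refine ⟨⟨_, hself, future_of_lor_neg (by rw [hself]; norm_num) h.lor_apex_self.le h.future
    hneg⟩, fun i => ?_⟩
  change lor (x + c • apex e) (e i) = -Y i
  rw [lor_add_left, lor_smul_left, h.lor_apex, hx, mul_zero, add_zero]

end Frame

/-- The chart at an ideal vertex: in the upper half-space model with the vertex at infinity, the
first two barycentric coordinates of the foot of the point, and a multiple of its inverse squared
height. -/
noncomputable def chart (e : Fin 3 → Mink) (x : H3) : E3 :=
  !₂[lor x.1 (e 0) / lor x.1 (apex e), lor x.1 (e 1) / lor x.1 (apex e), lor x.1 (apex e) ^ 2]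

lemma Frame.chart_injective {e : Fin 3 → Mink} (h : Frame e) : Function.Injective (chart e) := by
  intro x y hxy
  have hcoord : ∀ i, chart e x i = chart e y i := fun i => by rw [hxy]
  have hx := h.lor_apex_neg x
  have hy := h.lor_apex_neg y
  have hapex : lor x.1 (apex e) = lor y.1 (apex e) :=
    (sq_eq_sq_iff_eq_or_eq_neg.mp (hcoord 2)).resolve_right (by linarith)
  have h0 : lor x.1 (e 0) = lor y.1 (e 0) :=
    (div_left_inj' hy.ne).mp (by rw [← hapex]; simpa [chart, hapex] using hcoord 0)
  have h1 : lor x.1 (e 1) = lor y.1 (e 1) :=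
    (div_left_inj' hy.ne).mp (by simpa [chart, hapex] using hcoord 1)
  refine h.ext_H3 fun i => ?_
  rw [lor_apex_right, lor_apex_right] at hapex
  fin_cases i
  exacts [h0, h1, show lor x.1 (e 2) = lor y.1 (e 2) by linarith]

/-! ### Volume in the chart -/

open Matrix in
lemma det_bordered {K n : Type*} [Field K] [Fintype n] [DecidableEq n] {a : K} (ha : a ≠ 0)
    (b c : n → K) (D : Matrix n n K) :
    (fromBlocks (of fun _ _ : Unit => a) (of fun _ => b) (of fun i _ => c i) D).det =
      a * (D - of fun i j => c i * a⁻¹ * b j).det := by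
  let : Invertible (of fun _ _ : Unit => a) :=
    invertibleOfIsUnitDet _ (by rw [det_unique]; exact ha.isUnit)
  rw [det_fromBlocks₁₁, det_unique, invOf_eq_nonsing_inv, inv_subsingleton]
  congr 2
  ext i j
  simp [mul_apply]

/-- The matrix of time and space coordinates of a family of vectors. -/
noncomputable def coordMatrix {ι : Type*} (r : ι → Mink) : Matrix ι (Unit ⊕ Fin 3) ℝ :=
  Matrix.of fun i => Sum.elim (fun _ => (r i).1) (r i).2

lemma coordMatrix_det_sq (r : Unit ⊕ Fin 3 → Mink) :
    (coordMatrix r).det ^ 2 = -(Matrix.of fun i j => lor (r i) (r j)).det := by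
  have hgram : (Matrix.of fun i j => lor (r i) (r j)) =
      coordMatrix r * Matrix.diagonal (Sum.elim (fun _ => -1) fun _ => 1) *
        (coordMatrix r).transpose := by
    ext i j
    rw [Matrix.mul_apply]
    simp [Matrix.mul_diagonal, coordMatrix, lor, PiLp.inner_apply, mul_comm]
  rw [hgram, Matrix.det_mul, Matrix.det_mul, Matrix.det_diagonal, Matrix.det_transpose]
  simp only [Fintype.prod_sum_type, Sum.elim_inl, Sum.elim_inr, Finset.univ_unique,
    Finset.prod_singleton, Finset.prod_const_one]
  ring

/-- The gradient of `y ↦ ⟨lift y, e⟩`. -/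
noncomputable def gradLor (e : Mink) (y : E3) : E3 := e.2 - (e.1 / √(1 + ‖y‖ ^ 2)) • y

lemma gradLor_apex (e : Fin 3 → Mink) (y : E3) :
    gradLor (apex e) y = gradLor (e 0) y + gradLor (e 1) y + gradLor (e 2) y := by
  simp only [gradLor, apex, Fin.sum_univ_three, Prod.fst_add, Prod.snd_add]
  module

lemma hasFDerivAt_lor_lift (e : Mink) (y : E3) :
    HasFDerivAt (fun y => lor (lift y).1 e) (innerSL ℝ (gradLor e y)) y := by
  have hpos : (0 : ℝ) < 1 + ‖y‖ ^ 2 := by positivity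
  have htime : HasFDerivAt (fun y : E3 => 1 + ‖y‖ ^ 2) (2 • innerSL ℝ y) y :=
    (hasStrictFDerivAt_norm_sq y).hasFDerivAt.const_add 1
  have hspace : HasFDerivAt (fun y : E3 => inner ℝ y e.2) (innerSL ℝ e.2) y :=
    (innerSL ℝ e.2).hasFDerivAt.congr_of_eventuallyEq
      (.of_forall fun z => real_inner_comm _ _)
  refine (((htime.sqrt hpos.ne').mul_const e.1).neg.add hspace).congr_fderiv ?_
  ext z
  simp [gradLor]
  field_simp
  ring

lemma det_gradLor (e : Fin 3 → Mink) (y : E3) :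
    (coordMatrix (Sum.elim (fun _ : Unit => (lift y).1) e)).det =
      √(1 + ‖y‖ ^ 2) * (Matrix.of fun i k => gradLor (e i) y k).det := by
  have hblocks : coordMatrix (Sum.elim (fun _ : Unit => (lift y).1) e) =
      Matrix.fromBlocks (.of fun _ _ => √(1 + ‖y‖ ^ 2)) (.of fun _ => y) (.of fun i _ => (e i).1)
        (.of fun i k => (e i).2 k) := by
    ext (i | i) (j | j) <;> rfl
  rw [hblocks, det_bordered (Real.sqrt_pos.mpr (by positivity)).ne']
  congr 2

/-- The rows of the Jacobian matrix of `chart e ∘ lift`. -/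
noncomputable def chartRow (e : Fin 3 → Mink) (y : E3) : Fin 3 → E3 :=
  let t := lor (lift y).1 (apex e)
  let g := gradLor (apex e) y
  ![t⁻¹ • gradLor (e 0) y - (lor (lift y).1 (e 0) / t ^ 2) • g,
    t⁻¹ • gradLor (e 1) y - (lor (lift y).1 (e 1) / t ^ 2) • g, (2 * t) • g]

/-- The derivative of `chart e ∘ lift`. -/
noncomputable def chartDeriv (e : Fin 3 → Mink) (y : E3) : E3 →L[ℝ] E3 :=
  (Matrix.toEuclideanLin (Matrix.of fun i k => chartRow e y i k)).toContinuousLinearMap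

lemma chartDeriv_apply (e : Fin 3 → Mink) (y z : E3) (i : Fin 3) :
    chartDeriv e y z i = inner ℝ (chartRow e y i) z := by
  simp [chartDeriv, Matrix.toEuclideanLin, Matrix.mulVec, dotProduct, PiLp.inner_apply, mul_comm]

lemma chartDeriv_det (e : Fin 3 → Mink) (y : E3) :
    (chartDeriv e y).det = (Matrix.of fun i k => chartRow e y i k).det := by
  rw [ContinuousLinearMap.det, chartDeriv, LinearMap.coe_toContinuousLinearMap,
    Matrix.toEuclideanLin_eq_toLin_orthonormal, LinearMap.det_toLin]

namespace Frame

variable {e : Fin 3 → Mink}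

lemma hasFDerivAt_chart (h : Frame e) (y : E3) :
    HasFDerivAt (fun y => chart e (lift y)) (chartDeriv e y) y := by
  set t := lor (lift y).1 (apex e) with ht
  have ht0 : t ≠ 0 := (h.lor_apex_neg (lift y)).ne
  have hquot : ∀ f : Mink, HasFDerivAt (fun y => lor (lift y).1 f / lor (lift y).1 (apex e))
      (innerSL ℝ (t⁻¹ • gradLor f y - (lor (lift y).1 f / t ^ 2) • gradLor (apex e) y)) y := by
    intro f
    have hinv := (hasDerivAt_inv ht0).comp_hasFDerivAt y (hasFDerivAt_lor_lift (apex e) y)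
    simp only [div_eq_mul_inv]
    refine ((hasFDerivAt_lor_lift f y).mul hinv).congr_fderiv ?_
    ext z
    simp [← ht]
    field_simp
    ring
  rw [← hasFDerivWithinAt_univ, hasFDerivWithinAt_euclidean]
  intro i
  have hproj : PiLp.proj 2 (fun _ : Fin 3 => ℝ) i ∘L chartDeriv e y =
      innerSL ℝ (chartRow e y i) := by
    ext z
    simpa using chartDeriv_apply e y z i
  rw [hproj, hasFDerivWithinAt_univ]
  fin_cases i
  · exact hquot (e 0)
  · exact hquot (e 1)
  · refine ((hasFDerivAt_lor_lift (apex e) y).pow 2).congr_fderiv ?_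
    ext z
    simp [chartRow]

lemma coordMatrix_det_sq (h : Frame e) (x : H3) :
    (coordMatrix (Sum.elim (fun _ : Unit => x.1) e)).det ^ 2 = 3 / 4 * lor x.1 (apex e) ^ 2 := by
  have hblocks : (Matrix.of fun i j : Unit ⊕ Fin 3 =>
      lor (Sum.elim (fun _ => x.1) e i) (Sum.elim (fun _ => x.1) e j)) =
      Matrix.fromBlocks (.of fun _ _ => -1) (.of fun _ j => lor x.1 (e j))
        (.of fun i _ => lor x.1 (e i)) (.of fun i j => if i = j then 1 else -1 / 2) := by
    ext (i | i) (j | j)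
    exacts [x.2.1, rfl, lor_comm _ _, h.lor_eq_ite i j]
  rw [HypPoly.coordMatrix_det_sq, hblocks, det_bordered (by norm_num), Matrix.det_fin_three,
    lor_apex_right]
  norm_num [Matrix.sub_apply, Fin.ext_iff]
  ring

lemma det_chartRow (h : Frame e) (y : E3) :
    (Matrix.of fun i k => chartRow e y i k).det * lor (lift y).1 (apex e) =
      2 * (Matrix.of fun i k => gradLor (e i) y k).det := by
  have ht := (h.lor_apex_neg (lift y)).ne
  rw [Matrix.det_fin_three, Matrix.det_fin_three]
  simp only [chartRow, Matrix.of_apply, Matrix.cons_val, PiLp.sub_apply, PiLp.smul_apply,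
    smul_eq_mul, gradLor_apex, PiLp.add_apply]
  rw [lor_apex_right] at ht ⊢
  field_simp
  ring

lemma abs_det_chartDeriv (h : Frame e) (y : E3) :
    |(chartDeriv e y).det| = √3 * (1 / √(1 + ‖y‖ ^ 2)) := by
  have ht := (h.lor_apex_neg (lift y)).ne
  have hdet := h.det_chartRow y
  have hgram := h.coordMatrix_det_sq (lift y)
  rw [← chartDeriv_det] at hdet
  rw [det_gradLor] at hgram
  set s := √(1 + ‖y‖ ^ 2)
  have hs : 0 < s := Real.sqrt_pos.mpr (by positivity)
  have hsq : ((chartDeriv e y).det * s) ^ 2 = √3 ^ 2 := by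
    rw [Real.sq_sqrt (by norm_num)]
    refine mul_right_cancel₀ (pow_ne_zero 2 ht) ?_
    linear_combination 4 * hgram + s ^ 2 * ((chartDeriv e y).det * lor (lift y).1 (apex e) +
      2 * (Matrix.of fun i k => gradLor (e i) y k).det) * hdet
  have habs := (sq_eq_sq_iff_abs_eq_abs _ _).mp hsq
  rw [abs_mul, abs_of_pos hs, abs_of_nonneg (Real.sqrt_nonneg 3)] at habs
  rwa [mul_one_div, eq_div_iff hs.ne']

end Frame

lemma lift_space (x : H3) : lift x.1.2 = x := by
  refine Subtype.ext (Prod.ext ?_ rfl)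
  have hx := x.2.1
  rw [lor_self] at hx
  change √(1 + ‖x.1.2‖ ^ 2) = x.1.1
  rw [show 1 + ‖x.1.2‖ ^ 2 = x.1.1 ^ 2 by linarith, Real.sqrt_sq x.2.2.le]

lemma lift_injective : Function.Injective lift :=
  Function.LeftInverse.injective (g := fun x : H3 => x.1.2) fun _ => rfl

lemma Frame.volume_chart_image {e : Fin 3 → Mink} (h : Frame e) {A : Set H3}
    (hA : MeasurableSet A) : volume (chart e '' A) = ENNReal.ofReal (√3) * vol A := by
  have himage : chart e '' A = (fun y => chart e (lift y)) '' (lift ⁻¹' A) := by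
    rw [← Function.comp_def, Set.image_comp,
      Set.image_preimage_eq A fun x => ⟨x.1.2, lift_space x⟩]
  rw [himage, ← lintegral_abs_det_fderiv_eq_addHaar_image volume (measurable_lift hA)
    (fun y _ => (h.hasFDerivAt_chart y).hasFDerivWithinAt)
    (h.chart_injective.comp lift_injective).injOn, vol_apply hA,
    ← lintegral_const_mul _ (by fun_prop)]
  congr 1
  ext y
  rw [h.abs_det_chartDeriv, ENNReal.ofReal_mul (by positivity)]

/-! ### Ideal vertices and their cells -/

lemma exists_univ_eq_triple (i : Fin 3) :
    ∃ j k, i ≠ j ∧ i ≠ k ∧ j ≠ k ∧ (Finset.univ : Finset (Fin 3)) = {i, j, k} := by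
  decide +revert

lemma add_le_of_separated {p q : Fin 3 → ℝ} {r s : ℝ} (hr : 0 < r) (hs : 0 < s)
    (hpsum : ∑ j, p j = 1) (hqsum : ∑ j, q j = 1) (hp : ∀ j, r / 2 ≤ p j) (hq : ∀ j, s / 2 ≤ q j)
    {i : Fin 3} (hpi : p i = r / 2) (hqi : q i = s / 2)
    (hsep : r ^ 2 + s ^ 2 + r * s ≤ 2 / 3 * ∑ j, (p j - q j) ^ 2) : r + s ≤ 2 / 3 := by
  obtain ⟨j, k, hij, hik, hjk, huniv⟩ := exists_univ_eq_triple i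
  have hsum : ∀ f : Fin 3 → ℝ, ∑ l, f l = f i + f j + f k := fun f => by
    simp [huniv, hij, hik, hjk, add_assoc]
  rw [hsum] at hpsum hqsum hsep
  have hpk : p k = 1 - r / 2 - p j := by linarith
  have hqk : q k = 1 - s / 2 - q j := by linarith
  rw [hpi, hqi, hpk, hqk] at hsep
  have hdist : (3 / 4 * (r + s)) ^ 2 ≤ ((p j + r / 4) - (q j + s / 4)) ^ 2 := by nlinarith
  have habs := sq_le_sq.mp hdist
  rw [abs_of_pos (by positivity)] at habs
  rcases abs_cases ((p j + r / 4) - (q j + s / 4)) with ⟨heq, -⟩ | ⟨heq, -⟩ <;>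
    linarith [hp j, hp k, hq j, hq k]

lemma sq_le_of_corner {p q : Fin 3 → ℝ} (hpsum : ∑ j, p j = 1) (hqsum : ∑ j, q j = 1) {i : Fin 3}
    (hq : ∀ j ≠ i, q j = 0) : (1 - p i) ^ 2 ≤ 2 / 3 * ∑ j, (p j - q j) ^ 2 := by
  obtain ⟨j, k, hij, hik, hjk, huniv⟩ := exists_univ_eq_triple i
  have hsum : ∀ f : Fin 3 → ℝ, ∑ l, f l = f i + f j + f k := fun f => by
    simp [huniv, hij, hik, hjk, add_assoc]
  rw [hsum] at hpsum hqsum ⊢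
  rw [hq j hij.symm, hq k hik.symm, add_zero, add_zero] at hqsum
  rw [hq j hij.symm, hq k hik.symm, hqsum, show p i = 1 - p j - p k by linarith]
  nlinarith [sq_nonneg (p j - p k)]

namespace Frame

variable {e : Fin 3 → Mink}

lemma injective (h : Frame e) : Function.Injective e := by
  intro i j hij
  by_contra hne
  have hpair := h.pair i j hne
  rw [hij, h.unit] at hpair
  norm_num at hpair

/-- The set of the three faces that meet at an ideal vertex. -/
noncomputable def faces (h : Frame e) : Finset Mink := Finset.univ.map ⟨e, h.injective⟩

lemma mem_faces (h : Frame e) {f : Mink} : f ∈ h.faces ↔ ∃ i, e i = f := by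
  simp [faces]

lemma apply_mem_faces (h : Frame e) (i : Fin 3) : e i ∈ h.faces := h.mem_faces.mpr ⟨i, rfl⟩

lemma sum_faces (h : Frame e) : ∑ f ∈ h.faces, f = apex e := Finset.sum_map ..

lemma card_faces (h : Frame e) : h.faces.card = 3 := Finset.card_map _

lemma lor_apex_of_mem_faces (h : Frame e) {f : Mink} (hf : f ∈ h.faces) :
    lor f (apex e) = 0 := by
  obtain ⟨i, rfl⟩ := h.mem_faces.mp hf
  rw [lor_comm, h.lor_apex]

lemma sum_lor_div {x : Mink} (hx : lor x (apex e) ≠ 0) :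
    ∑ i, lor x (e i) / lor x (apex e) = 1 := by
  rw [Fin.sum_univ_three, ← add_div, ← add_div, ← lor_apex_right, div_self hx]

/-- In the upper half-space model with the vertex at infinity, `D` and `E` are hemispheres over the
same side of the base triangle, and the left-hand side is the sum of their radii. The hemispheres
do not overlap. -/
lemma inv_add_inv_le (h : Frame e) {D E : Mink} (hD : lor D D = 1) (hE : lor E E = 1)
    (hDE : lor D E ≤ -1 / 2) {i : Fin 3} (hDi : lor D (e i) = -1 / 2) (hEi : lor E (e i) = -1 / 2)
    (hDe : ∀ j, lor D (e j) ≤ -1 / 2) (hEe : ∀ j, lor E (e j) ≤ -1 / 2) :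
    1 / -lor D (apex e) + 1 / -lor E (apex e) ≤ 2 / 3 := by
  have hD0 : lor D (apex e) < 0 := by rw [lor_apex_right]; linarith [hDe 0, hDe 1, hDe 2]
  have hE0 : lor E (apex e) < 0 := by rw [lor_apex_right]; linarith [hEe 0, hEe 1, hEe 2]
  have hlor := h.lor_eq hD0.ne hE0.ne
  set s := lor D (apex e)
  set t := lor E (apex e)
  have hDE' : 2 * lor D E / (s * t) ≤ -1 / (s * t) :=
    div_le_div_of_nonneg_right (by linarith) (mul_pos_of_neg_of_neg hD0 hE0).le
  have hhalf : ∀ u : ℝ, 1 / -u / 2 = -1 / 2 / u := fun u => by field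
  refine add_le_of_separated (i := i) (one_div_pos.mpr (neg_pos.mpr hD0))
    (one_div_pos.mpr (neg_pos.mpr hE0)) (sum_lor_div hD0.ne) (sum_lor_div hE0.ne)
    (fun j => ?_) (fun j => ?_) ?_ ?_ ?_
  · rw [hhalf]
    exact div_le_div_of_nonpos_of_le hD0.le (hDe j)
  · rw [hhalf]
    exact div_le_div_of_nonpos_of_le hE0.le (hEe j)
  · rw [hhalf, hDi]
  · rw [hhalf, hEi]
  · have hsq : (1 / -s) ^ 2 + (1 / -t) ^ 2 + 1 / -s * (1 / -t) =
        1 / s ^ 2 + 1 / t ^ 2 - -1 / (s * t) := by field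
    rw [hD, hE] at hlor
    rw [hsq]
    linarith

lemma lor_nonpos_of_apex_le (h : Frame e) {x : H3} {f : Mink} (hf : lor f f = 1)
    (hfe : lor f (apex e) ≤ -2) (hx : lor x.1 (apex e) ^ 2 < 3) : lor x.1 f ≤ 0 := by
  have hx0 := h.lor_apex_neg x
  have hlor := h.lor_eq hx0.ne (y := f) (by linarith)
  rw [x.2.1, hf] at hlor
  have hinv : 1 / lor f (apex e) ^ 2 ≤ 1 / lor x.1 (apex e) ^ 2 :=
    one_div_le_one_div_of_le (sq_pos_of_neg hx0) (by nlinarith)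
  have hsum := Finset.sum_nonneg fun i (_ : i ∈ Finset.univ) =>
    sq_nonneg (lor x.1 (e i) / lor x.1 (apex e) - lor f (e i) / lor f (apex e))
  by_contra! hpos
  have hquot : 0 < 2 * lor x.1 f / (lor x.1 (apex e) * lor f (apex e)) :=
    div_pos (by linarith) (mul_pos_of_neg_of_neg hx0 (by linarith))
  rw [neg_div] at hlor
  linarith

lemma lor_lt_apex_of_far (h : Frame e) {x : H3} {n : Mink} (hn : lor n n = 0)
    (hne : lor n (apex e) ≤ -6) (hx : lor x.1 (apex e) ^ 2 < 3) :
    lor x.1 n < lor x.1 (apex e) := by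
  have hx0 := h.lor_apex_neg x
  have hlor := h.lor_eq hx0.ne (y := n) (by linarith)
  rw [x.2.1, hn, zero_div, add_zero] at hlor
  have hsum := Finset.sum_nonneg fun i (_ : i ∈ Finset.univ) =>
    sq_nonneg (lor x.1 (e i) / lor x.1 (apex e) - lor n (e i) / lor n (apex e))
  set s := lor x.1 (apex e)
  set t := lor n (apex e)
  have hquot : 2 * lor x.1 n / (s * t) ≤ -1 / s ^ 2 := by linarith
  rw [div_le_iff₀ (mul_pos_of_neg_of_neg hx0 (by linarith)),
    show -1 / s ^ 2 * (s * t) = -t / s by field, le_div_iff_of_neg hx0] at hquot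
  by_contra! hle
  nlinarith

/-- The points equidistant from `n` and the apex form a hemisphere centred at the corner `n` of the
base triangle. The condition on `x` measures the distance of its foot from that corner along the
altitude only. -/
lemma lor_lt_apex_of_corner (h : Frame e) {x : H3} {n : Mink} (hn : lor n n = 0)
    (hne : lor n (apex e) < 0) {i : Fin 3} (hni : ∀ j ≠ i, lor n (e j) = 0)
    (hx : lor x.1 (apex e) ^ 2 *
      (2 / -lor n (apex e) - (1 - lor x.1 (e i) / lor x.1 (apex e)) ^ 2) < 1) :
    lor x.1 n < lor x.1 (apex e) := by
  have hx0 := h.lor_apex_neg x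
  have hlor := h.lor_eq hx0.ne hne.ne
  have hcorner := sq_le_of_corner (sum_lor_div hx0.ne) (sum_lor_div hne.ne) (i := i) fun j hj => by
    rw [hni j hj, zero_div]
  rw [x.2.1, hn, zero_div, add_zero, neg_div] at hlor
  set s := lor x.1 (apex e)
  set t := lor n (apex e)
  rw [mul_comm, ← lt_div_iff₀ (sq_pos_of_neg hx0)] at hx
  have hquot : 2 * lor x.1 n / (s * t) < -(2 / -t) := by linarith
  rw [div_lt_iff₀ (mul_pos_of_neg_of_neg hx0 hne), show -(2 / -t) * (s * t) = 2 * s by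
    have := hne.ne; field_simp] at hquot
  linarith

lemma lor_apex_apex [DecidableEq Mink] {e' : Fin 3 → Mink} (h : Frame e) (h' : Frame e') :
    lor (apex e') (apex e) = ∑ f ∈ h'.faces \ h.faces, lor f (apex e) := by
  rw [← h'.sum_faces, lor_sum_left, ← Finset.sum_inter_add_sum_sdiff h'.faces h.faces,
    Finset.sum_eq_zero fun f hf => h.lor_apex_of_mem_faces (Finset.mem_inter.mp hf).2, zero_add]

lemma exists_sdiff_eq_singleton [DecidableEq Mink] {e' : Fin 3 → Mink} (h : Frame e)
    (h' : Frame e') (hne : h'.faces ≠ h.faces) (hcard : 2 ≤ (h'.faces ∩ h.faces).card) :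
    ∃ b i, h'.faces \ h.faces = {b} ∧ ∀ j ≠ i, e j ∈ h'.faces := by
  have hcard' : (h'.faces ∩ h.faces).card ≠ 3 := fun hc => hne <|
    (Finset.eq_of_subset_of_card_le Finset.inter_subset_left (by rw [hc, h'.card_faces])).symm.trans
      (Finset.eq_of_subset_of_card_le Finset.inter_subset_right (by rw [hc, h.card_faces]))
  have hle := Finset.card_le_card (Finset.inter_subset_right (s₁ := h'.faces) (s₂ := h.faces))
  have hsdiff := Finset.card_sdiff_add_card_inter h'.faces h.faces
  have hsdiff' := Finset.card_sdiff_add_card_inter h.faces h'.faces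
  rw [Finset.inter_comm] at hsdiff'
  rw [h.card_faces] at hle hsdiff'
  rw [h'.card_faces] at hsdiff
  obtain ⟨b, hb⟩ := Finset.card_eq_one.mp (show (h'.faces \ h.faces).card = 1 by omega)
  obtain ⟨c, hc⟩ := Finset.card_eq_one.mp (show (h.faces \ h'.faces).card = 1 by omega)
  obtain ⟨i, rfl⟩ := h.mem_faces.mp (Finset.mem_sdiff.mp (hc ▸ Finset.mem_singleton_self c)).1
  refine ⟨b, i, hb, fun j hji => ?_⟩
  by_contra hj
  have hmem := Finset.mem_sdiff.mpr ⟨h.apply_mem_faces j, hj⟩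
  rw [hc, Finset.mem_singleton] at hmem
  exact hji (h.injective hmem)

end Frame

/-- No four faces are pairwise adjacent. -/
def NoTetrahedron (N : Finset Mink) : Prop :=
  ∀ e, Frame e → (∀ i, e i ∈ N) → ∀ k ∈ N, ∃ i, lor k (e i) ≠ -1 / 2

open Classical in
/-- The ideal vertices, encoded as the sets of the three faces that meet there. -/
noncomputable def vertices (N : Finset Mink) : Finset (Finset Mink) :=
  N.powerset.filter fun T => ∃ (e : Fin 3 → Mink) (he : Frame e), he.faces = T

lemma mem_vertices {N T : Finset Mink} :
    T ∈ vertices N ↔ ∃ (e : Fin 3 → Mink) (he : Frame e), (∀ i, e i ∈ N) ∧ he.faces = T := by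
  simp only [vertices, Finset.mem_filter, Finset.mem_powerset]
  constructor
  · rintro ⟨hTN, e, he, rfl⟩
    exact ⟨e, he, fun i => hTN (he.apply_mem_faces i), rfl⟩
  · rintro ⟨e, he, heN, rfl⟩
    exact ⟨fun f hf => by obtain ⟨i, rfl⟩ := he.mem_faces.mp hf; exact heN i, e, he, rfl⟩

/-- The part of the polyhedron that is closest to a given ideal vertex, as measured by the horoballs
that the apexes determine. -/
def cell (N T : Finset Mink) : Set H3 :=
  {x | (∀ e ∈ N, lor x.1 e ≤ 0) ∧
    ∀ T' ∈ vertices N, T' ≠ T → lor x.1 (∑ f ∈ T', f) < lor x.1 (∑ f ∈ T, f)}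

namespace NormalSystem

variable {N : Finset Mink} {e : Fin 3 → Mink}

lemma frame (h : NormalSystem N) (heN : ∀ i, e i ∈ N)
    (hpair : ∀ i j, i ≠ j → lor (e i) (e j) = -1 / 2) : Frame e := by
  have hunit := fun i => h.unit _ (heN i)
  obtain ⟨x, hx⟩ := h.interior
  refine ⟨hunit, hpair, x.future_of_lor_neg ?_ ?_⟩
  · rw [apex, Fin.sum_univ_three]
    simp only [lor_add_left, lor_add_right, hunit, hpair 0 1 (by decide), hpair 0 2 (by decide),
      hpair 1 2 (by decide), hpair 1 0 (by decide), hpair 2 0 (by decide), hpair 2 1 (by decide)]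
    norm_num
  · rw [lor_apex_right]
    linarith [hx _ (heN 0), hx _ (heN 1), hx _ (heN 2)]

lemma exists_other_neighbor (h : NormalSystem N) {e f g : Mink} (he : e ∈ N) (hf : f ∈ N)
    (hg : g ∈ N) (hef : lor e f = -1 / 2) (heg : lor e g = -1 / 2) (hfg : lor f g = -1 / 2) :
    ∃ a ∈ N, a ≠ g ∧ lor e a = -1 / 2 ∧ lor f a = -1 / 2 ∧
      ∀ k ∈ N, lor e k = -1 / 2 → lor f k = -1 / 2 → k = g ∨ k = a := by
  obtain ⟨a, ha, b, hb, hab, hca, hcb⟩ := h.exists_common_neighbors he hf hef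
  have huniq := fun k hk hek hfk =>
    h.common_neighbor_unique (k := k) he hf ha hb hk hef hca hcb ⟨hek, hfk⟩ hab
  rcases huniq g hg heg hfg with rfl | rfl
  · exact ⟨b, hb, hab.symm, hcb.1, hcb.2, huniq⟩
  · exact ⟨a, ha, hab, hca.1, hca.2, fun k hk hek hfk => (huniq k hk hek hfk).symm⟩

lemma exists_opposite (h : NormalSystem N) (hno : NoTetrahedron N) (he : Frame e)
    (heN : ∀ i, e i ∈ N) (i : Fin 3) :
    ∃ a ∈ N, lor a (e i) ≤ -1 ∧ (∀ j ≠ i, lor a (e j) = -1 / 2) ∧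
      ∀ b ∈ N, b ∉ he.faces → (∀ j ≠ i, lor b (e j) = -1 / 2) → b = a := by
  obtain ⟨j, k, hij, hik, hjk, huniv⟩ := exists_univ_eq_triple i
  have hall : ∀ l ≠ i, l = j ∨ l = k := fun l hl => by
    have hmem := Finset.mem_univ l
    simpa [huniv, hl] using hmem
  obtain ⟨a, haN, hai, haj, hak, huniq⟩ := h.exists_other_neighbor (heN j) (heN k) (heN i)
    (he.pair _ _ hjk) (he.pair _ _ hij.symm) (he.pair _ _ hik.symm)
  have hae : ∀ l ≠ i, lor a (e l) = -1 / 2 := fun l hl => by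
    rcases hall l hl with rfl | rfl <;> rwa [lor_comm]
  refine ⟨a, haN, (h.gram a haN _ (heN i) hai).resolve_left fun hadj => ?_, hae,
    fun b hbN hbT hbe => ?_⟩
  · obtain ⟨l, hl⟩ := hno e he heN a haN
    by_cases hli : l = i
    exacts [hl (hli ▸ hadj), hl (hae l hli)]
  · refine (huniq b hbN ?_ ?_).resolve_left fun hbi => hbT (hbi ▸ he.apply_mem_faces i) <;>
      rw [lor_comm]
    exacts [hbe j hij.symm, hbe k hik.symm]

lemma lor_frame_le (h : NormalSystem N) (he : Frame e) (heN : ∀ i, e i ∈ N) {k : Mink}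
    (hk : k ∈ N) (hke : k ∉ he.faces) (i : Fin 3) : lor k (e i) ≤ -1 / 2 :=
  h.le_neg_half hk (heN i) fun hki => hke (hki ▸ he.apply_mem_faces i)

lemma lor_apex_le (h : NormalSystem N) (hno : NoTetrahedron N) (he : Frame e)
    (heN : ∀ i, e i ∈ N) {k : Mink} (hk : k ∈ N) (hke : k ∉ he.faces) :
    lor k (apex e) ≤ -2 := by
  obtain ⟨i, hi⟩ := hno e he heN k hk
  have hle := h.lor_frame_le he heN hk hke
  have hki : lor k (e i) ≤ -1 :=
    (h.gram k hk _ (heN i) fun hki => hke (hki ▸ he.apply_mem_faces i)).resolve_left hi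
  rw [lor_apex_right]
  fin_cases i
  · linarith [hle 1, hle 2, show lor k (e 0) ≤ -1 from hki]
  · linarith [hle 0, hle 2, show lor k (e 1) ≤ -1 from hki]
  · linarith [hle 0, hle 1, show lor k (e 2) ≤ -1 from hki]

lemma lor_apex_add_lor_apex_le (h : NormalSystem N) (hno : NoTetrahedron N) (he : Frame e)
    (heN : ∀ i, e i ∈ N) {D E : Mink} (hD : D ∈ N) (hDe : D ∉ he.faces) (hE : E ∈ N)
    (hEe : E ∉ he.faces) (hDE : D ≠ E) {i : Fin 3} (hDi : lor D (e i) = -1 / 2)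
    (hEi : lor E (e i) = -1 / 2) : lor D (apex e) + lor E (apex e) ≤ -6 := by
  have hradii := he.inv_add_inv_le (h.unit D hD) (h.unit E hE) (h.le_neg_half hD hE hDE) hDi hEi
    (h.lor_frame_le he heN hD hDe) (h.lor_frame_le he heN hE hEe)
  have hD2 := h.lor_apex_le hno he heN hD hDe
  have hE2 := h.lor_apex_le hno he heN hE hEe
  set m := -lor D (apex e)
  set m' := -lor E (apex e)
  rw [div_add_div _ _ (by linarith) (by linarith),
    div_le_div_iff₀ (mul_pos (by linarith) (by linarith)) (by norm_num)] at hradii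
  nlinarith [sq_nonneg (m - m')]

lemma lor_apex_apex_le (h : NormalSystem N) (hno : NoTetrahedron N) [DecidableEq Mink]
    {e' : Fin 3 → Mink} (he : Frame e) (heN : ∀ i, e i ∈ N) (he' : Frame e')
    (heN' : ∀ i, e' i ∈ N) (hcard : (he'.faces ∩ he.faces).card ≤ 1) :
    lor (apex e') (apex e) ≤ -6 := by
  have hmemN : ∀ f ∈ he'.faces, f ∈ N := fun f hf => by
    obtain ⟨i, rfl⟩ := he'.mem_faces.mp hf
    exact heN' i
  have hsdiff := Finset.card_sdiff_add_card_inter he'.faces he.faces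
  rw [he'.card_faces] at hsdiff
  rw [he.lor_apex_apex he']
  rcases Nat.le_one_iff_eq_zero_or_eq_one.mp hcard with hzero | hone
  · have hsum := Finset.sum_le_card_nsmul (he'.faces \ he.faces) (fun f => lor f (apex e)) (-2)
      fun f hf => have hf := Finset.mem_sdiff.mp hf
        h.lor_apex_le hno he heN (hmemN f hf.1) hf.2
    rw [show (he'.faces \ he.faces).card = 3 by omega] at hsum
    norm_num at hsum
    exact hsum
  · obtain ⟨k, hk⟩ := Finset.card_eq_one.mp hone
    obtain ⟨D, E, hDE, hdiff⟩ :=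
      Finset.card_eq_two.mp (show (he'.faces \ he.faces).card = 2 by omega)
    have hk : k ∈ he'.faces ∧ k ∈ he.faces := by
      rw [← Finset.mem_inter, hk]
      exact Finset.mem_singleton_self k
    have hD : D ∈ he'.faces ∧ D ∉ he.faces := by rw [← Finset.mem_sdiff, hdiff]; simp
    have hE : E ∈ he'.faces ∧ E ∉ he.faces := by rw [← Finset.mem_sdiff, hdiff]; simp
    obtain ⟨i, rfl⟩ := he.mem_faces.mp hk.2
    have hadj : ∀ f ∈ he'.faces, f ∉ he.faces → lor f (e i) = -1 / 2 := fun f hf hfe => by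
      obtain ⟨j, rfl⟩ := he'.mem_faces.mp hf
      obtain ⟨l, hl⟩ := he'.mem_faces.mp hk.1
      rw [← hl]
      exact he'.pair j l fun hjl => hfe (by rw [hjl, hl]; exact hk.2)
    rw [hdiff, Finset.sum_pair hDE]
    exact h.lor_apex_add_lor_apex_le hno he heN (hmemN D hD.1) hD.2 (hmemN E hE.1) hE.2 hDE
      (hadj D hD.1 hD.2) (hadj E hE.1 hE.2)

lemma mem_cell (h : NormalSystem N) (hno : NoTetrahedron N) (he : Frame e) (heN : ∀ i, e i ∈ N)
    {x : H3} (hxe : ∀ i, lor x.1 (e i) ≤ 0) (hx3 : lor x.1 (apex e) ^ 2 < 3)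
    (hcorner : ∀ i, ∀ a ∈ N, a ∉ he.faces → (∀ j ≠ i, lor a (e j) = -1 / 2) →
      lor x.1 (apex e) ^ 2 *
        (2 / -lor a (apex e) - (1 - lor x.1 (e i) / lor x.1 (apex e)) ^ 2) < 1) :
    x ∈ cell N he.faces := by
  classical
  refine ⟨fun f hf => ?_, fun T' hT' hne => ?_⟩
  · by_cases hfe : f ∈ he.faces
    · obtain ⟨i, rfl⟩ := he.mem_faces.mp hfe
      exact hxe i
    · exact he.lor_nonpos_of_apex_le (h.unit f hf) (h.lor_apex_le hno he heN hf hfe) hx3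
  obtain ⟨e', he', heN', rfl⟩ := mem_vertices.mp hT'
  rw [he.sum_faces, he'.sum_faces]
  rcases Nat.lt_or_ge 1 (he'.faces ∩ he.faces).card with hcard | hcard
  · obtain ⟨b, i, hb, hi⟩ := he.exists_sdiff_eq_singleton he' hne hcard
    obtain ⟨hbe', hbe⟩ := Finset.mem_sdiff.mp (hb ▸ Finset.mem_singleton_self b)
    obtain ⟨l, rfl⟩ := he'.mem_faces.mp hbe'
    have hapex : lor (apex e') (apex e) = lor (e' l) (apex e) := by
      rw [he.lor_apex_apex he', hb, Finset.sum_singleton]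
    have hle := h.lor_apex_le hno he heN (heN' l) hbe
    refine he.lor_lt_apex_of_corner he'.lor_apex_self (by linarith) (i := i)
      (fun j hj => by rw [lor_comm]; exact he'.lor_apex_of_mem_faces (hi j hj)) ?_
    rw [hapex]
    refine hcorner i _ (heN' l) hbe fun j hj => ?_
    obtain ⟨m, hm⟩ := he'.mem_faces.mp (hi j hj)
    rw [← hm]
    exact he'.pair l m fun hlm => hbe (by rw [hlm, hm]; exact he.apply_mem_faces j)
  · exact he.lor_lt_apex_of_far he'.lor_apex_self
      (h.lor_apex_apex_le hno he heN he' heN' hcard) hx3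

lemma exists_cell_bound (h : NormalSystem N) (hno : NoTetrahedron N) (he : Frame e)
    (heN : ∀ i, e i ∈ N) :
    ∃ m : Fin 3 → ℝ, (∀ i, 2 ≤ m i) ∧ (∀ i j, i ≠ j → 1 / m i + 1 / m j ≤ 2 / 3) ∧
      ∀ x : H3, (∀ i, lor x.1 (e i) ≤ 0) → lor x.1 (apex e) ^ 2 < 3 →
        (∀ i, lor x.1 (apex e) ^ 2 *
          (2 / m i - (1 - lor x.1 (e i) / lor x.1 (apex e)) ^ 2) < 1) →
        x ∈ cell N he.faces := by
  choose a haN hopp hadj huniq using h.exists_opposite hno he heN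
  have hae : ∀ i, a i ∉ he.faces := fun i hmem => by
    obtain ⟨j, hj⟩ := he.mem_faces.mp hmem
    have hle := hopp i
    rw [← hj, he.lor_eq_ite] at hle
    split_ifs at hle <;> norm_num at hle
  have hne : ∀ i j, i ≠ j → a i ≠ a j := fun i j hij heq => by
    have hle := hopp i
    rw [heq, hadj j i hij] at hle
    norm_num at hle
  refine ⟨fun i => -lor (a i) (apex e), fun i => ?_, fun i j hij => ?_, fun x hxe hx3 hx => ?_⟩
  · linarith [h.lor_apex_le hno he heN (haN i) (hae i)]
  · obtain ⟨k, hki, hkj⟩ : ∃ k : Fin 3, k ≠ i ∧ k ≠ j := by decide +revert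
    exact he.inv_add_inv_le (h.unit _ (haN i)) (h.unit _ (haN j))
      (h.le_neg_half (haN i) (haN j) (hne i j hij)) (hadj i k hki) (hadj j k hkj)
      (h.lor_frame_le he heN (haN i) (hae i)) (h.lor_frame_le he heN (haN j) (hae j))
  · refine h.mem_cell hno he heN hxe hx3 fun i b hbN hbe hbadj => ?_
    rw [huniq i b hbN hbe hbadj]
    exact hx i

end NormalSystem

/-! ### Volume of the cell of a vertex -/

/-- The coordinates of `E3`, with the `i`-th one moved to the front. -/
def coords (i : Fin 3) (q : E3) : ℝ × ℝ × ℝ := (q i, q (i.succAbove 0), q (i.succAbove 1))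

lemma measurePreserving_coords (i : Fin 3) : MeasurePreserving (coords i) volume volume :=
  ((MeasurePreserving.id (volume : Measure ℝ)).prod (volume_preserving_finTwoArrow ℝ)).comp
    ((volume_preserving_piFinSuccAbove (fun _ : Fin 3 => ℝ) i).comp
      (EuclideanSpace.volume_preserving_symm_measurableEquiv_toLp (Fin 3)))

lemma lintegral_Icc_ofReal {α β : ℝ} (hαβ : α ≤ β) {g : ℝ → ℝ}
    (hg : ContinuousOn g (Set.Icc α β)) (hg0 : ∀ a ∈ Set.Icc α β, 0 ≤ g a) :
    ∫⁻ a in Set.Icc α β, ENNReal.ofReal (g a) = ENNReal.ofReal (∫ a in α..β, g a) := by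
  rw [intervalIntegral.integral_of_le hαβ, ← integral_Icc_eq_integral_Ioc,
    ofReal_integral_eq_lintegral_ofReal hg.integrableOn_Icc
      ((ae_restrict_mem measurableSet_Icc).mono hg0)]

lemma volume_eq_setLIntegral_slices {Y : Type*} [MeasureSpace Y] [SFinite (volume : Measure Y)]
    {S : Set (ℝ × Y)} (hS : MeasurableSet S) {I : Set ℝ} (hI : MeasurableSet I)
    (hSI : ∀ p ∈ S, p.1 ∈ I) :
    volume S = ∫⁻ a in I, volume (Prod.mk a ⁻¹' S) := by
  rw [Measure.volume_eq_prod, Measure.prod_apply hS, ← lintegral_indicator hI]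
  congr 1
  ext a
  by_cases ha : a ∈ I
  · rw [Set.indicator_of_mem ha]
  · have hempty : Prod.mk a ⁻¹' S = ∅ :=
      Set.eq_empty_of_forall_notMem fun b hb => ha (hSI _ hb)
    rw [Set.indicator_of_notMem ha, hempty, measure_empty]

lemma volume_le_of_slices {Y : Type*} [MeasureSpace Y] [SFinite (volume : Measure Y)]
    {S : Set (ℝ × Y)} (hS : MeasurableSet S) {α β : ℝ} (hαβ : α ≤ β) {g : ℝ → ℝ}
    (hg : ContinuousOn g (Set.Icc α β)) (hg0 : ∀ a ∈ Set.Icc α β, 0 ≤ g a)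
    (hslice : ∀ a ∈ Set.Icc α β, volume (Prod.mk a ⁻¹' S) ≤ ENNReal.ofReal (g a))
    (hSI : ∀ p ∈ S, p.1 ∈ Set.Icc α β) :
    volume S ≤ ENNReal.ofReal (∫ a in α..β, g a) := by
  rw [volume_eq_setLIntegral_slices hS measurableSet_Icc hSI, ← lintegral_Icc_ofReal hαβ hg hg0]
  exact setLIntegral_mono' measurableSet_Icc hslice

/-- The standard triangle, the base of the prism in the chart of an ideal vertex. -/
def triangle : Set (ℝ × ℝ) := {p | 0 ≤ p.1 ∧ 0 ≤ p.2 ∧ p.1 + p.2 ≤ 1}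

/-- Barycentric coordinates on the standard triangle. -/
def bary (p : ℝ × ℝ) : Fin 3 → ℝ := ![p.1, p.2, 1 - p.1 - p.2]

lemma bary_nonneg {p : ℝ × ℝ} (hp : p ∈ triangle) (i : Fin 3) : 0 ≤ bary p i := by
  match i with
  | 0 => exact hp.1
  | 1 => exact hp.2.1
  | 2 =>
    change 0 ≤ 1 - p.1 - p.2
    linarith [hp.2.2]

lemma sum_bary (p : ℝ × ℝ) : ∑ i, bary p i = 1 := by
  simp [bary, Fin.sum_univ_three]

lemma continuous_bary (i : Fin 3) : Continuous fun p => bary p i := by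
  match i with
  | 0 => exact continuous_fst
  | 1 => exact continuous_snd
  | 2 => exact (continuous_const.sub continuous_fst).sub continuous_snd

lemma measurableSet_triangle : MeasurableSet triangle :=
  (measurableSet_le measurable_const measurable_fst).inter
    ((measurableSet_le measurable_const measurable_snd).inter
      (measurableSet_le (measurable_fst.add measurable_snd) measurable_const))

lemma volume_triangle : volume triangle = ENNReal.ofReal (1 / 2) := by
  have hslice : ∀ a ∈ Set.Icc (0 : ℝ) 1, volume (Prod.mk a ⁻¹' triangle) =
      ENNReal.ofReal (1 - a) := fun a ha => by
    have hIcc : Prod.mk a ⁻¹' triangle = Set.Icc 0 (1 - a) := by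
      ext b
      exact ⟨fun hb => ⟨hb.2.1, le_sub_iff_add_le'.mpr hb.2.2⟩,
        fun hb => ⟨ha.1, hb.1, le_sub_iff_add_le'.mp hb.2⟩⟩
    rw [hIcc, Real.volume_Icc, sub_zero]
  have hintegral : ∫ a in (0 : ℝ)..1, (1 - a) = 1 / 2 := by
    rw [intervalIntegral.integral_sub (by simp) (by simp), integral_id,
      intervalIntegral.integral_const, smul_eq_mul]
    norm_num
  rw [volume_eq_setLIntegral_slices measurableSet_triangle measurableSet_Icc
      fun p hp => ⟨hp.1, (le_add_of_nonneg_right hp.2.1).trans hp.2.2⟩,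
    setLIntegral_congr_fun measurableSet_Icc hslice, lintegral_Icc_ofReal zero_le_one (by fun_prop)
      fun a ha => sub_nonneg.mpr ha.2, hintegral]

/-- The vertices of the standard triangle, in the order of its barycentric coordinates. -/
def triangleVertex : Fin 3 → ℝ × ℝ := ![(1, 0), (0, 1), (0, 0)]

lemma eq_triangleVertex {p : ℝ × ℝ} (hp : p ∈ triangle) {i : Fin 3} (hi : 1 ≤ bary p i) :
    p = triangleVertex i := by
  obtain ⟨h0, h1, h2⟩ := hp
  match i with
  | 0 | 1 | 2 =>
    simp only [bary, Matrix.cons_val] at hi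
    refine Prod.ext ?_ ?_ <;> simp only [triangleVertex, Matrix.cons_val] <;> linarith

lemma homothety_inv_mem_triangle {p : ℝ × ℝ} (hp : p ∈ triangle) {c : ℝ} (hc : 0 < c) {i : Fin 3}
    (hi : 1 - bary p i ≤ c) : AffineMap.homothety (triangleVertex i) c⁻¹ p ∈ triangle := by
  obtain ⟨h0, h1, h2⟩ := hp
  match i with
  | 0 | 1 | 2 =>
    simp only [bary, Matrix.cons_val] at hi
    simp only [triangle, triangleVertex, Matrix.cons_val, AffineMap.homothety_apply, vsub_eq_sub,
      vadd_eq_add, Set.mem_ofPred_eq, Prod.fst_add, Prod.snd_add, Prod.smul_fst, Prod.smul_snd,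
      Prod.fst_sub, Prod.snd_sub, smul_eq_mul]
    field_simp
    refine ⟨?_, ?_, ?_⟩ <;> linarith

lemma volume_corner_le {c : ℝ} (hc : 0 ≤ c) (i : Fin 3) :
    volume {p | p ∈ triangle ∧ 1 - bary p i ≤ c} ≤ ENNReal.ofReal (c ^ 2 / 2) := by
  have hsub : {p | p ∈ triangle ∧ 1 - bary p i ≤ c} ⊆
      AffineMap.homothety (triangleVertex i) c '' triangle := fun p ⟨hp, hi⟩ => by
    rcases hc.eq_or_lt with rfl | hc
    · exact ⟨p, hp, by rw [← eq_triangleVertex hp (by linarith)]; simp⟩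
    · refine ⟨_, homothety_inv_mem_triangle hp hc hi, ?_⟩
      rw [← AffineMap.comp_apply, ← AffineMap.homothety_mul, mul_inv_cancel₀ hc.ne']
      simp
  refine (measure_mono hsub).trans_eq ?_
  rw [Measure.addHaar_image_homothety, volume_triangle, Module.finrank_prod, Module.finrank_self,
    one_add_one_eq_two, abs_of_nonneg (sq_nonneg c), ← ENNReal.ofReal_mul (sq_nonneg c)]
  congr 1
  ring

/-- The part of the prism of height `3` over the triangle which the face opposite to the `i`-th
corner may cut off, where `-m` is the product of that face with the ideal vertex. -/
def cornerRegion (m : ℝ) (i : Fin 3) : Set (ℝ × ℝ × ℝ) :=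
  {p | p ∈ Set.Ioo (0 : ℝ) 3 ×ˢ triangle ∧ 1 ≤ p.1 * (2 / m - (1 - bary p.2 i) ^ 2)}

lemma measurableSet_cornerRegion (m : ℝ) (i : Fin 3) : MeasurableSet (cornerRegion m i) :=
  (measurableSet_Ioo.prod measurableSet_triangle).inter
    (measurableSet_le measurable_const (measurable_fst.mul (measurable_const.sub
      ((measurable_const.sub ((continuous_bary i).measurable.comp measurable_snd)).pow_const 2))))

lemma half_le_of_mem_cornerRegion {m : ℝ} (hm : 0 < m) {i : Fin 3} {p : ℝ × ℝ × ℝ}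
    (hp : p ∈ cornerRegion m i) : m / 2 ≤ p.1 := by
  obtain ⟨⟨hp0, -⟩, hp1⟩ := hp
  have hle : p.1 * (2 / m - (1 - bary p.2 i) ^ 2) ≤ p.1 * (2 / m) :=
    mul_le_mul_of_nonneg_left (sub_le_self _ (sq_nonneg _)) hp0.1.le
  have hone : 1 ≤ p.1 * 2 / m := by rw [mul_div_assoc]; exact hp1.trans hle
  rw [le_div_iff₀ hm] at hone
  linarith

lemma volume_slice_cornerRegion_le {m w : ℝ} (hm : 0 < m) (hw : m / 2 ≤ w) (i : Fin 3) :
    volume (Prod.mk w ⁻¹' cornerRegion m i) ≤ ENNReal.ofReal (1 / m - 1 / 2 * w⁻¹) := by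
  have hw0 : 0 < w := by linarith
  have hnonneg : 0 ≤ 2 / m - 1 / w := by
    rw [sub_nonneg, div_le_div_iff₀ hw0 hm]
    linarith
  have hsub : Prod.mk w ⁻¹' cornerRegion m i ⊆
      {p | p ∈ triangle ∧ 1 - bary p i ≤ √(2 / m - 1 / w)} := fun p ⟨hp, hp1⟩ => by
    refine ⟨hp.2, Real.le_sqrt_of_sq_le ?_⟩
    have hle : 1 / w ≤ 2 / m - (1 - bary p i) ^ 2 := by
      rw [div_le_iff₀' hw0]
      exact hp1
    linarith
  refine (measure_mono hsub).trans ((volume_corner_le (Real.sqrt_nonneg _) i).trans_eq ?_)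
  rw [Real.sq_sqrt hnonneg]
  congr 1
  field_simp

lemma integral_inv_sub_le {m : ℝ} (hm : 0 < m) (hm6 : m ≤ 6) :
    ∫ w in m / 2..3, (1 / m - 1 / 2 * w⁻¹) ≤ (6 / m - 1) ^ 2 / (2 * (2 + (6 / m - 1))) := by
  have hg : 0 ≤ 6 / m - 1 := by
    rw [sub_nonneg, le_div_iff₀ hm]
    linarith
  have hzero : (0 : ℝ) ∉ Set.uIcc (m / 2) 3 := by
    rw [Set.uIcc_of_le (by linarith)]
    exact fun h => absurd h.1 (by linarith)
  have hinv : IntervalIntegrable (fun w : ℝ => w⁻¹) volume (m / 2) 3 :=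
    intervalIntegral.intervalIntegrable_inv (fun w hw hw0 => hzero (hw0 ▸ hw)) continuousOn_id
  rw [intervalIntegral.integral_sub (by simp) (hinv.const_mul _),
    intervalIntegral.integral_const_mul, integral_inv hzero, intervalIntegral.integral_const,
    smul_eq_mul, show 3 / (m / 2) = 1 + (6 / m - 1) by field_simp; ring,
    show (3 - m / 2) * (1 / m) = 1 / 2 * (6 / m - 1) by field_simp; ring]
  generalize 6 / m - 1 = g at hg ⊢
  have hlog : 2 * g / (g + 2) ≤ Real.log (1 + g) := Real.le_log_one_add_of_nonneg hg
  have hsplit : g ^ 2 / (2 * (2 + g)) = 1 / 2 * g - 1 / 2 * (2 * g / (g + 2)) := by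
    field_simp
    ring
  linarith

lemma sq_div_le_sq_div {x y : ℝ} (hx : 0 ≤ x) (hxy : x ≤ y) :
    x ^ 2 / (2 * (2 + x)) ≤ y ^ 2 / (2 * (2 + y)) := by
  rw [div_le_div_iff₀ (by positivity) (by linarith)]
  nlinarith [mul_nonneg hx (sub_nonneg.mpr hxy), mul_nonneg (mul_nonneg hx (sub_nonneg.mpr hxy))
    (hx.trans hxy)]

lemma volume_cornerRegion_le {m g : ℝ} (hm : 0 < m) (hmg : 6 / m - 1 ≤ g) (i : Fin 3) :
    volume (cornerRegion m i) ≤ ENNReal.ofReal (g ^ 2 / (2 * (2 + g))) := by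
  rcases le_or_gt m 6 with hm6 | hm6
  · have hnonneg : 0 ≤ 6 / m - 1 := by
      rw [sub_nonneg, le_div_iff₀ hm]
      linarith
    have hcont : ContinuousOn (fun w : ℝ => 1 / m - 1 / 2 * w⁻¹) (Set.Icc (m / 2) 3) :=
      continuousOn_const.sub (continuousOn_const.mul (continuousOn_id.inv₀ fun w hw => by
        have hw0 : 0 < w := by linarith [hw.1]
        exact hw0.ne'))
    have hpos : ∀ w ∈ Set.Icc (m / 2) 3, 0 ≤ 1 / m - 1 / 2 * w⁻¹ := fun w hw => by
      have hanti : w⁻¹ ≤ (m / 2)⁻¹ := inv_anti₀ (by positivity) hw.1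
      have hinv : (m / 2)⁻¹ = 2 * (1 / m) := by field_simp
      linarith
    refine (volume_le_of_slices (measurableSet_cornerRegion m i) (by linarith) hcont hpos
      (fun w hw => volume_slice_cornerRegion_le hm hw.1 i)
      fun p hp => ⟨half_le_of_mem_cornerRegion hm hp, hp.1.1.2.le⟩).trans ?_
    exact ENNReal.ofReal_le_ofReal
      ((integral_inv_sub_le hm hm6).trans (sq_div_le_sq_div hnonneg hmg))
  · have hempty : cornerRegion m i = ∅ := Set.eq_empty_of_forall_notMem fun p hp => by
      linarith [half_le_of_mem_cornerRegion hm hp, hp.1.1.2]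
    rw [hempty, measure_empty]
    exact zero_le

lemma sq_div_add_two_mul_le {a : ℝ} (ha1 : 1 ≤ a) (ha2 : a ≤ 2) :
    a ^ 2 / (2 * (2 + a)) + 2 * ((2 - a) ^ 2 / (2 * (2 + (2 - a)))) ≤ 1 / 2 := by
  have ha4 : 0 < 4 - a := by linarith
  have hdiff : 1 / 2 - (a ^ 2 / (2 * (2 + a)) + 2 * ((2 - a) ^ 2 / (2 * (2 + (2 - a))))) =
      (2 - a) * (a - 1) * (4 + a) / (2 * (2 + a) * (4 - a)) := by
    rw [show 2 + (2 - a) = 4 - a by ring]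
    field_simp
    ring
  rw [← sub_nonneg, hdiff]
  exact div_nonneg (mul_nonneg (mul_nonneg (by linarith) (by linarith)) (by linarith))
    (by positivity)

lemma sum_sq_div_le {g : Fin 3 → ℝ} (h0 : ∀ i, 0 ≤ g i) (h : ∀ i j, i ≠ j → g i + g j ≤ 2) :
    ∑ i, g i ^ 2 / (2 * (2 + g i)) ≤ 1 / 2 := by
  by_cases hbig : ∃ i, 1 ≤ g i
  · obtain ⟨i, hi⟩ := hbig
    obtain ⟨j, k, hij, hik, hjk, huniv⟩ := exists_univ_eq_triple i
    rw [huniv, Finset.sum_insert (by simp [hij, hik]), Finset.sum_pair hjk]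
    have hj := sq_div_le_sq_div (h0 j) (le_sub_iff_add_le'.mpr (h i j hij))
    have hk := sq_div_le_sq_div (h0 k) (le_sub_iff_add_le'.mpr (h i k hik))
    have hi2 := sq_div_add_two_mul_le hi (by linarith [h i j hij, h0 j])
    linarith
  · have hsmall : ∀ i, g i ^ 2 / (2 * (2 + g i)) ≤ 1 / 6 := fun i => by
      have hi : g i ≤ 1 := not_lt.mp fun hi => hbig ⟨i, hi.le⟩
      have hle := sq_div_le_sq_div (h0 i) hi
      norm_num at hle ⊢
      exact hle
    calc ∑ i, g i ^ 2 / (2 * (2 + g i)) ≤ ∑ _i : Fin 3, (1 / 6 : ℝ) :=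
          Finset.sum_le_sum fun i _ => hsmall i
      _ = 1 / 2 := by norm_num

lemma sum_volume_cornerRegion_le {m : Fin 3 → ℝ} (hm : ∀ i, 2 ≤ m i)
    (hmm : ∀ i j, i ≠ j → 1 / m i + 1 / m j ≤ 2 / 3) :
    ∑ i, volume (cornerRegion (m i) i) ≤ ENNReal.ofReal (1 / 2) := by
  set g : Fin 3 → ℝ := fun i => max (6 / m i - 1) 0 with hg
  have hg0 : ∀ i, 0 ≤ g i := fun i => le_max_right _ _
  have hg2 : ∀ i, 6 / m i - 1 ≤ 2 := fun i => by
    have h3 : 6 / m i ≤ 3 := by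
      rw [div_le_iff₀ (by linarith [hm i])]
      linarith [hm i]
    linarith
  have hgg : ∀ i j, i ≠ j → g i + g j ≤ 2 := fun i j hij => by
    have hsix : ∀ k, 6 / m k = 6 * (1 / m k) := fun k => by ring
    rcases max_cases (6 / m i - 1) 0 with ⟨hi, -⟩ | ⟨hi, -⟩ <;>
      rcases max_cases (6 / m j - 1) 0 with ⟨hj, -⟩ | ⟨hj, -⟩ <;>
      simp only [hg, hi, hj] <;> linarith [hmm i j hij, hg2 i, hg2 j, hsix i, hsix j]
  calc ∑ i, volume (cornerRegion (m i) i)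
      ≤ ∑ i, ENNReal.ofReal (g i ^ 2 / (2 * (2 + g i))) := Finset.sum_le_sum fun i _ =>
        volume_cornerRegion_le (by linarith [hm i]) (le_max_left _ _) i
    _ = ENNReal.ofReal (∑ i, g i ^ 2 / (2 * (2 + g i))) :=
        (ENNReal.ofReal_sum_of_nonneg fun i _ => by have := hg0 i; positivity).symm
    _ ≤ ENNReal.ofReal (1 / 2) := ENNReal.ofReal_le_ofReal (sum_sq_div_le hg0 hgg)

lemma one_le_volume_prism_diff {m : Fin 3 → ℝ} (hm : ∀ i, 2 ≤ m i)
    (hmm : ∀ i j, i ≠ j → 1 / m i + 1 / m j ≤ 2 / 3) :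
    1 ≤ volume (Set.Ioo (0 : ℝ) 3 ×ˢ triangle \ ⋃ i, cornerRegion (m i) i) := by
  have hprism : volume (Set.Ioo (0 : ℝ) 3 ×ˢ triangle) = ENNReal.ofReal (3 / 2) := by
    rw [Measure.volume_eq_prod, Measure.prod_prod, Real.volume_Ioo, volume_triangle,
      ← ENNReal.ofReal_mul (by norm_num)]
    norm_num
  have hcorner : volume (⋃ i, cornerRegion (m i) i) ≤ ENNReal.ofReal (1 / 2) :=
    (measure_iUnion_fintype_le _ _).trans (sum_volume_cornerRegion_le hm hmm)
  calc (1 : ENNReal) = ENNReal.ofReal (3 / 2) - ENNReal.ofReal (1 / 2) := by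
        rw [← ENNReal.ofReal_sub _ (by norm_num)]
        norm_num
    _ ≤ volume (Set.Ioo (0 : ℝ) 3 ×ˢ triangle) - volume (⋃ i, cornerRegion (m i) i) := by
        rw [hprism]
        exact tsub_le_tsub_left hcorner _
    _ ≤ _ := le_measure_sdiff

lemma measurableSet_cell (N T : Finset Mink) : MeasurableSet (cell N T) := by
  have hlor : ∀ f : Mink, Measurable fun x : H3 => lor x.1 f := fun f =>
    (continuous_lor_comp continuous_subtype_val continuous_const).measurable
  have hcell : cell N T = (⋂ e ∈ N, halfSpace e) ∩ ⋂ T' ∈ vertices N, ⋂ _ : T' ≠ T,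
      {x : H3 | lor x.1 (∑ f ∈ T', f) < lor x.1 (∑ f ∈ T, f)} := by
    ext x
    simp [cell, halfSpace]
  rw [hcell]
  exact (measurableSet_polyhedron N).inter (Finset.measurableSet_biInter _ fun T' _ =>
    MeasurableSet.iInter fun _ => measurableSet_lt (hlor _) (hlor _))

lemma Frame.exists_chart_eq {e : Fin 3 → Mink} (h : Frame e) {q : E3} (hq : 0 < q 2) :
    ∃ x, chart e x = q ∧ lor x.1 (apex e) = -√(q 2) ∧
      ∀ i, lor x.1 (e i) = -(√(q 2) * bary (q 0, q 1) i) := by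
  have hsqrt : 0 < √(q 2) := Real.sqrt_pos.mpr hq
  have hsum : √(q 2) * bary (q 0, q 1) 0 + √(q 2) * bary (q 0, q 1) 1 +
      √(q 2) * bary (q 0, q 1) 2 = √(q 2) := by
    rw [← mul_add, ← mul_add, ← Fin.sum_univ_three, sum_bary, mul_one]
  obtain ⟨x, hx⟩ := h.exists_H3 (fun i => √(q 2) * bary (q 0, q 1) i) (hsqrt.trans_eq hsum.symm)
  have hapex : lor x.1 (apex e) = -√(q 2) := by
    rw [lor_apex_right, hx, hx, hx, ← neg_add, ← neg_add, hsum]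
  refine ⟨x, ?_, hapex, hx⟩
  ext i
  match i with
  | 0 | 1 => simp [chart, hx, hapex, bary, hsqrt.ne']
  | 2 => simp [chart, hapex, Real.sq_sqrt hq.le]

lemma NormalSystem.one_le_vol_cell {N : Finset Mink} (h : NormalSystem N) (hno : NoTetrahedron N)
    {e : Fin 3 → Mink} (he : Frame e) (heN : ∀ i, e i ∈ N) :
    1 ≤ ENNReal.ofReal (√3) * vol (cell N he.faces) := by
  obtain ⟨m, hm, hmm, hcell⟩ := h.exists_cell_bound hno he heN
  have hmeas : MeasurableSet (Set.Ioo (0 : ℝ) 3 ×ˢ triangle \ ⋃ i, cornerRegion (m i) i) :=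
    (measurableSet_Ioo.prod measurableSet_triangle).diff
      (MeasurableSet.iUnion fun i => measurableSet_cornerRegion (m i) i)
  rw [← he.volume_chart_image (measurableSet_cell N he.faces)]
  refine (one_le_volume_prism_diff hm hmm).trans ?_
  rw [← (measurePreserving_coords 2).measure_preimage hmeas.nullMeasurableSet]
  refine measure_mono fun q ⟨hprism, hcorner⟩ => ?_
  obtain ⟨⟨hq0 : 0 < q 2, hq3 : q 2 < 3⟩, hq : (q 0, q 1) ∈ triangle⟩ := hprism
  obtain ⟨x, hchart, hapex, hx⟩ := he.exists_chart_eq hq0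
  have hsqrt : 0 < √(q 2) := Real.sqrt_pos.mpr hq0
  have hsq : lor x.1 (apex e) ^ 2 = q 2 := by rw [hapex, neg_sq, Real.sq_sqrt hq0.le]
  refine ⟨x, hcell x (fun i => ?_) (hsq.trans_lt hq3) (fun i => ?_), hchart⟩
  · rw [hx, neg_nonpos]
    exact mul_nonneg hsqrt.le (bary_nonneg hq i)
  · rw [hsq, hx, hapex, neg_div_neg_eq, mul_div_cancel_left₀ _ hsqrt.ne']
    exact not_le.mp fun hle => hcorner (Set.mem_iUnion.mpr ⟨i, ⟨⟨hq0, hq3⟩, hq⟩, hle⟩)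

/-! ### Counting ideal vertices -/

/-- The outward normals of an ideal cube: the faces `e i` share an ideal vertex and `a i` is the
face opposite to `e i`. -/
structure IsCube (e a : Fin 3 → Mink) : Prop where
  frame : Frame e
  unit : ∀ i, lor (a i) (a i) = 1
  opposite : ∀ i, lor (a i) (e i) = -2
  adjacent : ∀ i, ∀ j ≠ i, lor (a i) (e j) = -1 / 2

lemma exists_univ_eq_triple_of_ne {i j : Fin 3} (hij : i ≠ j) :
    ∃ k, i ≠ k ∧ j ≠ k ∧ (Finset.univ : Finset (Fin 3)) = {i, j, k} := by
  decide +revert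

lemma Frame.injective_sumElim {e a : Fin 3 → Mink} (he : Frame e)
    (hopp : ∀ i, lor (a i) (e i) ≤ -1) (hae : ∀ i, ∀ j ≠ i, lor (a i) (e j) = -1 / 2) :
    Function.Injective (Sum.elim e a) := by
  refine he.injective.sumElim (fun i j hij => ?_) fun i j hij => ?_
  · by_contra hne
    have hopp := hopp i
    rw [hij, hae j i hne] at hopp
    norm_num at hopp
  · have hneg : lor (a j) (e i) < 0 := by
      rcases eq_or_ne i j with rfl | hne
      · linarith [hopp i]
      · rw [hae j i hne]; norm_num
    rw [← hij, he.unit] at hneg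
    norm_num at hneg

/-- In the upper half-space model with the vertex at infinity, the left-hand side is the sum of the
radii of two hemispheres that meet at the angle `π / 3`. -/
lemma Frame.inv_add_inv_eq {e : Fin 3 → Mink} (he : Frame e) {a b : Mink} (ha : lor a a = 1)
    (hb : lor b b = 1) (hab : lor a b = -1 / 2) {i j : Fin 3} (hij : i ≠ j)
    (hai : lor a (e i) ≤ -1) (hbj : lor b (e j) ≤ -1) (hae : ∀ l ≠ i, lor a (e l) = -1 / 2)
    (hbe : ∀ l ≠ j, lor b (e l) = -1 / 2) :
    1 / (1 - lor a (e i)) + 1 / (1 - lor b (e j)) = 2 / 3 := by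
  obtain ⟨k, hik, hjk, huniv⟩ := exists_univ_eq_triple_of_ne hij
  have hsum : ∀ f : Fin 3 → ℝ, ∑ l, f l = f i + f j + f k := fun f => by
    simp [huniv, hij, hik, hjk, add_assoc]
  have happly : ∀ w, lor w (apex e) = lor w (e i) + lor w (e j) + lor w (e k) := fun w => by
    rw [lor_apex_right, ← hsum fun l => lor w (e l), Fin.sum_univ_three]
  have hsa : lor a (apex e) = -(1 - lor a (e i)) := by
    rw [happly, hae j hij.symm, hae k hik.symm]; ring
  have hsb : lor b (apex e) = -(1 - lor b (e j)) := by
    rw [happly, hbe i hij, hbe k hjk.symm]; ring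
  have hlor := he.lor_eq (x := a) (y := b) (by linarith) (by linarith)
  rw [hsum, hsa, hsb, ha, hb, hab, hae j hij.symm, hae k hik.symm, hbe i hij,
    hbe k hjk.symm] at hlor
  obtain ⟨m, hm⟩ : ∃ m, lor a (e i) = 1 - m := ⟨1 - lor a (e i), by ring⟩
  obtain ⟨m', hm'⟩ : ∃ m', lor b (e j) = 1 - m' := ⟨1 - lor b (e j), by ring⟩
  have hm0 : 0 < m := by linarith
  have hm0' : 0 < m' := by linarith
  rw [hm, hm', sub_sub_cancel, sub_sub_cancel] at hlor ⊢
  field_simp at hlor ⊢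
  refine mul_left_cancel₀ (mul_pos hm0 hm0').ne' ?_
  linarith

namespace NormalSystem

variable {N : Finset Mink} {e : Fin 3 → Mink}

lemma frame_triple (h : NormalSystem N) {e f g : Mink} (he : e ∈ N) (hf : f ∈ N) (hg : g ∈ N)
    (hef : lor e f = -1 / 2) (heg : lor e g = -1 / 2) (hfg : lor f g = -1 / 2) :
    Frame ![e, f, g] := by
  refine h.frame (fun i => ?_) fun i j hij => ?_
  · match i with | 0 => exact he | 1 => exact hf | 2 => exact hg
  · match i, j with
    | 0, 0 | 1, 1 | 2, 2 => exact absurd rfl hij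
    | 0, 1 => exact hef
    | 0, 2 => exact heg
    | 1, 2 => exact hfg
    | 1, 0 => rwa [lor_comm] at hef
    | 2, 0 => rwa [lor_comm] at heg
    | 2, 1 => rwa [lor_comm] at hfg

lemma triple_mem_vertices (h : NormalSystem N) [DecidableEq Mink] {e f g : Mink} (he : e ∈ N)
    (hf : f ∈ N) (hg : g ∈ N) (hef : lor e f = -1 / 2) (heg : lor e g = -1 / 2)
    (hfg : lor f g = -1 / 2) : {e, f, g} ∈ vertices N := by
  have hframe := h.frame_triple he hf hg hef heg hfg
  refine mem_vertices.mpr ⟨_, hframe, fun i => ?_, ?_⟩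
  · match i with | 0 => exact he | 1 => exact hf | 2 => exact hg
  · ext k
    simp [hframe.mem_faces, Fin.exists_fin_succ, eq_comm]

lemma exists_frame (h : NormalSystem N) : ∃ e : Fin 3 → Mink, Frame e ∧ ∀ i, e i ∈ N := by
  have hN : N.Nonempty := by
    by_contra hN
    rw [Finset.not_nonempty_iff_eq_empty] at hN
    have hspace := h.causal (0, EuclideanSpace.single 0 1) (by simp [hN])
    simp only [lor_self, PiLp.norm_single, norm_one] at hspace
    norm_num at hspace
  obtain ⟨e, he⟩ := hN
  obtain ⟨f, hf, hef⟩ := h.exists_adj he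
  obtain ⟨g, hg, -, -, -, ⟨heg, hfg⟩, -⟩ := h.exists_common_neighbors he hf hef
  refine ⟨_, h.frame_triple he hf hg hef heg hfg, fun i => ?_⟩
  match i with | 0 => exact he | 1 => exact hf | 2 => exact hg

lemma not_adj_of_noTetrahedron (h : NormalSystem N) (hno : NoTetrahedron N) {e f g k : Mink}
    (he : e ∈ N) (hf : f ∈ N) (hg : g ∈ N) (hk : k ∈ N) (hef : lor e f = -1 / 2)
    (heg : lor e g = -1 / 2) (hfg : lor f g = -1 / 2) (hek : lor e k = -1 / 2)
    (hfk : lor f k = -1 / 2) : lor g k ≠ -1 / 2 := by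
  intro hgk
  obtain ⟨i, hi⟩ := hno _ (h.frame_triple he hf hg hef heg hfg)
    (fun i => by match i with | 0 => exact he | 1 => exact hf | 2 => exact hg) k hk
  rw [lor_comm] at hi
  match i with | 0 => exact hi hek | 1 => exact hi hfk | 2 => exact hi hgk

open Classical in
lemma two_le_card_vertices_edge (h : NormalSystem N) {e f : Mink} (he : e ∈ N) (hf : f ∈ N)
    (hef : lor e f = -1 / 2) : 2 ≤ {T ∈ vertices N | e ∈ T ∧ f ∈ T}.card := by
  obtain ⟨g, hg, g', hg', hne, ⟨heg, hfg⟩, heg', hfg'⟩ := h.exists_common_neighbors he hf hef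
  refine Finset.one_lt_card.mpr ⟨{e, f, g}, ?_, {e, f, g'}, ?_, fun heq => ?_⟩
  · simp [h.triple_mem_vertices he hf hg hef heg hfg]
  · simp [h.triple_mem_vertices he hf hg' hef heg' hfg']
  · have hmem : g ∈ ({e, f, g'} : Finset Mink) := by simp [← heq]
    simp only [Finset.mem_insert, Finset.mem_singleton] at hmem
    rcases hmem with rfl | rfl | rfl
    exacts [h.ne_of_adj he heg rfl, h.ne_of_adj hf hfg rfl, hne rfl]

open Classical in
/-- The face `e` has two edges next to its edge on `f`, and their other end points do not coincide,
because `e` is not a triangle. -/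
lemma two_le_card_vertices_off_edge (h : NormalSystem N) (hno : NoTetrahedron N) {e f : Mink}
    (he : e ∈ N) (hf : f ∈ N) (hef : lor e f = -1 / 2) :
    2 ≤ {T ∈ vertices N | e ∈ T ∧ f ∉ T}.card := by
  obtain ⟨g, hg, g', hg', hne, ⟨heg, hfg⟩, heg', hfg'⟩ := h.exists_common_neighbors he hf hef
  have hadj := h.not_adj_of_noTetrahedron hno he hf hg hg' hef heg hfg heg' hfg'
  have hef0 := h.ne_of_adj he hef
  have hfg0 := h.ne_of_adj hf hfg
  have hfg0' := h.ne_of_adj hf hfg'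
  rw [lor_comm] at hfg hfg'
  obtain ⟨k, hk, hkf, hek, hgk, -⟩ := h.exists_other_neighbor he hg hf heg hef hfg
  obtain ⟨k', hk', hkf', hek', hgk', -⟩ := h.exists_other_neighbor he hg' hf heg' hef hfg'
  refine Finset.one_lt_card.mpr ⟨{e, g, k}, ?_, {e, g', k'}, ?_, fun heq => ?_⟩
  · simp [h.triple_mem_vertices he hg hk heg hek hgk, hef0.symm, hfg0, hkf.symm]
  · simp [h.triple_mem_vertices he hg' hk' heg' hek' hgk', hef0.symm, hfg0', hkf'.symm]
  · have hmem : g ∈ ({e, g', k'} : Finset Mink) := by simp [← heq]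
    simp only [Finset.mem_insert, Finset.mem_singleton] at hmem
    rcases hmem with rfl | rfl | rfl
    exacts [h.ne_of_adj he heg rfl, hne rfl, hadj (by rwa [lor_comm])]

open Classical in
lemma four_le_card_vertices_face (h : NormalSystem N) (hno : NoTetrahedron N) {e : Mink}
    (he : e ∈ N) : 4 ≤ {T ∈ vertices N | e ∈ T}.card := by
  obtain ⟨f, hf, hef⟩ := h.exists_adj he
  rw [← Finset.card_filter_add_card_filter_not (f ∈ ·), Finset.filter_filter, Finset.filter_filter]
  exact Nat.add_le_add (h.two_le_card_vertices_edge he hf hef)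
    (h.two_le_card_vertices_off_edge hno he hf hef)

lemma four_mul_card_le (h : NormalSystem N) (hno : NoTetrahedron N) :
    4 * N.card ≤ 3 * (vertices N).card := by
  classical
  have hcount := Finset.sum_card_bipartiteAbove_eq_sum_card_bipartiteBelow
    (s := N) (t := vertices N) (fun e T => e ∈ T)
  have hthree : ∀ T ∈ vertices N, (N.bipartiteBelow (fun e T => e ∈ T) T).card = 3 := by
    intro T hT
    obtain ⟨e, he, heN, rfl⟩ := mem_vertices.mp hT
    refine Eq.trans ?_ he.card_faces
    rw [Finset.bipartiteBelow, Finset.filter_mem_eq_inter, Finset.inter_eq_right.mpr]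
    intro f hf
    obtain ⟨i, rfl⟩ := he.mem_faces.mp hf
    exact heN i
  calc 4 * N.card = ∑ e ∈ N, 4 := by rw [Finset.sum_const, smul_eq_mul, mul_comm]
    _ ≤ ∑ e ∈ N, ((vertices N).bipartiteAbove (fun e T => e ∈ T) e).card :=
        Finset.sum_le_sum fun e he => h.four_le_card_vertices_face hno he
    _ = 3 * (vertices N).card := by
        rw [hcount, Finset.sum_congr rfl hthree, Finset.sum_const, smul_eq_mul, mul_comm]

lemma card_vertices_le_vol (h : NormalSystem N) (hno : NoTetrahedron N) :
    ((vertices N).card : ENNReal) ≤ ENNReal.ofReal (√3) * vol (⋂ e ∈ N, halfSpace e) := by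
  have hdisj : Set.PairwiseDisjoint (vertices N : Set (Finset Mink)) (cell N) :=
    fun T hT T' hT' hne => Set.disjoint_left.mpr fun x hx hx' =>
      lt_asymm (hx.2 T' hT' hne.symm) (hx'.2 T hT hne)
  have hsub : (⋃ T ∈ vertices N, cell N T) ⊆ ⋂ e ∈ N, halfSpace e :=
    Set.iUnion₂_subset fun T _ x hx => mem_polyhedron.mpr hx.1
  calc ((vertices N).card : ENNReal) = ∑ T ∈ vertices N, 1 := by simp
    _ ≤ ∑ T ∈ vertices N, ENNReal.ofReal (√3) * vol (cell N T) := by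
        refine Finset.sum_le_sum fun T hT => ?_
        obtain ⟨e, he, heN, rfl⟩ := mem_vertices.mp hT
        exact h.one_le_vol_cell hno he heN
    _ = ENNReal.ofReal (√3) * vol (⋃ T ∈ vertices N, cell N T) := by
        rw [← Finset.mul_sum, measure_biUnion_finset hdisj fun T _ => measurableSet_cell N T]
    _ ≤ _ := by gcongr

lemma ten_le_vol (h : NormalSystem N) (hno : NoTetrahedron N) (hcard : 7 ≤ N.card) :
    10 ≤ ENNReal.ofReal (√3) * vol (⋂ e ∈ N, halfSpace e) := by
  have hcount := h.four_mul_card_le hno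
  have hten : 10 ≤ (vertices N).card := by omega
  exact le_trans (by exact_mod_cast hten) (h.card_vertices_le_vol hno)

lemma isCube_of_adjacent (h : NormalSystem N) {a : Fin 3 → Mink} (he : Frame e)
    (haN : ∀ i, a i ∈ N) (hopp : ∀ i, lor (a i) (e i) ≤ -1)
    (hae : ∀ i, ∀ j ≠ i, lor (a i) (e j) = -1 / 2)
    (haa : ∀ i j, i ≠ j → lor (a i) (a j) = -1 / 2) : IsCube e a := by
  refine ⟨he, fun i => h.unit _ (haN i), fun i => ?_, hae⟩
  have hradii : ∀ i j, i ≠ j → 1 / (1 - lor (a i) (e i)) + 1 / (1 - lor (a j) (e j)) = 2 / 3 :=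
    fun i j hij => he.inv_add_inv_eq (h.unit _ (haN i)) (h.unit _ (haN j)) (haa i j hij) hij
      (hopp i) (hopp j) (hae i) (hae j)
  obtain ⟨j, k, hij, hik, hjk, -⟩ := exists_univ_eq_triple i
  have hradius : 1 / (1 - lor (a i) (e i)) = 1 / 3 := by
    linarith [hradii i j hij, hradii i k hik, hradii j k hjk]
  rw [div_eq_div_iff (by linarith [hopp i]) (by norm_num)] at hradius
  linarith

/-- If `a i` and `a j` are not adjacent, then the edge that `a i` shares with `e k` does not end on
`a j`, but on a seventh face. -/
lemma seven_le_card_of_not_adj (h : NormalSystem N) {a : Fin 3 → Mink} (he : Frame e)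
    (heN : ∀ i, e i ∈ N) (haN : ∀ i, a i ∈ N) (hopp : ∀ i, lor (a i) (e i) ≤ -1)
    (hae : ∀ i, ∀ j ≠ i, lor (a i) (e j) = -1 / 2) {i j : Fin 3} (hij : i ≠ j)
    (hnadj : lor (a i) (a j) ≠ -1 / 2) : 7 ≤ N.card := by
  obtain ⟨k, hik, hjk, huniv⟩ := exists_univ_eq_triple_of_ne hij
  have hall : ∀ l, l = i ∨ l = j ∨ l = k := fun l => by
    have hmem := Finset.mem_univ l
    simpa only [huniv, Finset.mem_insert, Finset.mem_singleton] using hmem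
  have hopp' : ∀ l, lor (a l) (e l) ≠ -1 / 2 := fun l hl => by linarith [hopp l]
  obtain ⟨x, hxN, hxj, hkx, hax, -⟩ := h.exists_other_neighbor (heN k) (haN i) (heN j)
    (by rw [lor_comm, hae i k hik.symm]) (he.pair _ _ hjk.symm) (hae i j hij.symm)
  have hx : x ∉ Set.range (Sum.elim e a) := by
    rintro ⟨l | l, rfl⟩ <;> rcases hall l with rfl | rfl | rfl
    · exact hopp' _ hax
    · exact hxj rfl
    · exact h.ne_of_adj (heN _) hkx rfl
    · exact h.ne_of_adj (haN _) hax rfl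
    · exact hnadj hax
    · exact hopp' _ (by rw [lor_comm]; exact hkx)
  classical
  have hsub : insert x (Finset.univ.map ⟨_, he.injective_sumElim hopp hae⟩) ⊆ N := by
    intro f hf
    simp only [Finset.mem_insert, Finset.mem_map, Finset.mem_univ, true_and,
      Function.Embedding.coeFn_mk] at hf
    rcases hf with rfl | ⟨l | l, rfl⟩
    exacts [hxN, heN l, haN l]
  have hcard := Finset.card_le_card hsub
  rw [Finset.card_insert_of_notMem (by simpa using hx), Finset.card_map, Finset.card_univ] at hcard
  simpa using hcard

lemma exists_isCube_or_seven_le_card (h : NormalSystem N) (hno : NoTetrahedron N) :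
    (∃ e a, IsCube e a ∧ (∀ i, e i ∈ N) ∧ ∀ i, a i ∈ N) ∨ 7 ≤ N.card := by
  obtain ⟨e, he, heN⟩ := h.exists_frame
  choose a haN hopp hae _ using h.exists_opposite hno he heN
  by_cases hadj : ∀ i j, i ≠ j → lor (a i) (a j) = -1 / 2
  · exact .inl ⟨e, a, h.isCube_of_adjacent he haN hopp hae hadj, heN, haN⟩
  · push Not at hadj
    obtain ⟨i, j, hij, hnadj⟩ := hadj
    exact .inr (h.seven_le_card_of_not_adj he heN haN hopp hae hij hnadj)

end NormalSystem

/-! ### Polyhedra seen from a frame -/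

/-- The polyhedron bounded by the three faces of a frame and further faces. -/
def framePolyhedron {ι : Type*} (e : Fin 3 → Mink) (g : ι → Mink) : Set H3 :=
  (⋂ i, halfSpace (e i)) ∩ ⋂ k, halfSpace (g k)

lemma mem_framePolyhedron {ι : Type*} {e : Fin 3 → Mink} {g : ι → Mink} {x : H3} :
    x ∈ framePolyhedron e g ↔ (∀ i, lor x.1 (e i) ≤ 0) ∧ ∀ k, lor x.1 (g k) ≤ 0 := by
  simp only [framePolyhedron, halfSpace, Set.mem_inter_iff, Set.mem_iInter, Set.mem_ofPred_eq]

lemma measurableSet_framePolyhedron {ι : Type*} [Finite ι] (e : Fin 3 → Mink) (g : ι → Mink) :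
    MeasurableSet (framePolyhedron e g) :=
  (MeasurableSet.iInter fun i => measurableSet_halfSpace (e i)).inter
    (MeasurableSet.iInter fun k => measurableSet_halfSpace (g k))

namespace Frame

variable {e e' : Fin 3 → Mink}

lemma lor_eq_lor (h : Frame e) (h' : Frame e') {x y x' y' : Mink} (hxx : lor x x = lor x' x')
    (hyy : lor y y = lor y' y') (hx : ∀ i, lor x (e i) = lor x' (e' i))
    (hy : ∀ i, lor y (e i) = lor y' (e' i)) (hx0 : lor x (apex e) ≠ 0)
    (hy0 : lor y (apex e) ≠ 0) : lor x y = lor x' y' := by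
  have hxa : lor x (apex e) = lor x' (apex e') := by simp only [lor_apex_right, hx]
  have hya : lor y (apex e) = lor y' (apex e') := by simp only [lor_apex_right, hy]
  have hlor := h.lor_eq hx0 hy0
  have hlor' := h'.lor_eq (hxa ▸ hx0) (hya ▸ hy0)
  simp only [hxx, hyy, hx, hy, hxa, hya] at hlor
  rw [← hlor', ← hxa, ← hya, div_left_inj' (mul_ne_zero hx0 hy0)] at hlor
  exact mul_left_cancel₀ two_ne_zero hlor

lemma exists_equiv (h : Frame e) (h' : Frame e') :
    ∃ φ : H3 ≃ H3, ∀ x i, lor (φ x).1 (e' i) = lor x.1 (e i) := by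
  have hpoint : ∀ {e e' : Fin 3 → Mink}, Frame e → Frame e' →
      ∀ x : H3, ∃ y : H3, ∀ i, lor y.1 (e' i) = lor x.1 (e i) := by
    intro e e' h h' x
    obtain ⟨y, hy⟩ := h'.exists_H3 (fun i => -lor x.1 (e i)) (by
      linarith [h.lor_apex_neg x, lor_apex_right x.1 e])
    exact ⟨y, fun i => by rw [hy, neg_neg]⟩
  choose φ hφ using hpoint h h'
  choose ψ hψ using hpoint h' h
  exact ⟨⟨φ, ψ, fun x => h.ext_H3 fun i => by rw [hψ, hφ], fun x => h'.ext_H3 fun i => by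
    rw [hφ, hψ]⟩, hφ⟩

lemma vol_eq_of_chart_image_eq (h : Frame e) (h' : Frame e') {A B : Set H3}
    (hA : MeasurableSet A) (hB : MeasurableSet B) (hAB : chart e '' A = chart e' '' B) :
    vol A = vol B := by
  have hvol := h'.volume_chart_image hB
  rw [← hAB, h.volume_chart_image hA] at hvol
  exact (ENNReal.mul_right_inj (by simp) ENNReal.ofReal_ne_top).mp hvol

lemma congruent (h : Frame e) (h' : Frame e') {ι : Type*} [Finite ι] {g g' : ι → Mink}
    (hself : ∀ k, lor (g k) (g k) = lor (g' k) (g' k))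
    (hframe : ∀ k i, lor (g k) (e i) = lor (g' k) (e' i)) (hapex : ∀ k, lor (g k) (apex e) ≠ 0) :
    Congruent (framePolyhedron e g) (framePolyhedron e' g') ∧
      vol (framePolyhedron e g) = vol (framePolyhedron e' g') := by
  obtain ⟨φ, hφ⟩ := h.exists_equiv h'
  have hisom : ∀ x y, lor (φ x).1 (φ y).1 = lor x.1 y.1 := fun x y =>
    (h.lor_eq_lor h' (by rw [x.2.1, (φ x).2.1]) (by rw [y.2.1, (φ y).2.1])
      (fun i => (hφ x i).symm) (fun i => (hφ y i).symm) (h.lor_apex_neg x).ne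
      (h.lor_apex_neg y).ne).symm
  have hface : ∀ x k, lor (φ x).1 (g' k) = lor x.1 (g k) := fun x k =>
    (h.lor_eq_lor h' (by rw [x.2.1, (φ x).2.1]) (hself k) (fun i => (hφ x i).symm) (hframe k)
      (h.lor_apex_neg x).ne (hapex k)).symm
  have himage : φ '' framePolyhedron e g = framePolyhedron e' g' := by
    rw [Equiv.image_eq_preimage_symm]
    ext y
    obtain ⟨x, rfl⟩ := φ.surjective y
    simp only [Set.mem_preimage, Equiv.symm_apply_apply, mem_framePolyhedron, hφ, hface]
  have hchart : ∀ x, chart e' (φ x) = chart e x := fun x => by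
    simp only [chart, lor_apex_right, hφ]
  refine ⟨⟨φ, fun x y => by rw [hdist, hdist, hisom], himage⟩,
    h.vol_eq_of_chart_image_eq h' (measurableSet_framePolyhedron e g)
      (measurableSet_framePolyhedron e' g') ?_⟩
  rw [← himage, Set.image_image]
  simp only [hchart]

end Frame

namespace NormalSystem

variable {N : Finset Mink} {e : Fin 3 → Mink}

lemma eq_framePolyhedron {ι : Type*} {g : ι → Mink} (heN : ∀ i, e i ∈ N) (hgN : ∀ k, g k ∈ N)
    (hN : ∀ f ∈ N, (∃ i, e i = f) ∨ ∃ k, g k = f) :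
    ⋂ f ∈ N, halfSpace f = framePolyhedron e g := by
  ext x
  rw [mem_polyhedron, mem_framePolyhedron]
  refine ⟨fun hx => ⟨fun i => hx _ (heN i), fun k => hx _ (hgN k)⟩, fun hx f hf => ?_⟩
  rcases hN f hf with ⟨i, rfl⟩ | ⟨k, rfl⟩
  exacts [hx.1 i, hx.2 k]

end NormalSystem

/-! ### Tetrahedra and cubes -/

/-- The outward normals of an ideal tetrahedron: the faces `e i` share an ideal vertex and `k` is
the face opposite to it. -/
structure IsTetrahedron (e : Fin 3 → Mink) (k : Mink) : Prop where
  frame : Frame e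
  unit : lor k k = 1
  adjacent : ∀ i, lor k (e i) = -1 / 2

namespace IsTetrahedron

variable {e e' : Fin 3 → Mink} {k k' f : Mink}

lemma lor_apex (h : IsTetrahedron e k) : lor k (apex e) = -3 / 2 := by
  rw [lor_apex_right, h.adjacent, h.adjacent, h.adjacent]
  norm_num

lemma congruent (h : IsTetrahedron e k) (h' : IsTetrahedron e' k') :
    Congruent (framePolyhedron e fun _ : Unit => k) (framePolyhedron e' fun _ : Unit => k') ∧
      vol (framePolyhedron e fun _ : Unit => k) = vol (framePolyhedron e' fun _ : Unit => k') :=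
  h.frame.congruent h'.frame (fun _ => by rw [h.unit, h'.unit])
    (fun _ i => by rw [h.adjacent, h'.adjacent]) fun _ => by rw [h.lor_apex]; norm_num

lemma lor_pos (h : IsTetrahedron e k) (hf : 0 < lor f f) (hfe : ∀ i, lor f (e i) < 0) :
    0 < lor f k := by
  have hs : lor f (apex e) < 0 := by
    rw [lor_apex_right]
    linarith [hfe 0, hfe 1, hfe 2]
  have hlor := h.frame.lor_eq (x := f) (y := k) hs.ne (by rw [h.lor_apex]; norm_num)
  have hsum := Frame.sum_lor_div hs.ne
  have hnonneg := fun i => (div_pos_of_neg_of_neg (hfe i) hs).le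
  simp only [h.lor_apex, h.unit, h.adjacent] at hlor
  set p := fun i => lor f (e i) / lor f (apex e)
  have hdist : ∑ i, (p i - -1 / 2 / (-3 / 2)) ^ 2 ≤ 2 / 3 := by
    rw [Fin.sum_univ_three] at hsum ⊢
    nlinarith [mul_nonneg (hnonneg 0) (hnonneg 1), mul_nonneg (hnonneg 0) (hnonneg 2),
      mul_nonneg (hnonneg 1) (hnonneg 2)]
  have hheight : 0 < lor f f / lor f (apex e) ^ 2 := div_pos hf (sq_pos_of_neg hs)
  have hquot : 0 < 2 * lor f k / (lor f (apex e) * (-3 / 2)) := by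
    rw [hlor]
    linarith
  linarith [(div_pos_iff_of_pos_right (mul_pos_of_neg_of_neg hs (by norm_num))).mp hquot]

end IsTetrahedron

namespace IsCube

variable {e e' a a' : Fin 3 → Mink} {f : Mink}

lemma lor_eq_ite (h : IsCube e a) (i j : Fin 3) :
    lor (a i) (e j) = if j = i then -2 else -1 / 2 := by
  split_ifs with hji
  exacts [hji ▸ h.opposite i, h.adjacent i j hji]

lemma lor_apex (h : IsCube e a) (i : Fin 3) : lor (a i) (apex e) = -3 := by
  simp only [lor_apex_right, h.lor_eq_ite]
  fin_cases i <;> norm_num [Fin.ext_iff]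

lemma congruent (h : IsCube e a) (h' : IsCube e' a') :
    Congruent (framePolyhedron e a) (framePolyhedron e' a') ∧
      vol (framePolyhedron e a) = vol (framePolyhedron e' a') :=
  h.frame.congruent h'.frame (fun i => by rw [h.unit, h'.unit])
    (fun i j => by rw [h.lor_eq_ite, h'.lor_eq_ite]) fun i => by rw [h.lor_apex]; norm_num

lemma lor_pos (h : IsCube e a) (hf : 0 < lor f f) (hfe : ∀ i, lor f (e i) < 0) {i : Fin 3}
    (hmin : ∀ j, lor f (e i) ≤ lor f (e j)) : 0 < lor f (a i) := by
  have hs : lor f (apex e) < 0 := by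
    rw [lor_apex_right]
    linarith [hfe 0, hfe 1, hfe 2]
  have hlor := h.frame.lor_eq (x := f) (y := a i) hs.ne (by rw [h.lor_apex]; norm_num)
  have hsum := Frame.sum_lor_div hs.ne
  have hnonneg := fun j => (div_pos_of_neg_of_neg (hfe j) hs).le
  have hmax := fun j => div_le_div_of_nonpos_of_le hs.le (hmin j)
  obtain ⟨j, k, hij, hik, hjk, huniv⟩ := exists_univ_eq_triple i
  have hsum_eq : ∀ g : Fin 3 → ℝ, ∑ l, g l = g i + g j + g k := fun g => by
    simp [huniv, hij, hik, hjk, add_assoc]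
  rw [h.lor_apex, h.unit, hsum_eq, h.opposite, h.adjacent i j hij.symm,
    h.adjacent i k hik.symm] at hlor
  rw [hsum_eq] at hsum
  set p := fun l => lor f (e l) / lor f (apex e)
  have hdist : (p i - -2 / -3) ^ 2 + (p j - -1 / 2 / -3) ^ 2 + (p k - -1 / 2 / -3) ^ 2 ≤ 1 / 6 := by
    nlinarith [mul_le_mul_of_nonneg_right (hmax j) (hnonneg j),
      mul_le_mul_of_nonneg_right (hmax k) (hnonneg k)]
  have hheight : 0 < lor f f / lor f (apex e) ^ 2 := div_pos hf (sq_pos_of_neg hs)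
  have hquot : 0 < 2 * lor f (a i) / (lor f (apex e) * -3) := by
    rw [hlor]
    linarith
  linarith [(div_pos_iff_of_pos_right (mul_pos_of_neg_of_neg hs (by norm_num))).mp hquot]

end IsCube

namespace NormalSystem

variable {N : Finset Mink} {e a : Fin 3 → Mink} {k : Mink}

lemma eq_framePolyhedron_of_isTetrahedron (h : NormalSystem N) (hT : IsTetrahedron e k)
    (heN : ∀ i, e i ∈ N) (hkN : k ∈ N) :
    ⋂ f ∈ N, halfSpace f = framePolyhedron e fun _ : Unit => k := by
  refine eq_framePolyhedron heN (fun _ => hkN) fun f hf => ?_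
  by_contra! hcon
  have hpos := hT.lor_pos (by rw [h.unit f hf]; exact one_pos) fun i =>
    (h.le_neg_half hf (heN i) (hcon.1 i).symm).trans_lt (by norm_num)
  linarith [h.le_neg_half hf hkN (hcon.2 ()).symm]

lemma eq_framePolyhedron_of_isCube (h : NormalSystem N) (hC : IsCube e a)
    (heN : ∀ i, e i ∈ N) (haN : ∀ i, a i ∈ N) :
    ⋂ f ∈ N, halfSpace f = framePolyhedron e a := by
  refine eq_framePolyhedron heN haN fun f hf => ?_
  by_contra! hcon
  obtain ⟨i, hi⟩ := Finite.exists_min fun i => lor f (e i)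
  have hpos := hC.lor_pos (by rw [h.unit f hf]; exact one_pos) (fun i =>
    (h.le_neg_half hf (heN i) (hcon.1 i).symm).trans_lt (by norm_num)) hi
  linarith [h.le_neg_half hf (haN i) (hcon.2 i).symm]

theorem isTetrahedron_or_isCube_or_ten_le_vol (h : NormalSystem N) :
    (∃ e k, IsTetrahedron e k ∧ ⋂ f ∈ N, halfSpace f = framePolyhedron e fun _ : Unit => k) ∨
    (∃ e a, IsCube e a ∧ ⋂ f ∈ N, halfSpace f = framePolyhedron e a) ∨
    10 ≤ ENNReal.ofReal (√3) * vol (⋂ f ∈ N, halfSpace f) := by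
  by_cases hno : NoTetrahedron N
  · right
    refine (h.exists_isCube_or_seven_le_card hno).imp ?_ (h.ten_le_vol hno)
    rintro ⟨e, a, hC, heN, haN⟩
    exact ⟨e, a, hC, h.eq_framePolyhedron_of_isCube hC heN haN⟩
  · left
    unfold NoTetrahedron at hno
    push Not at hno
    obtain ⟨e, he, heN, k, hkN, hke⟩ := hno
    have hT : IsTetrahedron e k := ⟨he, h.unit k hkN, hke⟩
    exact ⟨e, k, hT, h.eq_framePolyhedron_of_isTetrahedron hT heN hkN⟩

end NormalSystem

/-! ### Equiangular polyhedra from Gram matrices -/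

lemma timelike_future_sum {ι : Type*} {s : Finset ι} (hs : s.Nonempty) (y : ι → H3) :
    lor (∑ i ∈ s, (y i).1) (∑ i ∈ s, (y i).1) < 0 ∧ 0 < (∑ i ∈ s, (y i).1).1 :=
  Finset.sum_induction_nonempty (fun i => (y i).1) (fun w => lor w w < 0 ∧ 0 < w.1)
    (fun _ _ hv hw => by
      simpa only [one_smul] using timelike_future_add hv.1 hv.2 hw.1 hw.2 one_pos one_pos) hs
    fun i _ => ⟨(y i).lor_self_neg, (y i).2.2⟩

lemma exists_nonneg_of_subset_halfSpace {N : Finset Mink} {e w : Mink} (he : lor e e = 1)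
    (hsub : ⋂ n ∈ N, halfSpace n ⊆ halfSpace e) (hw : lor w w < 0) (hw0 : 0 < w.1)
    (hwe : lor w e = 0) : ∃ n ∈ N, 0 ≤ lor w n := by
  by_contra! hneg
  obtain ⟨s, hs, htimelike, hfuture, hN⟩ := exists_small_step (u := e) hw hw0
    fun n hn => Or.inl (hneg n hn)
  obtain ⟨y, c, hc, hy⟩ := exists_H3_smul htimelike hfuture
  have hye : lor y.1 e ≤ 0 := hsub <| mem_polyhedron.mpr fun n hn => by
    have hyn := hN n hn
    rw [hy, lor_smul_left] at hyn
    exact nonpos_of_mul_nonpos_right hyn hc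
  have hstep : c * lor y.1 e = s := by
    rw [← lor_smul_left, ← hy, lor_add_left, lor_smul_left, hwe, he, zero_add, mul_one]
  nlinarith

lemma spanRank_empty : spanRank ∅ = 0 := by
  rw [spanRank, Set.image_empty, Submodule.span_empty, finrank_bot]

lemma nonempty_of_spanRank_ne_zero {A : Set H3} (h : spanRank A ≠ 0) : A.Nonempty :=
  Set.nonempty_iff_ne_empty.mpr fun hA => h (hA ▸ spanRank_empty)

/-- Otherwise the sum of a point of the face off each bounding hyperplane is a vector in the
relative interior of the face, from which one could leave the half-space of `e`. -/
lemma IsFaceNormal.exists_forall_lor_eq_zero {N : Finset Mink} {e : Mink}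
    (he : IsFaceNormal (⋂ n ∈ N, halfSpace n) e) :
    ∃ n ∈ N, ∀ y ∈ (⋂ n ∈ N, halfSpace n) ∩ hyperplane e, lor y.1 n = 0 := by
  classical
  obtain ⟨hee, hsub, hrank⟩ := he
  by_contra! hlt
  obtain ⟨y₀, hy₀⟩ := nonempty_of_spanRank_ne_zero (hrank.trans_ne three_ne_zero)
  have hexists : ∀ n, ∃ y ∈ (⋂ n ∈ N, halfSpace n) ∩ hyperplane e, n ∈ N → lor y.1 n ≠ 0 :=
    fun n => (em (n ∈ N)).elim (fun hn => (hlt n hn).imp fun y hy => ⟨hy.1, fun _ => hy.2⟩)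
      fun hn => ⟨y₀, hy₀, fun hn' => absurd hn' hn⟩
  choose y hy hyn using hexists
  have hyN : ∀ m, ∀ n ∈ N, lor (y m).1 n ≤ 0 := fun m => mem_polyhedron.mp (hy m).1
  obtain ⟨hw, hw0⟩ := timelike_future_sum (Finset.insert_nonempty e N) y
  obtain ⟨n, hn, hwn⟩ := exists_nonneg_of_subset_halfSpace hee hsub hw hw0
    (by rw [lor_sum_left]; exact Finset.sum_eq_zero fun m _ => (hy m).2)
  rw [lor_sum_left] at hwn
  exact hwn.not_gt <| Finset.sum_neg' (fun m _ => hyN m n hn)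
    ⟨n, Finset.mem_insert_of_mem hn, (hyN n n hn).lt_of_ne (hyn n hn)⟩

lemma mem_of_isFaceNormal {N : Finset Mink} (hunit : ∀ n ∈ N, lor n n = 1) {x : H3} {r : ℝ}
    (hr : 0 < r) (hball : {y | hdist x y < r} ⊆ ⋂ n ∈ N, halfSpace n) {e : Mink}
    (he : IsFaceNormal (⋂ n ∈ N, halfSpace n) e) : e ∈ N := by
  obtain ⟨n, hn, hFn⟩ := he.exists_forall_lor_eq_zero
  obtain ⟨hee, hsub, hrank⟩ := he
  obtain ⟨y, hy⟩ := nonempty_of_spanRank_ne_zero (hrank.trans_ne three_ne_zero)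
  have hadd : e + n ≠ 0 := fun hsum => by
    have hx : lor x.1 e + lor x.1 n = 0 := by rw [← lor_add_right, hsum, lor_zero_right]
    linarith [lor_neg_of_ball_subset hr hee (hball.trans hsub),
      lor_neg_of_ball_subset hr (hunit n hn) (hball.trans (Set.biInter_subset_of_mem hn))]
  by_contra heN
  have hsq := lor_sq_lt_one_of_perp y.lor_self_neg hee (hunit n hn) hy.2 (hFn y hy)
    (ne_of_mem_of_not_mem hn heN).symm hadd
  have hspan : Submodule.span ℝ ((fun x : H3 => x.1) '' ((⋂ n ∈ N, halfSpace n) ∩ hyperplane e)) ≤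
      perp e ⊓ perp n := by
    rw [Submodule.span_le]
    rintro _ ⟨z, hz, rfl⟩
    exact ⟨mem_perp.mpr hz.2, mem_perp.mpr (hFn z hz)⟩
  have hle := Submodule.finrank_mono hspan
  rw [finrank_perp_inf_perp (by rw [hee]; exact one_ne_zero)
    (by rw [hee, hunit n hn, mul_one]; exact hsq.ne)] at hle
  rw [spanRank] at hrank
  omega

lemma dihedralAngle_of_lor_eq {e f : Mink} (h : lor e f = -1 / 2) :
    dihedralAngle e f = Real.pi / 3 := by
  rw [dihedralAngle, h, neg_div, Real.arccos_neg, ← Real.cos_pi_div_three,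
    Real.arccos_cos (by positivity) (by linarith [Real.pi_pos])]
  ring

/-- The hyperplane with normal `n` has distance `arsinh n.1` from the point `lift 0`. -/
lemma ball_subset_halfSpace {n : Mink} (hn : lor n n = 1) (hn0 : 0 < n.1) :
    {y | hdist (lift 0) y < Real.arsinh n.1} ⊆ halfSpace n := by
  intro y hy
  have hy1 : 1 ≤ y.1.1 := by
    have hyy := y.2.1
    rw [lor, real_inner_self_eq_norm_sq] at hyy
    nlinarith [y.2.2, sq_nonneg ‖y.1.2‖]
  have hlor : -lor (lift 0).1 y.1 = y.1.1 := by simp [lor, lift]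
  have hlt : y.1.1 < √(1 + n.1 ^ 2) := by
    have hdist_lt : Real.arcosh y.1.1 < Real.arsinh n.1 := by rw [← hlor]; exact hy
    rw [← Real.cosh_arsinh, ← Real.cosh_arcosh hy1, Real.cosh_lt_cosh,
      abs_of_nonneg (Real.arcosh_nonneg hy1), abs_of_pos (Real.arsinh_pos_iff.mpr hn0)]
    exact hdist_lt
  rw [Real.lt_sqrt y.2.2.le] at hlt
  have hynorm : ‖y.1.2‖ ^ 2 = y.1.1 ^ 2 - 1 := by
    have hyy := y.2.1
    rw [lor, real_inner_self_eq_norm_sq] at hyy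
    linarith
  have hnnorm : ‖n.2‖ ^ 2 = 1 + n.1 ^ 2 := by
    rw [lor, real_inner_self_eq_norm_sq] at hn
    linarith
  have hle : ‖y.1.2‖ * ‖n.2‖ ≤ y.1.1 * n.1 := by
    rw [← sq_le_sq₀ (by positivity) (mul_pos y.2.2 hn0).le, mul_pow, hynorm, hnnorm]
    linarith
  change -(y.1.1 * n.1) + inner ℝ y.1.2 n.2 ≤ 0
  linarith [real_inner_le_norm y.1.2 n.2]

lemma exists_ball_subset_iInter_halfSpace {ι : Type*} [Finite ι] {n : ι → Mink}
    (hunit : ∀ i, lor (n i) (n i) = 1) (hfuture : ∀ i, 0 < (n i).1) :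
    ∃ r > 0, {y | hdist (lift 0) y < r} ⊆ ⋂ i, halfSpace (n i) := by
  have hsmall : ∀ᶠ r in nhds (0 : ℝ), ∀ i, r < Real.arsinh (n i).1 :=
    Filter.eventually_all.mpr fun i => eventually_lt_nhds (Real.arsinh_pos_iff.mpr (hfuture i))
  have hpos : ∀ᶠ r in nhdsWithin (0 : ℝ) (Set.Ioi 0), 0 < r := eventually_mem_nhdsWithin
  obtain ⟨r, hr, hri⟩ := (hpos.and (hsmall.filter_mono nhdsWithin_le_nhds)).exists
  exact ⟨r, hr, Set.subset_iInter fun i => subset_trans (fun _ hy => lt_trans hy (hri i))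
    (ball_subset_halfSpace (hunit i) (hfuture i))⟩

lemma isEquiangular_of_gram {ι : Type*} [Finite ι] {n : ι → Mink}
    (hunit : ∀ i, lor (n i) (n i) = 1) (hfuture : ∀ i, 0 < (n i).1)
    (hgram : ∀ i j, i ≠ j → lor (n i) (n j) = -1 / 2 ∨ lor (n i) (n j) < -1)
    (hvol : vol (⋂ i, halfSpace (n i)) < ⊤) :
    IsEquiangular (Real.pi / 3) (⋂ i, halfSpace (n i)) := by
  obtain ⟨r, hr, hball⟩ := exists_ball_subset_iInter_halfSpace hunit hfuture
  have hN : ⋂ i, halfSpace (n i) = ⋂ e ∈ (Set.finite_range n).toFinset, halfSpace e := by simp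
  have hunitN : ∀ e ∈ (Set.finite_range n).toFinset, lor e e = 1 := by simpa using hunit
  refine ⟨⟨⟨_, hunitN, hN⟩, _, r, hr, hball⟩, hvol, fun e f ⟨he, hf, hef, hrank⟩ => ?_⟩
  obtain ⟨y, hye, hyf⟩ := nonempty_of_spanRank_ne_zero (hrank.trans_ne two_ne_zero)
  rw [hN] at hball he hf
  have hmem : ∀ {f}, IsFaceNormal (⋂ e ∈ (Set.finite_range n).toFinset, halfSpace e) f →
      ∃ i, n i = f := fun hf => by simpa using mem_of_isFaceNormal hunitN hr hball hf
  obtain ⟨i, rfl⟩ := hmem he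
  obtain ⟨j, rfl⟩ := hmem hf
  have hlow := neg_one_le_lor_of_perp y.lor_self_neg.le
    (ne_zero_of_lor_self_ne_zero y.lor_self_neg.ne) (hunit i) (hunit j) hye.2 hyf.2
  exact dihedralAngle_of_lor_eq
    ((hgram i j fun hij => hef (congrArg n hij)).resolve_right hlow.not_gt)

/-! ### The regular ideal tetrahedron and cube -/

/-- The outward normals of the cube `P₂`: the faces of the cube are paired by the sign `s = ±1`. -/
noncomputable def cubeNormal (s : ℝ) (i : Fin 3) : Mink :=
  (1 / √2, EuclideanSpace.single i (s * √3 / √2))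

lemma lor_cubeNormal (x : Mink) (s : ℝ) (i : Fin 3) :
    lor x (cubeNormal s i) = (s * (√3 * x.2 i) - x.1) / √2 := by
  simp only [lor, cubeNormal, EuclideanSpace.inner_single_right, conj_trivial]
  ring

lemma lor_cubeNormal_cubeNormal (s t : ℝ) (i j : Fin 3) :
    lor (cubeNormal s i) (cubeNormal t j) = if i = j then 3 / 2 * (s * t) - 1 / 2 else -1 / 2 := by
  have hsqrt2 : √2 ^ 2 = 2 := Real.sq_sqrt (by norm_num)
  have hsqrt3 : √3 ^ 2 = 3 := Real.sq_sqrt (by norm_num)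
  rw [lor_cubeNormal]
  split_ifs with hij
  · subst hij
    simp only [cubeNormal, PiLp.single_apply, if_true]
    field_simp
    rw [hsqrt2, hsqrt3]
    ring
  · simp only [cubeNormal, PiLp.single_apply, if_neg (Ne.symm hij)]
    field_simp
    rw [hsqrt2]
    ring

lemma frame_cubeNormal : Frame (cubeNormal 1) where
  unit i := by rw [lor_cubeNormal_cubeNormal, if_pos rfl]; norm_num
  pair i j hij := by rw [lor_cubeNormal_cubeNormal, if_neg hij]
  future := by simp only [apex, cubeNormal, Fin.sum_univ_three, Prod.fst_add]; positivity

lemma isCube_cubeNormal : IsCube (cubeNormal 1) (cubeNormal (-1)) where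
  frame := frame_cubeNormal
  unit i := by rw [lor_cubeNormal_cubeNormal, if_pos rfl]; norm_num
  opposite i := by rw [lor_cubeNormal_cubeNormal, if_pos rfl]; norm_num
  adjacent i j hji := by rw [lor_cubeNormal_cubeNormal, if_neg hji.symm]

/-- The vertices of the tetrahedron `P₁`, scaled by `√3`. -/
def tetrahedronSign : Fin 4 → Fin 3 → ℝ :=
  ![![1, 1, 1], ![1, -1, -1], ![-1, 1, -1], ![-1, -1, 1]]

lemma sum_tetrahedronSign_mul (k l : Fin 4) :
    ∑ i, tetrahedronSign k i * tetrahedronSign l i = if k = l then 3 else -1 := by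
  fin_cases k <;> fin_cases l <;> simp [tetrahedronSign, Fin.sum_univ_three] <;> norm_num

/-- The outward normals of the tetrahedron `P₁`; the face with normal `tetrahedronNormal k` is
opposite to the vertex `k`. -/
noncomputable def tetrahedronNormal (k : Fin 4) : Mink :=
  (1 / (2 * √2), WithLp.toLp 2 fun i => -(√3 * tetrahedronSign k i) / (2 * √2))

lemma lor_tetrahedronNormal (x : Mink) (k : Fin 4) :
    lor x (tetrahedronNormal k) =
      -(x.1 + √3 * ∑ i, tetrahedronSign k i * x.2 i) / (2 * √2) := by
  simp only [lor, tetrahedronNormal, PiLp.inner_apply, Fin.sum_univ_three, RCLike.inner_apply,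
    conj_trivial]
  ring

lemma lor_tetrahedronNormal_tetrahedronNormal (k l : Fin 4) :
    lor (tetrahedronNormal k) (tetrahedronNormal l) = if k = l then 1 else -1 / 2 := by
  have hsqrt2 : √2 ^ 2 = 2 := Real.sq_sqrt (by norm_num)
  have hsqrt3 : √3 ^ 2 = 3 := Real.sq_sqrt (by norm_num)
  have hsum : ∑ i, tetrahedronSign l i * (tetrahedronNormal k).2 i =
      -√3 / (2 * √2) * if k = l then 3 else -1 := by
    rw [← sum_tetrahedronSign_mul, Finset.mul_sum]
    exact Finset.sum_congr rfl fun i _ => by simp only [tetrahedronNormal]; ring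
  rw [lor_tetrahedronNormal, hsum, tetrahedronNormal]
  split_ifs <;> field_simp <;> rw [hsqrt2, hsqrt3] <;> norm_num

lemma isTetrahedron_tetrahedronNormal :
    IsTetrahedron (fun i : Fin 3 => tetrahedronNormal i.succ) (tetrahedronNormal 0) where
  frame :=
    { unit := fun i => by rw [lor_tetrahedronNormal_tetrahedronNormal, if_pos rfl]
      pair := fun i j hij => by
        rw [lor_tetrahedronNormal_tetrahedronNormal, if_neg ((Fin.succ_injective _).ne hij)]
      future := by
        simp only [apex, tetrahedronNormal, Fin.sum_univ_three, Prod.fst_add]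
        positivity }
  unit := by rw [lor_tetrahedronNormal_tetrahedronNormal, if_pos rfl]
  adjacent i := by rw [lor_tetrahedronNormal_tetrahedronNormal, if_neg (Fin.succ_ne_zero i).symm]

lemma convexHull_cubeVertices :
    convexHull ℝ cubeVertices = {y | ∀ i, y i ∈ Set.Icc (-(1 / √3)) (1 / √3)} := by
  have hpi : cubeVertices = (WithLp.linearEquiv 2 ℝ (Fin 3 → ℝ)).symm.toLinearMap ''
      Set.univ.pi fun _ => {-(1 / √3), 1 / √3} := by
    ext v
    exact ⟨fun hv => ⟨v.ofLp, fun i _ => (hv i).symm, rfl⟩, by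
      rintro ⟨w, hw, rfl⟩ i
      exact (hw i trivial).symm⟩
  have hle : -(1 / √3) ≤ 1 / √3 := neg_le_self (by positivity)
  rw [hpi, ← LinearMap.image_convexHull, convexHull_pi]
  simp only [convexHull_pair, segment_eq_Icc hle]
  ext v
  exact ⟨by rintro ⟨w, hw, rfl⟩ i; exact hw i trivial, fun hv => ⟨v.ofLp, fun i _ => hv i, rfl⟩⟩

lemma mem_P₂ {x : H3} : x ∈ P₂ ↔ ∀ i, |√3 * x.1.2 i| ≤ x.1.1 := by
  have hsqrt3 : 0 < √3 := by positivity
  simp only [P₂, idealHull, convexHull_cubeVertices, Set.mem_ofPred_eq, Set.mem_Icc,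
    PiLp.smul_apply, smul_eq_mul]
  refine forall_congr' fun i => ?_
  rw [← abs_le, abs_mul, abs_mul, abs_inv, abs_of_pos x.2.2, abs_of_pos hsqrt3,
    inv_mul_le_iff₀ x.2.2, mul_one_div, le_div_iff₀ hsqrt3, mul_comm]

lemma P₂_eq_framePolyhedron : P₂ = framePolyhedron (cubeNormal 1) (cubeNormal (-1)) := by
  ext x
  have hiff : ∀ s i, lor x.1 (cubeNormal s i) ≤ 0 ↔ s * (√3 * x.1.2 i) ≤ x.1.1 := fun s i => by
    rw [lor_cubeNormal, div_le_iff₀ (by positivity), zero_mul, sub_nonpos]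
  simp only [mem_P₂, mem_framePolyhedron, hiff, abs_le', ← forall_and, one_mul, neg_one_mul]

lemma tetrahedronVertices_eq_range : tetrahedronVertices =
    Set.range fun k => (WithLp.toLp 2 fun i => tetrahedronSign k i * (1 / √3) : E3) := by
  have hpos : 0 < 1 / √3 := by positivity
  ext v
  constructor
  · rintro ⟨hv, hprod⟩
    have hv_eq : ∀ k, (∀ i, v i = tetrahedronSign k i * (1 / √3)) → v ∈ Set.range fun k =>
        (WithLp.toLp 2 fun i => tetrahedronSign k i * (1 / √3) : E3) :=
      fun k hk => ⟨k, by ext i; exact (hk i).symm⟩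
    rcases hv 0 with h0 | h0 <;> rcases hv 1 with h1 | h1 <;> rcases hv 2 with h2 | h2 <;>
      rw [h0, h1, h2] at hprod
    · exact hv_eq 0 (by simp [Fin.forall_fin_succ, tetrahedronSign, h0, h1, h2])
    · nlinarith [pow_pos hpos 3]
    · nlinarith [pow_pos hpos 3]
    · exact hv_eq 1 (by simp [Fin.forall_fin_succ, tetrahedronSign, h0, h1, h2])
    · nlinarith [pow_pos hpos 3]
    · exact hv_eq 2 (by simp [Fin.forall_fin_succ, tetrahedronSign, h0, h1, h2])
    · exact hv_eq 3 (by simp [Fin.forall_fin_succ, tetrahedronSign, h0, h1, h2])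
    · nlinarith [pow_pos hpos 3]
  · rintro ⟨k, rfl⟩
    constructor
    · intro i
      fin_cases k <;> fin_cases i <;> simp [tetrahedronSign]
    · fin_cases k <;> simp [tetrahedronSign]

/-- The barycentric coordinates of `y` are `(1 + √3 * ∑ i, tetrahedronSign k i * y i) / 4`. -/
lemma convexHull_tetrahedronVertices :
    convexHull ℝ tetrahedronVertices =
      {y | ∀ k, 0 ≤ 1 + √3 * ∑ i, tetrahedronSign k i * y i} := by
  have hsqrt3 : √3 * (1 / √3) = 1 := mul_one_div_cancel (by positivity)
  apply Set.Subset.antisymm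
  · refine convexHull_min ?_ fun x hx y hy a b ha hb hab k => ?_
    · rw [tetrahedronVertices_eq_range]
      rintro _ ⟨l, rfl⟩ k
      simp only [← mul_assoc, ← Finset.sum_mul, sum_tetrahedronSign_mul]
      rw [mul_right_comm, hsqrt3]
      split_ifs <;> norm_num
    · have hcombo := add_nonneg (mul_nonneg ha (hx k)) (mul_nonneg hb (hy k))
      simp only [Fin.sum_univ_three, PiLp.add_apply, PiLp.smul_apply, smul_eq_mul] at hcombo ⊢
      linear_combination hcombo + hab
  · intro y hy
    have hbary : y = ∑ k, ((1 + √3 * ∑ i, tetrahedronSign k i * y i) / 4) •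
        (WithLp.toLp 2 fun i => tetrahedronSign k i * (1 / √3) : E3) := by
      ext i
      simp only [Fin.sum_univ_four, Fin.sum_univ_three, PiLp.add_apply, PiLp.smul_apply,
        smul_eq_mul]
      fin_cases i <;> simp [tetrahedronSign] <;> field_simp <;> ring
    rw [hbary, tetrahedronVertices_eq_range]
    refine (convex_convexHull ℝ _).sum_mem (fun k _ => div_nonneg (hy k) (by norm_num)) ?_
      fun k _ => subset_convexHull ℝ _ ⟨k, rfl⟩
    simp only [Fin.sum_univ_four, Fin.sum_univ_three, tetrahedronSign, Matrix.cons_val]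
    ring

lemma P₁_eq_iInter : P₁ = ⋂ k, halfSpace (tetrahedronNormal k) := by
  ext x
  simp only [P₁, idealHull, convexHull_tetrahedronVertices, Set.mem_ofPred_eq, PiLp.smul_apply,
    smul_eq_mul, Set.mem_iInter, halfSpace]
  refine forall_congr' fun k => ?_
  have hscale : 1 + √3 * ∑ i, tetrahedronSign k i * (x.1.1⁻¹ * x.1.2 i) =
      (x.1.1 + √3 * ∑ i, tetrahedronSign k i * x.1.2 i) / x.1.1 := by
    have hx := x.2.2.ne'
    simp only [Fin.sum_univ_three]
    field_simp
  rw [hscale, le_div_iff₀ x.2.2, zero_mul, lor_tetrahedronNormal, div_le_iff₀ (by positivity),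
    zero_mul, neg_nonpos]

lemma P₁_eq_framePolyhedron : P₁ = framePolyhedron (fun i : Fin 3 => tetrahedronNormal i.succ)
    fun _ : Unit => tetrahedronNormal 0 := by
  ext x
  rw [P₁_eq_iInter, mem_framePolyhedron, Set.mem_iInter, Fin.forall_fin_succ, and_comm,
    forall_const]
  rfl

lemma P₁_subset_P₂ : P₁ ⊆ P₂ := fun _ hx => convexHull_mono (fun _ hv => hv.1) hx

lemma measurableSet_P₁ : MeasurableSet P₁ :=
  P₁_eq_framePolyhedron ▸ measurableSet_framePolyhedron _ _

lemma measurableSet_P₂ : MeasurableSet P₂ :=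
  P₂_eq_framePolyhedron ▸ measurableSet_framePolyhedron _ _

lemma isEquiangular_P₂ (hvol : vol P₂ < ⊤) : IsEquiangular (Real.pi / 3) P₂ := by
  have hP₂ : P₂ = ⋂ k, halfSpace (Sum.elim (cubeNormal 1) (cubeNormal (-1)) k) := by
    rw [P₂_eq_framePolyhedron, Set.iInter_sum]
    rfl
  rw [hP₂] at hvol ⊢
  refine isEquiangular_of_gram ?_ ?_ ?_ hvol
  · rintro (i | i) <;> simp only [Sum.elim_inl, Sum.elim_inr, lor_cubeNormal_cubeNormal] <;>
      norm_num
  · rintro (i | i) <;> simp only [Sum.elim_inl, Sum.elim_inr, cubeNormal] <;> positivity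
  · rintro (i | i) (j | j) hij <;> rcases eq_or_ne i j with rfl | hne <;>
      simp_all only [Sum.elim_inl, Sum.elim_inr, lor_cubeNormal_cubeNormal] <;> norm_num at *

lemma isEquiangular_P₁ (hvol : vol P₁ < ⊤) : IsEquiangular (Real.pi / 3) P₁ := by
  rw [P₁_eq_iInter] at hvol ⊢
  refine isEquiangular_of_gram (fun k => ?_) (fun k => ?_) (fun k l hkl => .inl ?_) hvol
  · rw [lor_tetrahedronNormal_tetrahedronNormal, if_pos rfl]
  · simp only [tetrahedronNormal]
    positivity
  · rw [lor_tetrahedronNormal_tetrahedronNormal, if_neg hkl]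

lemma vol_pos_of_isOpen {A : Set H3} (hA : MeasurableSet A) {U : Set E3} (hU : IsOpen U)
    (hne : U.Nonempty) (hUA : U ⊆ lift ⁻¹' A) : 0 < vol A := by
  have hdensity : ∀ y : E3, 0 < 1 / √(1 + ‖y‖ ^ 2) := fun y => by positivity
  rw [vol_apply hA]
  refine lt_of_lt_of_le ?_ (lintegral_mono_set hUA)
  rw [setLIntegral_pos_iff (by fun_prop)]
  have hsupport : (Function.support fun y : E3 => ENNReal.ofReal (1 / √(1 + ‖y‖ ^ 2))) =
      Set.univ := Set.eq_univ_of_forall fun y => (ENNReal.ofReal_pos.mpr (hdensity y)).ne'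
  rw [hsupport, Set.univ_inter]
  exact hU.measure_pos volume hne

lemma vol_P₂_sdiff_P₁_pos : 0 < vol (P₂ \ P₁) := by
  refine vol_pos_of_isOpen (measurableSet_P₂.diff measurableSet_P₁)
    (U := (⋂ i, {y : E3 | |√3 * y i| < √(1 + ‖y‖ ^ 2)}) ∩
      {y | √(1 + ‖y‖ ^ 2) + √3 * ∑ i, tetrahedronSign 0 i * y i < 0})
    ((isOpen_iInter_of_finite fun i => isOpen_lt (by fun_prop) (by fun_prop)).inter
      (isOpen_lt (by fun_prop) (by fun_prop))) ⟨WithLp.toLp 2 fun _ => -1, ?_⟩ ?_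
  · have hnorm : √(1 + ‖(WithLp.toLp 2 fun _ => -1 : E3)‖ ^ 2) = 2 := by
      rw [EuclideanSpace.norm_sq_eq, Real.sqrt_eq_iff_mul_self_eq (by positivity) (by norm_num)]
      norm_num
    have hlt : √3 < 2 := by rw [Real.sqrt_lt' (by norm_num)]; norm_num
    have hgt : 1 < √3 := Real.lt_sqrt_of_sq_lt (by norm_num)
    refine ⟨Set.mem_iInter.mpr fun i => ?_, ?_⟩
    · rw [Set.mem_ofPred_eq, hnorm, mul_neg_one, abs_neg, abs_of_pos (by positivity)]
      exact hlt
    · rw [Set.mem_ofPred_eq, hnorm]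
      simp only [Fin.sum_univ_three, tetrahedronSign, Matrix.cons_val]
      linarith
  · rintro y ⟨hcube, hbeyond⟩
    refine ⟨mem_P₂.mpr fun i => (Set.mem_iInter.mp hcube i).le, fun hy => ?_⟩
    rw [P₁_eq_iInter] at hy
    have hface : lor (lift y).1 (tetrahedronNormal 0) ≤ 0 := Set.mem_iInter.mp hy 0
    rw [lor_tetrahedronNormal, div_le_iff₀ (by positivity), zero_mul, neg_nonpos] at hface
    exact hface.not_gt hbeyond

lemma vol_P₁_lt_vol_P₂ (hvol : vol P₂ < ⊤) : vol P₁ < vol P₂ := by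
  rw [← measure_sdiff_add_inter P₂ measurableSet_P₁,
    Set.inter_eq_self_of_subset_right P₁_subset_P₂, add_comm]
  exact ENNReal.lt_add_right ((measure_mono P₁_subset_P₂).trans_lt hvol).ne
    vol_P₂_sdiff_P₁_pos.ne'

/-! ### The volume of the regular ideal cube -/

lemma integral_sum_mul_pow {n : ℕ} (c : Fin n → ℝ) (α β : ℝ) :
    ∫ b in α..β, ∑ k, c k * b ^ (k : ℕ) =
      ∑ k, c k * ((β ^ (k + 1 : ℕ) - α ^ (k + 1 : ℕ)) / (k + 1)) := by
  rw [intervalIntegral.integral_finsetSum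
    fun k _ => Continuous.intervalIntegrable (by fun_prop) _ _]
  simp only [intervalIntegral.integral_const_mul, integral_pow]

/-- A fundamental domain of the symmetries of the cube, in the chart of a vertex. -/
def sector : Set (ℝ × ℝ × ℝ) :=
  {p | (0 ≤ p.1 ∧ p.1 ≤ p.2.1 ∧ p.1 + 2 * p.2.1 ≤ 1) ∧ 0 < p.2.2 ∧
    p.2.2 * (1 - 2 * (p.1 ^ 2 + p.1 * p.2.1 + p.2.1 ^ 2)) ≤ 3 / 2}

lemma measurableSet_sector : MeasurableSet sector := by
  have ha : Measurable fun p : ℝ × ℝ × ℝ => p.1 := measurable_fst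
  have hb : Measurable fun p : ℝ × ℝ × ℝ => p.2.1 := measurable_snd.fst
  have hsum : Measurable fun p : ℝ × ℝ × ℝ => p.1 + 2 * p.2.1 := by fun_prop
  have hw : Measurable fun p : ℝ × ℝ × ℝ => p.2.2 := measurable_snd.snd
  have hheight : Measurable fun p : ℝ × ℝ × ℝ =>
    p.2.2 * (1 - 2 * (p.1 ^ 2 + p.1 * p.2.1 + p.2.1 ^ 2)) := by fun_prop
  exact ((measurableSet_le measurable_const ha).inter ((measurableSet_le ha hb).inter
    (measurableSet_le hsum measurable_const))).inter
    ((measurableSet_lt measurable_const hw).inter (measurableSet_le hheight measurable_const))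

/-- For `0 ≤ q ≤ 1 / 3` one has `1 ≤ (1 - 2 * q) * (1 + 2 * q + 12 * q ^ 2)`, so the height bound
`3 / 2 / (1 - 2 * q)` of the sector is at most a polynomial. -/
lemma le_quartic_of_mem_sector {a b w : ℝ} (h : (a, b, w) ∈ sector) :
    w ≤ 3 / 2 * (1 + 2 * (a ^ 2 + a * b + b ^ 2) + 12 * (a ^ 2 + a * b + b ^ 2) ^ 2) := by
  obtain ⟨⟨ha : 0 ≤ a, hab : a ≤ b, hb : a + 2 * b ≤ 1⟩, hw : 0 < w,
    hheight : w * (1 - 2 * (a ^ 2 + a * b + b ^ 2)) ≤ 3 / 2⟩ := h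
  have hq : 3 * (a ^ 2 + a * b + b ^ 2) ≤ 1 := by
    nlinarith [mul_nonneg (sub_nonneg.mpr hab) (show 0 ≤ b + 2 * a by linarith)]
  have hq0 : 0 ≤ a ^ 2 + a * b + b ^ 2 := by nlinarith
  set q := a ^ 2 + a * b + b ^ 2
  have hmul := mul_le_mul_of_nonneg_right hheight (show 0 ≤ 1 + 2 * q + 12 * q ^ 2 by positivity)
  have hexcess : 0 ≤ w * (q ^ 2 * (1 - 3 * q)) :=
    mul_nonneg hw.le (mul_nonneg (sq_nonneg q) (by linarith))
  nlinarith

lemma integral_sector_slice (a : ℝ) :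
    ∫ b in a..(1 - a) / 2,
      3 / 2 * (1 + 2 * (a ^ 2 + a * b + b ^ 2) + 12 * (a ^ 2 + a * b + b ^ 2) ^ 2) =
      79 / 80 + -9 / 4 * a + 9 / 4 * a ^ 2 + -27 / 4 * a ^ 3 + 81 / 16 * a ^ 4 +
        -729 / 10 * a ^ 5 := by
  have h := integral_sum_mul_pow ![3 / 2 + 3 * a ^ 2 + 18 * a ^ 4, 3 * a + 36 * a ^ 3,
    3 + 54 * a ^ 2, 36 * a, 18] a ((1 - a) / 2)
  simp only [Fin.sum_univ_five, Matrix.cons_val] at h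
  convert h using 1
  · congr! 1
    ext b
    norm_num
    ring
  · norm_num
    ring

lemma integral_sector :
    ∫ a in (0 : ℝ)..1 / 3, (79 / 80 + -9 / 4 * a + 9 / 4 * a ^ 2 + -27 / 4 * a ^ 3 +
      81 / 16 * a ^ 4 + -729 / 10 * a ^ 5) = 143 / 720 := by
  have h := integral_sum_mul_pow ![79 / 80, -9 / 4, 9 / 4, -27 / 4, 81 / 16, -729 / 10] 0 (1 / 3)
  simp only [Fin.sum_univ_six, Matrix.cons_val] at h
  convert h using 1
  · congr! 1
    ext a
    norm_num
  · norm_num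

lemma volume_sector_slice_le {a : ℝ} (ha : a ∈ Set.Icc (0 : ℝ) (1 / 3)) :
    volume (Prod.mk a ⁻¹' sector) ≤ ENNReal.ofReal (∫ b in a..(1 - a) / 2,
      3 / 2 * (1 + 2 * (a ^ 2 + a * b + b ^ 2) + 12 * (a ^ 2 + a * b + b ^ 2) ^ 2)) := by
  have ha0 : 0 ≤ a := ha.1
  refine volume_le_of_slices (measurable_prodMk_left measurableSet_sector) (by linarith [ha.2])
    (by fun_prop) (fun b hb => ?_) (fun b _ => ?_) ?_
  · have hb0 : 0 ≤ b := ha0.trans hb.1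
    positivity
  · refine (measure_mono (t := Set.Icc 0 (3 / 2 * (1 + 2 * (a ^ 2 + a * b + b ^ 2) +
      12 * (a ^ 2 + a * b + b ^ 2) ^ 2))) fun w hw => ?_).trans (by rw [Real.volume_Icc, sub_zero])
    have hmem : (a, b, w) ∈ sector := hw
    exact ⟨hmem.2.1.le, le_quartic_of_mem_sector hmem⟩
  · rintro ⟨b, w⟩ ⟨⟨-, hab : a ≤ b, hb : a + 2 * b ≤ 1⟩, -⟩
    exact ⟨hab, by linarith⟩

lemma volume_sector_le : volume sector ≤ ENNReal.ofReal (143 / 720) := by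
  rw [← integral_sector]
  refine volume_le_of_slices measurableSet_sector (by norm_num) (by fun_prop) (fun a ha => ?_)
    (fun a ha => ?_) ?_
  · rw [← integral_sector_slice]
    refine intervalIntegral.integral_nonneg (by linarith [ha.2]) fun b hb => ?_
    have ha0 : 0 ≤ a := ha.1
    have hb0 : 0 ≤ b := ha0.trans hb.1
    positivity
  · rw [← integral_sector_slice]
    exact volume_sector_slice_le ha
  · rintro ⟨a, b, w⟩ ⟨⟨ha : 0 ≤ a, hab : a ≤ b, hb : a + 2 * b ≤ 1⟩, -⟩
    exact ⟨ha, by linarith⟩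

/-- The set that the chart of the frame `e` maps to `sector`. -/
def frameSector (e : Fin 3 → Mink) : Set H3 :=
  {x | (lor x.1 (e 0) ≤ 0 ∧ lor x.1 (e 1) ≤ lor x.1 (e 0) ∧ lor x.1 (e 2) ≤ lor x.1 (e 1)) ∧
    lor x.1 (apex e) ^ 2 - 2 * (lor x.1 (e 0) ^ 2 + lor x.1 (e 0) * lor x.1 (e 1) +
      lor x.1 (e 1) ^ 2) ≤ 3 / 2}

lemma measurableSet_frameSector (e : Fin 3 → Mink) : MeasurableSet (frameSector e) := by
  have hlor : ∀ w, Measurable fun x : H3 => lor x.1 w := fun w =>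
    (continuous_lor_comp continuous_id continuous_const).measurable.comp measurable_subtype_coe
  exact ((measurableSet_le (hlor _) measurable_const).inter
    ((measurableSet_le (hlor _) (hlor _)).inter (measurableSet_le (hlor _) (hlor _)))).inter
    (measurableSet_le (((hlor _).pow_const 2).sub (((((hlor _).pow_const 2).add
      ((hlor _).mul (hlor _))).add ((hlor _).pow_const 2)).const_mul 2)) measurable_const)

lemma Frame.vol_frameSector_le {e : Fin 3 → Mink} (h : Frame e) :
    ENNReal.ofReal (√3) * vol (frameSector e) ≤ ENNReal.ofReal (143 / 720) := by
  rw [← h.volume_chart_image (measurableSet_frameSector e)]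
  refine le_trans ?_ volume_sector_le
  rw [← (measurePreserving_coords 0).measure_preimage measurableSet_sector.nullMeasurableSet]
  refine measure_mono ?_
  rintro _ ⟨x, ⟨⟨h0, h10, h21⟩, hheight⟩, rfl⟩
  have hapex := h.lor_apex_neg x
  have hne := hapex.ne
  refine ⟨⟨?_, ?_, ?_⟩, ?_, ?_⟩
  · exact div_nonneg_of_nonpos h0 hapex.le
  · exact div_le_div_of_nonpos_of_le hapex.le h10
  · change lor x.1 (e 0) / lor x.1 (apex e) + 2 * (lor x.1 (e 1) / lor x.1 (apex e)) ≤ 1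
    rw [← mul_div_assoc, ← add_div, div_le_one_of_neg hapex, lor_apex_right]
    linarith
  · exact sq_pos_of_neg hapex
  · refine le_trans (le_of_eq ?_) hheight
    change lor x.1 (apex e) ^ 2 * (1 - 2 * ((lor x.1 (e 0) / lor x.1 (apex e)) ^ 2 +
      lor x.1 (e 0) / lor x.1 (apex e) * (lor x.1 (e 1) / lor x.1 (apex e)) +
      (lor x.1 (e 1) / lor x.1 (apex e)) ^ 2)) = _
    field_simp

/-- The frame of the vertex of the cube in the octant with signs `s`. -/
noncomputable def cubeFrame (s : Fin 3 → Bool) (i : Fin 3) : Mink :=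
  cubeNormal (if s i then 1 else -1) i

lemma frame_cubeFrame (s : Fin 3 → Bool) : Frame (cubeFrame s) where
  unit i := by
    rw [cubeFrame, lor_cubeNormal_cubeNormal, if_pos rfl]
    split_ifs <;> norm_num
  pair i j hij := by rw [cubeFrame, cubeFrame, lor_cubeNormal_cubeNormal, if_neg hij]
  future := by
    simp only [apex, cubeFrame, cubeNormal, Fin.sum_univ_three, Prod.fst_add]
    positivity

lemma apex_comp_perm (e : Fin 3 → Mink) (π : Equiv.Perm (Fin 3)) : apex (e ∘ π) = apex e :=
  Equiv.sum_comp π e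

lemma Frame.comp_perm {e : Fin 3 → Mink} (h : Frame e) (π : Equiv.Perm (Fin 3)) :
    Frame (e ∘ π) where
  unit i := h.unit (π i)
  pair i j hij := h.pair (π i) (π j) (π.injective.ne hij)
  future := (apex_comp_perm e π).symm ▸ h.future

lemma exists_cubeFrame_abs_eq (x : Mink) :
    ∃ s, ∀ i, |√3 * x.2 i| = x.1 + √2 * lor x (cubeFrame s i) := by
  refine ⟨fun i => decide (0 ≤ √3 * x.2 i), fun i => ?_⟩
  rw [cubeFrame, lor_cubeNormal, mul_div_cancel₀ _ (by positivity)]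
  simp only [decide_eq_true_eq]
  split_ifs with hi
  · rw [abs_of_nonneg hi]
    ring
  · rw [abs_of_neg (not_le.mp hi)]
    ring

/-- This is the equation `lor x x = -1` in the coordinates of the frame. -/
lemma sum_sq_lor_cubeFrame {x : H3} {s : Fin 3 → Bool}
    (hs : ∀ i, |√3 * x.1.2 i| = x.1.1 + √2 * lor x.1 (cubeFrame s i)) :
    2 * ∑ i, lor x.1 (cubeFrame s i) ^ 2 = -3 - 2 * √2 * x.1.1 * lor x.1 (apex (cubeFrame s)) := by
  have hsqrt2 : √2 ^ 2 = 2 := Real.sq_sqrt (by norm_num)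
  have hsq : ∀ i, 3 * x.1.2 i ^ 2 = (x.1.1 + √2 * lor x.1 (cubeFrame s i)) ^ 2 := fun i => by
    rw [← hs, sq_abs, mul_pow, Real.sq_sqrt (by norm_num)]
  have hxx := x.2.1
  rw [lor, real_inner_self_eq_norm_sq, EuclideanSpace.real_norm_sq_eq] at hxx
  rw [lor_apex_right]
  simp only [Fin.sum_univ_three] at hxx ⊢
  have h0 := hsq 0
  have h1 := hsq 1
  have h2 := hsq 2
  simp only [add_sq, mul_pow, hsqrt2] at h0 h1 h2
  linarith

lemma mem_frameSector_cubeFrame {x : H3} (hx : x ∈ P₂) {s : Fin 3 → Bool}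
    (hs : ∀ i, |√3 * x.1.2 i| = x.1.1 + √2 * lor x.1 (cubeFrame s i)) {π : Equiv.Perm (Fin 3)}
    (hπ : Antitone fun i => lor x.1 (cubeFrame s (π i))) : x ∈ frameSector (cubeFrame s ∘ π) := by
  have hneg : ∀ i, lor x.1 (cubeFrame s i) ≤ 0 := fun i =>
    nonpos_of_mul_nonpos_right (by linarith [hs i, mem_P₂.mp hx i]) (show 0 < √2 by positivity)
  refine ⟨⟨hneg _, hπ (Fin.zero_le 1), hπ (by decide : (1 : Fin 3) ≤ 2)⟩, ?_⟩
  have hsum := sum_sq_lor_cubeFrame hs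
  rw [← Equiv.sum_comp π, ← apex_comp_perm _ π, Fin.sum_univ_three] at hsum
  have hapex := ((frame_cubeFrame s).comp_perm π).lor_apex_neg x
  have hlast : 0 ≤ √2 * x.1.1 + 2 * lor x.1 (cubeFrame s (π 2)) := by
    have habs : 0 ≤ √2 * (x.1.1 + √2 * lor x.1 (cubeFrame s (π 2))) := by rw [← hs]; positivity
    linear_combination
      habs + lor x.1 (cubeFrame s (π 2)) * Real.sq_sqrt (zero_le_two : (0 : ℝ) ≤ 2)
  have hmul := mul_nonpos_of_nonneg_of_nonpos hlast hapex.le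
  have hexpand := lor_apex_right x.1 (cubeFrame s ∘ π)
  simp only [Function.comp_apply] at hexpand ⊢
  rw [hexpand] at hmul hsum ⊢
  linarith

lemma P₂_subset_iUnion : P₂ ⊆ ⋃ p : (Fin 3 → Bool) × Equiv.Perm (Fin 3),
    frameSector (cubeFrame p.1 ∘ p.2) := by
  intro x hx
  obtain ⟨s, hs⟩ := exists_cubeFrame_abs_eq x.1
  have hsort := Tuple.monotone_sort fun i => -lor x.1 (cubeFrame s i)
  exact Set.mem_iUnion.mpr ⟨(s, _),
    mem_frameSector_cubeFrame hx hs fun i j hij => neg_le_neg_iff.mp (hsort hij)⟩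

lemma sqrt_three_mul_vol_P₂_lt : ENNReal.ofReal (√3) * vol P₂ < 10 := by
  calc ENNReal.ofReal (√3) * vol P₂
      ≤ ENNReal.ofReal (√3) * ∑ p : (Fin 3 → Bool) × Equiv.Perm (Fin 3),
          vol (frameSector (cubeFrame p.1 ∘ p.2)) := by
        gcongr
        exact (measure_mono P₂_subset_iUnion).trans (measure_iUnion_fintype_le _ _)
    _ ≤ ∑ _p : (Fin 3 → Bool) × Equiv.Perm (Fin 3), ENNReal.ofReal (143 / 720) := by
        rw [Finset.mul_sum]
        exact Finset.sum_le_sum fun p _ => ((frame_cubeFrame p.1).comp_perm p.2).vol_frameSector_le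
    _ = ENNReal.ofReal (143 / 15) := by
        rw [Finset.sum_const, Finset.card_univ, Fintype.card_prod, Fintype.card_perm,
          Fintype.card_fun, Fintype.card_bool, Fintype.card_fin, nsmul_eq_mul,
          ← ENNReal.ofReal_natCast, ← ENNReal.ofReal_mul (by positivity)]
        norm_num [Nat.factorial]
    _ < 10 := by
        rw [← ENNReal.ofReal_ofNat, ENNReal.ofReal_lt_ofReal_iff (by norm_num)]
        norm_num

lemma vol_P₂_lt_top : vol P₂ < ⊤ :=
  ENNReal.lt_top_of_mul_ne_top_right (sqrt_three_mul_vol_P₂_lt.trans ENNReal.ofNat_lt_top).ne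
    (by simp)

lemma vol_P₂_lt_of_ten_le {P : Set H3} (hP : 10 ≤ ENNReal.ofReal (√3) * vol P) :
    vol P₂ < vol P :=
  lt_of_mul_lt_mul_left' (sqrt_three_mul_vol_P₂_lt.trans_le hP)

theorem IsEquiangular.congruent_or_vol_lt {P : Set H3} (hP : IsEquiangular (Real.pi / 3) P) :
    (Congruent P P₁ ∧ vol P = vol P₁) ∨ (Congruent P P₂ ∧ vol P = vol P₂) ∨ vol P₂ < vol P := by
  obtain ⟨N, hN, rfl⟩ := hP.exists_normalSystem
  rcases hN.isTetrahedron_or_isCube_or_ten_le_vol with ⟨e, k, hek, heq⟩ | ⟨e, a, hea, heq⟩ | hten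
  · rw [heq, P₁_eq_framePolyhedron]
    exact .inl (hek.congruent isTetrahedron_tetrahedronNormal)
  · rw [heq, P₂_eq_framePolyhedron]
    exact .inr (.inl (hea.congruent isCube_cubeNormal))
  · exact .inr (.inr (vol_P₂_lt_of_ten_le hten))

end HypPoly

theorem mainTheorem1 :
    HypPoly.IsEquiangular (Real.pi / 3) HypPoly.P₁ ∧
    HypPoly.IsEquiangular (Real.pi / 3) HypPoly.P₂ ∧
    HypPoly.vol HypPoly.P₁ < HypPoly.vol HypPoly.P₂ ∧
    ∀ P : Set HypPoly.H3, HypPoly.IsEquiangular (Real.pi / 3) P →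
      (HypPoly.Congruent P HypPoly.P₁ ∧ HypPoly.vol P = HypPoly.vol HypPoly.P₁) ∨
      (HypPoly.Congruent P HypPoly.P₂ ∧ HypPoly.vol P = HypPoly.vol HypPoly.P₂) ∨
      HypPoly.vol HypPoly.P₂ < HypPoly.vol P :=
  ⟨HypPoly.isEquiangular_P₁ ((HypPoly.vol_P₁_lt_vol_P₂ HypPoly.vol_P₂_lt_top).trans
      HypPoly.vol_P₂_lt_top),
    HypPoly.isEquiangular_P₂ HypPoly.vol_P₂_lt_top,
    HypPoly.vol_P₁_lt_vol_P₂ HypPoly.vol_P₂_lt_top, fun _ hP => hP.congruent_or_vol_lt⟩
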